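/- Consider the state-feedback LQR problem $\dot x=Ax+Bu$, $u=-Kx$, with $A\in\mathbb R^{n\times n}$, $B\in\mathbb R^{n\times m}$, $m,n\ge 1$, a random initial state with $\mathbb E\,x(0)x(0)^{\rm T}=\Sigma$, and $Q,R,\Sigma\succ0$. Let $\mathcal S$ be the set of $K\in\mathbb R^{m\times n}$ for which all eigenvalues of $A-BK$ have negative real part, let $f(K)=\mathbb E\int_0^\infty (x^{\rm T}Qx+u^{\rm T}Ru)\,dt$ for $K\in\mathcal S$, and let $K^*$ minimize $f$ over $\mathcal S$, $z^*=(K^*,0)$. Let $\|\cdot\|$ be the spectral norm, $\|\cdot\|_F$ the Frobenius norm, $\lambda_{\min},\lambda_{\max}$ the extreme eigenvalues, and put $$\xi(\alpha)=\frac{\sqrt n\,\alpha}{\lambda_{\min}(\Sigma)}\Big(\frac{\alpha\|B\|}{\lambda_{\min}(Q)\lambda_{\min}(\Sigma)}+\sqrt{\Big(\frac{\alpha\|B\|}{\lambda_{\min}(Q)\lambda_{\min}(\Sigma)}\Big)^2+\lambda_{\max}(R)}\Big),$$ $$C(\alpha)=\frac{2\alpha}{\lambda_{\min}(Q)}\big(\lambda_{\max}(R)+\sqrt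 n\,\|B\|\,\xi(\alpha)\big),\qquad \mu(\alpha)=\frac{\lambda_{\min}(R)\lambda_{\min}(\Sigma)^2\lambda_{\min}(Q)}{8f(K^*)\big(\|A\|+\frac{\|B\|^2\alpha}{\lambda_{\min}(\Sigma)\lambda_{\min}(R)}\big)^2},$$ $L=C(f(K^*))$, $\kappa=L/\mu(f(K^*))$. Let $K_{\rm init}\in\mathcal S$, $\alpha_0=f(K_{\rm init})$; let $\mathrm{Cv}$ be a convex set with $K^*\in\mathrm{Cv}\subseteq\{K\in\mathcal S: f(K)\le\alpha_0\}$, and let $\bar K_0\in\mathcal S$, $\alpha_1=f(\bar K_0)$, be such that $\mathcal S_0=\{K\in\mathcal S: f(K)\le\alpha_1\}\subseteq\mathrm{Cv}$. For $d,T,\eta>0$ the method with damping $d$, step size $T$ and $\beta=0$ maps $(K_k,p_k)$ to $$p_{k+1}=(1-2dT)p_k-T\nabla f(K_k),\qquad K_{k+1}=K_k+Tp_{k+1}$$ if this $K_{k+1}$ lies in $\mathcal S_0$, and otherwise restarts from $(K_k,-\eta\nabla f(K_k))$. Call $T_{\max}>0$ admissible if for every step size $T\in(0,T_{\max}]$ the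 point $z^*$ is asymptotically stable for this method, with region of attraction containing $\mathcal S_0\times\mathbb R^{m\times n}$. Theorem. For all $0<a_1\le a_2$ and $\ell>0$ there are $c>0$ and $\tau>0$, depending only on $a_1,a_2,\ell$, such that for every problem as above with $L\ge\ell$ and every $d$ with $a_1/\sqrt\kappa\le d\le a_2/\sqrt\kappa$ there is $\eta_0>0$ such that for every $\eta\in(0,\eta_0]$: an admissible $T_{\max}$ exists; and for every admissible $T_{\max}$ and every $T$ with $$0<T\le\min\Big\{\tau,\;T_{\max},\;\frac{-\eta+\sqrt{\eta^2+\frac{8(1-2d\eta)}{C(\alpha_0)}}}{2(1-2d\eta)}\Big\},$$ the iterates from any $(K_0,p_0)$ with $K_0\in\mathcal S_0$ satisfy $$\|(K_k,p_k)-z^*\|_F=\mathcal O\Big(\exp\Big(-\frac{cT}{\sqrt\kappa}k\Big)\Big)\qquad(k\to\infty).$$ -/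

import Mathlib

open MeasureTheory Filter Topology Matrix Asymptotics

noncomputable section

/-- Data of a state-feedback LQR problem: the system `x' = A x + B u`, the weights `Q`, `R`,
the law `law` of the random initial state `x(0)` and its second moment matrix `Sig`. -/
structure SLQR (m n : ℕ) where
  A : Matrix (Fin n) (Fin n) ℝ
  B : Matrix (Fin n) (Fin m) ℝ
  Q : Matrix (Fin n) (Fin n) ℝ
  R : Matrix (Fin m) (Fin m) ℝ
  Sig : Matrix (Fin n) (Fin n) ℝ
  law : Measure (Fin n → ℝ)

/-- Smallest eigenvalue of a real symmetric matrix. -/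
def lamMin {n : ℕ} (M : Matrix (Fin n) (Fin n) ℝ) : ℝ := sInf (spectrum ℝ M)

/-- Largest eigenvalue of a real symmetric matrix. -/
def lamMax {n : ℕ} (M : Matrix (Fin n) (Fin n) ℝ) : ℝ := sSup (spectrum ℝ M)

open scoped Matrix.Norms.L2Operator in
/-- Spectral norm of a matrix. -/
def specNorm {a b : ℕ} (M : Matrix (Fin a) (Fin b) ℝ) : ℝ := ‖M‖

/-- Square of the Frobenius norm of a matrix. -/
def frobSq {a b : ℕ} (M : Matrix (Fin a) (Fin b) ℝ) : ℝ := ∑ i, ∑ j, M i j ^ 2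

/-- Gradient of a function of a matrix for the Frobenius inner product: the matrix of its
partial derivatives. -/
def matGrad {a b : ℕ} (g : Matrix (Fin a) (Fin b) ℝ → ℝ) (K : Matrix (Fin a) (Fin b) ℝ) :
    Matrix (Fin a) (Fin b) ℝ :=
  Matrix.of fun i j => lineDeriv ℝ g K (Matrix.single i j 1)

/-- The pairs `(K, p)` of a gain and a momentum. -/
abbrev GainState (m n : ℕ) : Type := Matrix (Fin m) (Fin n) ℝ × Matrix (Fin m) (Fin n) ℝ

/-- Frobenius norm of the difference of two stacked pairs `(K, p)`. -/
def stateDist {m n : ℕ} (z w : GainState m n) : ℝ :=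
  √(frobSq (z.1 - w.1) + frobSq (z.2 - w.2))

namespace SLQR

variable {m n : ℕ}

/-- Standing assumptions: `Q`, `R`, `Sig` are positive definite, and `Sig = E x(0) x(0)ᵀ`. -/
structure Standing (P : SLQR m n) : Prop where
  posQ : P.Q.PosDef
  posR : P.R.PosDef
  posSig : P.Sig.PosDef
  prob : IsProbabilityMeasure P.law
  integrable : ∀ i j, Integrable (fun x : Fin n → ℝ => x i * x j) P.law
  secondMoment : ∀ i j, ∫ x, x i * x j ∂P.law = P.Sig i j

/-- The set of stabilizing gains: all eigenvalues of `A - B K` have negative real part. -/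
def stab (P : SLQR m n) : Set (Matrix (Fin m) (Fin n) ℝ) :=
  {K | ∀ s ∈ spectrum ℂ ((P.A - P.B * K).map (fun x : ℝ => (x : ℂ))), s.re < 0}

/-- Closed-loop trajectory `x(t)` under `u = -K x`, from `x(0) = x₀`. -/
def traj (P : SLQR m n) (K : Matrix (Fin m) (Fin n) ℝ) (x₀ : Fin n → ℝ) (t : ℝ) : Fin n → ℝ :=
  NormedSpace.exp (t • (P.A - P.B * K)) *ᵥ x₀

/-- Control `u(t) = -K x(t)`. -/
def control (P : SLQR m n) (K : Matrix (Fin m) (Fin n) ℝ) (x₀ : Fin n → ℝ) (t : ℝ) : Fin m → ℝ :=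
  -(K *ᵥ P.traj K x₀ t)

/-- The LQR cost `f(K) = E ∫₀^∞ (xᵀ Q x + uᵀ R u) dt`; it is meant for stabilizing `K` only. -/
def cost (P : SLQR m n) (K : Matrix (Fin m) (Fin n) ℝ) : ℝ :=
  ∫ x₀, (∫ t in Set.Ioi (0 : ℝ),
    (P.traj K x₀ t ⬝ᵥ (P.Q *ᵥ P.traj K x₀ t) +
      P.control K x₀ t ⬝ᵥ (P.R *ᵥ P.control K x₀ t))) ∂P.law

/-- Sublevel set of the cost inside the stabilizing gains. -/
def sublevel (P : SLQR m n) (α : ℝ) : Set (Matrix (Fin m) (Fin n) ℝ) :=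
  {K | K ∈ P.stab ∧ P.cost K ≤ α}

/-- `K` is an optimal stabilizing gain. -/
def IsOptimal (P : SLQR m n) (K : Matrix (Fin m) (Fin n) ℝ) : Prop :=
  K ∈ P.stab ∧ ∀ K' ∈ P.stab, P.cost K ≤ P.cost K'

/-- The quantity `ξ(α)` that enters the smoothness constant. -/
def xi (P : SLQR m n) (α : ℝ) : ℝ :=
  √n * α / lamMin P.Sig *
    (α * specNorm P.B / (lamMin P.Q * lamMin P.Sig) +
      √((α * specNorm P.B / (lamMin P.Q * lamMin P.Sig)) ^ 2 + lamMax P.R))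

/-- The smoothness constant `C(α)`. -/
def smoothConst (P : SLQR m n) (α : ℝ) : ℝ :=
  2 * α / lamMin P.Q * (lamMax P.R + √n * specNorm P.B * P.xi α)

/-- The gradient-domination constant `μ(α)`; `fstar` stands for the optimal value. -/
def plConst (P : SLQR m n) (fstar α : ℝ) : ℝ :=
  lamMin P.R * lamMin P.Sig ^ 2 * lamMin P.Q /
    (8 * fstar * (specNorm P.A + specNorm P.B ^ 2 * α / (lamMin P.Sig * lamMin P.R)) ^ 2)

/-- The condition number `κ = C(f*) / μ(f*)` at the optimal value `f*`. -/
def condNumber (P : SLQR m n) (fstar : ℝ) : ℝ :=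
  P.smoothConst fstar / P.plConst fstar fstar

/-- One step of the semi-implicit Euler discretization:
`p⁺ = (1 - 2 d T) p - T ∇f(K + β p)`, `K⁺ = K + T p⁺`. -/
def euler (P : SLQR m n) (d β T : ℝ) (z : GainState m n) : GainState m n :=
  (z.1 + T • ((1 - 2 * d * T) • z.2 - T • matGrad P.cost (z.1 + β • z.2)),
    (1 - 2 * d * T) • z.2 - T • matGrad P.cost (z.1 + β • z.2))

open Classical in
/-- One step of the restarted method. If the new gain leaves the sublevel set of level `α₁` (a gain
that is not stabilizing has infinite cost), the new gain is discarded and the method is restarted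
from the current gain `K` with momentum `-η ∇f(K)`. -/
def restartStep (P : SLQR m n) (d β T η α₁ : ℝ) (z : GainState m n) : GainState m n :=
  if (P.euler d β T z).1 ∈ P.sublevel α₁ then P.euler d β T z
  else (z.1, -(η • matGrad P.cost z.1))

/-- The iterates `(K_k, p_k)` of the restarted method from `(K_0, p_0) = z`. -/
def iterates (P : SLQR m n) (d β T η α₁ : ℝ) (z : GainState m n) (k : ℕ) : GainState m n :=
  (P.restartStep d β T η α₁)^[k] z

/-- `Tmax` is an admissible maximal step size (for `β = 0`): for every step size `T ∈ (0, Tmax]`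
the point `zs` is asymptotically stable for the restarted method, with region of attraction
containing every `(K, p)` with `K` in the sublevel set of level `α₁` and `p` arbitrary. -/
def IsMaxStep (P : SLQR m n) (d η α₁ : ℝ) (zs : GainState m n) (Tmax : ℝ) : Prop :=
  0 < Tmax ∧ ∀ T : ℝ, 0 < T → T ≤ Tmax →
    (∀ ε : ℝ, 0 < ε → ∃ δ : ℝ, 0 < δ ∧ ∀ z : GainState m n, z.1 ∈ P.sublevel α₁ →
      stateDist z zs < δ → ∀ k : ℕ, stateDist (P.iterates d 0 T η α₁ z k) zs < ε) ∧
    ∀ z : GainState m n, z.1 ∈ P.sublevel α₁ →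
      Tendsto (fun k : ℕ => stateDist (P.iterates d 0 T η α₁ z k) zs) atTop (𝓝 0)

/-- The explicit bound on the step size; `α₀` is the cost of the reference gain `K_init`. -/
def stepBound (P : SLQR m n) (d η α₀ : ℝ) : ℝ :=
  (-η + √(η ^ 2 + 8 * (1 - 2 * d * η) / P.smoothConst α₀)) / (2 * (1 - 2 * d * η))

end SLQR

end

/-! The rate is a local matter. Admissibility of a step size already contains convergence to the
equilibrium, so the exponent is decided by the linearization of the method at the optimal gain.
Global arguments are needed only to show that an admissible maximal step size exists.

Local part. The cost is a trace against solutions of Lyapunov equations and has an exact expansion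
around any stabilizing gain (`cost_sub`). At the optimal gain its linear term disappears, and the
Hessian there is V ↦ 2 R V Y, with Y the integrated second moment of the state (`fderiv_grad`). Its
quadratic form lies between 4μ‖V‖² and L‖V‖² (`plConst_mul_le`, `le_smoothConst_mul`). For a
quadratic objective the undamped semi-implicit Euler step conserves ⟨Hx,x⟩ + ‖p‖² − T⟨Hx,p⟩.
`modEnergy` adapts this quantity to damping and adds a small multiple of d⟨x,p⟩; it then contracts
by a factor 1 − const·d·T (`modEnergy_decay`), and a nonlinear remainder of order o(‖x‖) only halves
the gain (`equilDist_isBigO_of_tendsto`).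

The contraction needs three things: d T small, T² L ≤ 5/2, and d² ≤ D²·4μ; its constant depends on D
alone. The first follows from T ≤ τ and κ ≥ 4, the second from the explicit step bound
(`smoothConst_mul_sq_le`), the third from d² ≤ a₂²μ/L and L ≥ ℓ with D = a₂/(2√ℓ). This is why c and
τ are uniform over all problems.

Global part. For small T the energy f + ‖p‖²/2 decreases, and a step can leave the sublevel set only
if the energy is at least the level α. A restart near the boundary may exceed α slightly, but the
motion then follows the negative initial gradient for a fixed time, cannot exit, and dissipates more
energy than the restart momentum added when η is small. So at most one restart occurs
(`exists_no_restart`), and monotone energy with compactness of the sublevel set gives stability and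
attraction (`exists_maxStep`). Compactness comes from Lyapunov certificates (`isCompact_sublevel`),
the Lipschitz gradient from the convex set between two sublevel sets (`exists_landscape`). If the
level is the optimal value itself, the sublevel set is one point, reached after one step. -/

noncomputable section

/-! ### Energy estimates for the restarted momentum method on an abstract sublevel set. -/

section Momentum

variable {E : Type*} [NormedAddCommGroup E] [InnerProductSpace ℝ E]

/-- One step of the semi-implicit Euler method with damping `d` and step size `T`. -/
def momentumEuler (g : E → E) (d T : ℝ) (z : E × E) : E × E :=
  (z.1 + T • ((1 - 2 * d * T) • z.2 - T • g z.1), (1 - 2 * d * T) • z.2 - T • g z.1)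

open Classical in
/-- One step of the restarted momentum method for a vector field `g` on a region `S`. -/
def momentumStep (g : E → E) (S : Set E) (d T η : ℝ) (z : E × E) : E × E :=
  if (momentumEuler g d T z).1 ∈ S then momentumEuler g d T z else (z.1, -(η • g z.1))

/-- Distance of a pair position, momentum to the equilibrium `(xs, 0)`. -/
def equilDist (xs : E) (z : E × E) : ℝ := √(‖z.1 - xs‖ ^ 2 + ‖z.2‖ ^ 2)

/-- A compact sublevel set `S` of `f`, of level `α`, on which the gradient `g` of `f` is Lipschitz
and vanishes at the minimizer `xs` only; a segment that leaves `S` does so through the level `α`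
in a direction of ascent. -/
structure Landscape (f : E → ℝ) (g : E → E) (S : Set E) (α C : ℝ) (xs : E) : Prop where
  compact : IsCompact S
  mem : xs ∈ S
  le : ∀ x ∈ S, f x ≤ α
  isMin : ∀ x ∈ S, f xs ≤ f x
  strict : ∀ x ∈ S, f x = f xs → x = xs
  cont : ContinuousOn f S
  crit : ∀ x ∈ S, g x = 0 → x = xs
  pos : 0 < C
  descent : ∀ x ∈ S, ∀ y ∈ S, f y ≤ f x + inner ℝ (g x) (y - x) + C * ‖y - x‖ ^ 2
  lipschitz : ∀ x ∈ S, ∀ y ∈ S, ‖g y - g x‖ ≤ C * ‖y - x‖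
  exit : ∀ x ∈ S, ∀ v, x + v ∉ S → ∃ s : ℝ, 0 ≤ s ∧ s ≤ 1 ∧ x + s • v ∈ S ∧
    f (x + s • v) = α ∧ 0 ≤ inner ℝ (g (x + s • v)) v

namespace Landscape

variable {f : E → ℝ} {g : E → E} {S : Set E} {α C : ℝ} {xs : E}

/-- Work of the gradient along one step, for any intermediate point of the step. -/
lemma smul_inner_le (d T : ℝ) (hr : 0 ≤ 1 - 2 * d * T) (G p p' : E)
    (hp' : p' = (1 - 2 * d * T) • p - T • G) :
    T * inner ℝ G p' ≤
      (1 - 2 * d * T) / 2 * ‖p‖ ^ 2 + ((1 - 2 * d * T) / 2 - 1) * ‖p'‖ ^ 2 := by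
  have h1 : T • G = (1 - 2 * d * T) • p - p' := by rw [hp']; abel
  have h2 : T * inner ℝ G p' = (1 - 2 * d * T) * inner ℝ p p' - ‖p'‖ ^ 2 := by
    rw [← real_inner_smul_left, h1, inner_sub_left, real_inner_smul_left,
      real_inner_self_eq_norm_sq]
  have h3 : inner ℝ p p' ≤ 1 / 2 * (‖p‖ ^ 2 + ‖p'‖ ^ 2) := by
    have := norm_sub_sq_real p p'
    have h4 := sq_nonneg ‖p - p'‖
    linarith
  rw [h2]
  nlinarith [mul_le_mul_of_nonneg_left h3 hr]

/-- The update reads T g = (1 − 2dT) p − p', which turns the work of the gradient into a change of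
kinetic energy minus d T (‖p‖² + ‖p'‖²). The second-order error C T²‖p'‖² uses up half of the last
term. -/
lemma energy_step (H : Landscape f g S α C xs) {d T : ℝ} (hT : 0 < T) (hr : 0 ≤ 1 - 2 * d * T)
    (hC : C * T ≤ d / 2) {x p p' : E} (hp' : p' = (1 - 2 * d * T) • p - T • g x) (hx : x ∈ S)
    (hx' : x + T • p' ∈ S) :
    f (x + T • p') + 1 / 2 * ‖p'‖ ^ 2 + d * T * ‖p‖ ^ 2 + d * T / 2 * ‖p'‖ ^ 2 ≤
      f x + 1 / 2 * ‖p‖ ^ 2 := by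
  have h1 := H.descent x hx _ hx'
  rw [add_sub_cancel_left, real_inner_smul_right, norm_smul, mul_pow, Real.norm_eq_abs,
    sq_abs] at h1
  have h2 := smul_inner_le d T hr (g x) p p' hp'
  have h3 : C * (T ^ 2 * ‖p'‖ ^ 2) ≤ d * T / 2 * ‖p'‖ ^ 2 := by
    have : C * T * (T * ‖p'‖ ^ 2) ≤ d / 2 * (T * ‖p'‖ ^ 2) :=
      mul_le_mul_of_nonneg_right hC (by positivity)
    nlinarith
  nlinarith

/-- A step that leaves S crosses the level α at some fraction s of its length. Up to that point the
cost has risen by at most s‖p‖²/2, so the kinetic energy had to pay for the rise. Hence energy below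
α excludes a restart. -/
lemma energy_of_exit (H : Landscape f g S α C xs) {d T : ℝ} (hT : 0 < T) (hd : 0 ≤ d)
    (hr : 0 ≤ 1 - 2 * d * T)
    (hC : C * T ^ 2 ≤ 1 / 2) {x p p' : E} (hp' : p' = (1 - 2 * d * T) • p - T • g x) (hx : x ∈ S)
    (hx' : x + T • p' ∉ S) :
    α ≤ f x + 1 / 2 * ‖p‖ ^ 2 := by
  obtain ⟨s, hs0, hs1, hs, hα, -⟩ := H.exit x hx _ hx'
  have h1 := H.descent x hx _ hs
  rw [add_sub_cancel_left, real_inner_smul_right, real_inner_smul_right, norm_smul, norm_smul,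
    mul_pow, mul_pow, Real.norm_eq_abs, Real.norm_eq_abs, sq_abs, sq_abs, hα] at h1
  have h2 := smul_inner_le d T hr (g x) p p' hp'
  have hdT : 0 ≤ d * T := by positivity
  have h3 : C * (T ^ 2 * ‖p'‖ ^ 2) ≤ 1 / 2 * ‖p'‖ ^ 2 := by
    nlinarith [mul_le_mul_of_nonneg_right hC (sq_nonneg ‖p'‖)]
  have h4 : C * (s ^ 2 * (T ^ 2 * ‖p'‖ ^ 2)) ≤ s * (1 / 2 * ‖p'‖ ^ 2) := by
    have : s ^ 2 ≤ s := by nlinarith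
    have h5 : 0 ≤ C * (T ^ 2 * ‖p'‖ ^ 2) := by have := H.pos; positivity
    calc _ = s ^ 2 * (C * (T ^ 2 * ‖p'‖ ^ 2)) := by ring
      _ ≤ s * (C * (T ^ 2 * ‖p'‖ ^ 2)) := mul_le_mul_of_nonneg_right this h5
      _ ≤ _ := mul_le_mul_of_nonneg_left h3 hs0
  have h6 : s * (T * inner ℝ (g x) p') + s * (1 / 2 * ‖p'‖ ^ 2) ≤ s * (1 / 2 * ‖p‖ ^ 2) := by
    rw [← mul_add]
    refine mul_le_mul_of_nonneg_left ?_ hs0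
    nlinarith [mul_nonneg hdT (sq_nonneg ‖p‖), mul_nonneg hdT (sq_nonneg ‖p'‖)]
  have h7 : s * (1 / 2 * ‖p‖ ^ 2) ≤ 1 * (1 / 2 * ‖p‖ ^ 2) :=
    mul_le_mul_of_nonneg_right hs1 (by positivity)
  linarith

/-- Total energy of a state. -/
def energy (f : E → ℝ) (z : E × E) : ℝ := f z.1 + 1 / 2 * ‖z.2‖ ^ 2

lemma _root_.momentumStep_of_mem {d T η : ℝ} {z : E × E} (h : (momentumEuler g d T z).1 ∈ S) :
    momentumStep g S d T η z = momentumEuler g d T z := if_pos h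

lemma _root_.momentumStep_of_notMem {d T η : ℝ} {z : E × E} (h : (momentumEuler g d T z).1 ∉ S) :
    momentumStep g S d T η z = (z.1, -(η • g z.1)) := if_neg h

lemma _root_.momentumStep_fst_mem {d T η : ℝ} {z : E × E} (hz : z.1 ∈ S) :
    (momentumStep g S d T η z).1 ∈ S := by
  by_cases h : (momentumEuler g d T z).1 ∈ S
  · rwa [momentumStep_of_mem h]
  · rwa [momentumStep_of_notMem h]

lemma _root_.momentumStep_iterate_fst_mem {d T η : ℝ} {z : E × E} (hz : z.1 ∈ S) (k : ℕ) :
    ((momentumStep g S d T η)^[k] z).1 ∈ S := by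
  induction k with
  | zero => exact hz
  | succ k ih => rw [Function.iterate_succ_apply']; exact momentumStep_fst_mem ih

lemma energy_euler (H : Landscape f g S α C xs) {d T : ℝ} (hT : 0 < T) (hr : 2 * d * T ≤ 1 / 2)
    (hC : C * T ≤ d / 2) {z : E × E} (hz : z.1 ∈ S) (h : (momentumEuler g d T z).1 ∈ S) :
    energy f (momentumEuler g d T z) + d * T * ‖z.2‖ ^ 2
      + d * T / 2 * ‖(momentumEuler g d T z).2‖ ^ 2 ≤ energy f z :=
  H.energy_step hT (by linarith) hC rfl hz h

lemma euler_mem_of_energy_lt (H : Landscape f g S α C xs) {d T : ℝ} (hd : 0 < d) (hT : 0 < T)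
    (hr : 2 * d * T ≤ 1 / 2) (hC : C * T ≤ d / 2) {z : E × E} (hz : z.1 ∈ S)
    (hV : energy f z < α) : (momentumEuler g d T z).1 ∈ S := by
  by_contra h
  have : C * T ^ 2 ≤ 1 / 2 := by nlinarith
  exact absurd (H.energy_of_exit hT hd.le (by linarith) this rfl hz h) (not_le.2 hV)

lemma iterate_of_energy_lt (H : Landscape f g S α C xs) {d T η : ℝ} (hd : 0 < d) (hT : 0 < T)
    (hr : 2 * d * T ≤ 1 / 2) (hC : C * T ≤ d / 2) {z : E × E} (hz : z.1 ∈ S)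
    (hV : energy f z < α) (k : ℕ) :
    (momentumEuler g d T ((momentumStep g S d T η)^[k] z)).1 ∈ S ∧
      energy f ((momentumStep g S d T η)^[k] z) ≤ energy f z := by
  induction k with
  | zero => exact ⟨H.euler_mem_of_energy_lt hd hT hr hC hz hV, le_rfl⟩
  | succ k ih =>
    have hk : ((momentumStep g S d T η)^[k] z).1 ∈ S := momentumStep_iterate_fst_mem hz k
    have h1 : energy f ((momentumStep g S d T η)^[k + 1] z) ≤ energy f z := by
      rw [Function.iterate_succ_apply', momentumStep_of_mem ih.1]
      have := H.energy_euler hT hr hC hk ih.1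
      have h2 : 0 ≤ d * T * ‖((momentumStep g S d T η)^[k] z).2‖ ^ 2 := by positivity
      have h3 : 0 ≤ d * T / 2 *
        ‖(momentumEuler g d T ((momentumStep g S d T η)^[k] z)).2‖ ^ 2 := by positivity
      linarith [ih.2]
    exact ⟨H.euler_mem_of_energy_lt hd hT hr hC (momentumStep_iterate_fst_mem hz _)
      (h1.trans_lt hV), h1⟩

/-- A vector close to `-σ G` is a direction of descent for every covector close to `G`. -/
lemma inner_neg_of_near {G G' p : E} {γ σ : ℝ} (hγ : 0 < γ) (hσ : 0 < σ) (hG : γ ≤ ‖G‖)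
    (hG' : ‖G' - G‖ ≤ γ / 4) (hp : ‖p + σ • G‖ ≤ γ / 4 * σ) : inner ℝ G' p < 0 := by
  have e : inner ℝ G' p = -σ * ‖G‖ ^ 2 + inner ℝ G (p + σ • G) - σ * inner ℝ (G' - G) G
      + inner ℝ (G' - G) (p + σ • G) := by
    simp only [inner_add_right, inner_sub_left, real_inner_smul_right, real_inner_self_eq_norm_sq]
    ring
  have h1 : inner ℝ G (p + σ • G) ≤ ‖G‖ * (γ / 4 * σ) :=
    (real_inner_le_norm _ _).trans (by gcongr)
  have h2 : -(γ / 4 * ‖G‖) ≤ inner ℝ (G' - G) G :=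
    (abs_le.1 ((abs_real_inner_le_norm _ _).trans
      (mul_le_mul_of_nonneg_right hG' (norm_nonneg _)))).1
  have h3 : inner ℝ (G' - G) (p + σ • G) ≤ γ / 4 * (γ / 4 * σ) :=
    (real_inner_le_norm _ _).trans (by gcongr)
  have h4 : γ * ‖G‖ ≤ ‖G‖ ^ 2 := by nlinarith
  have h5 : γ * γ ≤ ‖G‖ ^ 2 := by nlinarith
  have h6 : 0 < ‖G‖ ^ 2 := by nlinarith
  rw [e]
  nlinarith [mul_le_mul_of_nonneg_left h2 hσ.le, mul_le_mul_of_nonneg_left h4 hσ.le,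
    mul_le_mul_of_nonneg_left h5 hσ.le, mul_pos hσ h6]

set_option maxHeartbeats 800000 in
/-- One step of the motion that starts from rest near the level `α`: the momentum `p` stays close
to a multiple `-σ G` of the initial gradient `G`, and the step does not leave `S`. -/
lemma step_near (H : Landscape f g S α C xs) {d T t γ B : ℝ} (hd : 0 < d)
    (hT : 0 < T) (hr : 2 * d * T ≤ 1 / 2) (hC : C * T ≤ d / 2) (hγ : 0 < γ) (ht : 0 < t)
    (ht1 : t ≤ 1) (htd : 8 * d * t ≤ 1) (hTt : T ≤ t) (htC : C * (12 * t * B) ≤ γ / 4)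
    {x₀ : E} (hx₀ : x₀ ∈ S) (hγG : γ ≤ ‖g x₀‖) (hB : ‖g x₀‖ ≤ B)
    {z : E × E} (hz : z.1 ∈ S) {σ a : ℝ} (hσ : 0 < σ) (hσt : σ ≤ 2 * t) (ha : a ≤ t)
    (hp : ‖z.2 + σ • g x₀‖ ≤ γ / 4 * σ) (hdist : ‖z.1 - x₀‖ ≤ a * (6 * t * B)) :
    (momentumEuler g d T z).1 ∈ S ∧
    ∃ σ' : ℝ, σ + T / 2 ≤ σ' ∧ σ' ≤ σ + T ∧
      ‖(momentumEuler g d T z).2 + σ' • g x₀‖ ≤ γ / 4 * σ' ∧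
      ‖(momentumEuler g d T z).1 - x₀‖ ≤ (a + T) * (6 * t * B) ∧
      energy f (momentumEuler g d T z) + d * γ ^ 2 / 12 * σ' ^ 3 ≤
        energy f z + d * γ ^ 2 / 12 * σ ^ 3 := by
  obtain ⟨p', hp'⟩ : ∃ p', p' = (1 - 2 * d * T) • z.2 - T • g z.1 := ⟨_, rfl⟩
  have hE : momentumEuler g d T z = (z.1 + T • p', p') := by rw [hp']; rfl
  have hB0 : 0 < B := hγ.trans_le (hγG.trans hB)
  have hCp := H.pos
  set σ' := (1 - 2 * d * T) * σ + T with hσ'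
  have near : ∀ y ∈ S, ‖y - x₀‖ ≤ (2 * t) * (6 * t * B) → ‖g y - g x₀‖ ≤ γ / 4 := by
    intro y hy hyd
    refine (H.lipschitz x₀ hx₀ y hy).trans (le_trans ?_ htC)
    refine mul_le_mul_of_nonneg_left (hyd.trans ?_) hCp.le
    nlinarith [mul_pos ht hB0]
  have hg1 : ‖g z.1 - g x₀‖ ≤ γ / 4 := near _ hz (hdist.trans (by gcongr; linarith))
  have hr0 : 0 ≤ 1 - 2 * d * T := by linarith
  have hs1 : σ + T / 2 ≤ σ' := by
    have : 2 * d * σ ≤ 1 / 2 := by nlinarith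
    rw [hσ']; nlinarith
  have hs2 : σ' ≤ σ + T := by
    rw [hσ']; nlinarith [mul_pos (mul_pos hd hT) hσ]
  have hσ'0 : 0 < σ' := by linarith
  have hnear : ‖p' + σ' • g x₀‖ ≤ γ / 4 * σ' := by
    have : p' + σ' • g x₀ = (1 - 2 * d * T) • (z.2 + σ • g x₀) - T • (g z.1 - g x₀) := by
      rw [hp', hσ']; module
    rw [this]
    refine (norm_sub_le _ _).trans ?_
    rw [norm_smul, norm_smul, Real.norm_of_nonneg hr0, Real.norm_of_nonneg hT.le, hσ']
    nlinarith [mul_le_mul_of_nonneg_left hp hr0, mul_le_mul_of_nonneg_left hg1 hT.le]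
  have hnorm : ‖p'‖ ≤ 6 * t * B := by
    have h1 : ‖p'‖ ≤ ‖p' + σ' • g x₀‖ + ‖σ' • g x₀‖ := by
      simpa using norm_sub_le (p' + σ' • g x₀) (σ' • g x₀)
    rw [norm_smul, Real.norm_of_nonneg hσ'0.le] at h1
    have h2 : σ' ≤ 3 * t := by linarith
    have h3 : ‖p'‖ ≤ σ' * (2 * B) := by nlinarith
    nlinarith
  have hnorm2 : 3 / 4 * γ * σ' ≤ ‖p'‖ := by
    have h1 : ‖σ' • g x₀‖ ≤ ‖p' + σ' • g x₀‖ + ‖p'‖ := by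
      simpa using norm_sub_le (p' + σ' • g x₀) p'
    rw [norm_smul, Real.norm_of_nonneg hσ'0.le] at h1
    nlinarith
  have hpos : 0 ≤ 6 * t * B := by positivity
  have hdist' : ∀ s : ℝ, 0 ≤ s → s ≤ 1 → ‖z.1 + s • T • p' - x₀‖ ≤ (a + T) * (6 * t * B) := by
    intro s hs0 hs
    have : z.1 + s • T • p' - x₀ = (z.1 - x₀) + s • T • p' := by abel
    rw [this]
    refine (norm_add_le _ _).trans ?_
    rw [norm_smul, norm_smul, Real.norm_of_nonneg hs0, Real.norm_of_nonneg hT.le]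
    have : s * (T * ‖p'‖) ≤ 1 * (T * (6 * t * B)) := by gcongr
    linarith
  -- At an exit point the gradient would make a nonnegative product with p', but it is close to G
  -- while p' is close to −σ' G.
  have hmem : z.1 + T • p' ∈ S := by
    by_contra hcon
    obtain ⟨s, hs0, hs1', hs, -, hin⟩ := H.exit _ hz _ hcon
    have h1 : ‖g (z.1 + s • T • p') - g x₀‖ ≤ γ / 4 :=
      near _ hs ((hdist' s hs0 hs1').trans (by gcongr; linarith))
    have h2 := inner_neg_of_near hγ hσ'0 hγG h1 hnear
    rw [real_inner_smul_right] at hin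
    nlinarith
  refine ⟨by rw [hE]; exact hmem, σ', hs1, hs2, by rw [hE]; exact hnear, ?_, ?_⟩
  · rw [hE]
    simpa using hdist' 1 zero_le_one le_rfl
  · have h1 := H.energy_euler hT hr hC hz (by rw [hE]; exact hmem)
    rw [hE] at h1 ⊢
    have h2 : 0 ≤ d * T * ‖z.2‖ ^ 2 := by positivity
    have h3 : (3 / 4 * γ * σ') ^ 2 ≤ ‖p'‖ ^ 2 := by gcongr
    -- The dissipation d T‖p'‖²/2 is at least (9/32) d T γ² σ'², which dominates d γ²/12 times the
    -- increment of σ³. Summed over the steps it telescopes to a cubic in σ.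
    have h4 : σ' ^ 3 - σ ^ 3 ≤ T * (3 * σ' ^ 2) := by
      have h5 : σ' ^ 2 + σ' * σ + σ ^ 2 ≤ 3 * σ' ^ 2 := by
        have hle : σ ≤ σ' := by linarith
        have e1 : σ' * σ ≤ σ' * σ' := by gcongr
        have e2 : σ ^ 2 ≤ σ' ^ 2 := by gcongr
        linarith [sq σ']
      calc σ' ^ 3 - σ ^ 3 = (σ' - σ) * (σ' ^ 2 + σ' * σ + σ ^ 2) := by ring
        _ ≤ T * (3 * σ' ^ 2) := by
          apply mul_le_mul _ h5 (by positivity) hT.le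
          linarith
    have h6 : d * γ ^ 2 / 12 * (σ' ^ 3 - σ ^ 3) ≤ d * γ ^ 2 / 12 * (T * (3 * σ' ^ 2)) :=
      mul_le_mul_of_nonneg_left h4 (by positivity)
    have h7 : d * T / 2 * (3 / 4 * γ * σ') ^ 2 ≤ d * T / 2 * ‖p'‖ ^ 2 :=
      mul_le_mul_of_nonneg_left h3 (by positivity)
    have h8 : 0 ≤ d * T * γ ^ 2 * σ' ^ 2 := by positivity
    have h1' : energy f (z.1 + T • p', p') + d * T / 2 * ‖p'‖ ^ 2 ≤ energy f z := by
      simp only at h1; linarith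
    linarith

end Landscape
end Momentum

/-! ### At most one restart; stability and attraction of the equilibrium. -/

section Momentum

variable {E : Type*} [NormedAddCommGroup E] [InnerProductSpace ℝ E]

namespace Landscape

variable {f : E → ℝ} {g : E → E} {S : Set E} {α C : ℝ} {xs : E}

lemma continuousOn_grad (H : Landscape f g S α C xs) : ContinuousOn g S := by
  have : LipschitzOnWith C.toNNReal g S :=
    LipschitzOnWith.of_dist_le_mul fun x hx y hy => by
      rw [dist_eq_norm, dist_eq_norm, Real.coe_toNNReal _ H.pos.le]
      exact H.lipschitz y hy x hx
  exact this.continuousOn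

lemma exists_le_grad (H : Landscape f g S α C xs) {K : Set E} (hK : IsCompact K) (hKS : K ⊆ S)
    (hxs : xs ∉ K) : ∃ γ : ℝ, 0 < γ ∧ ∀ x ∈ K, γ ≤ ‖g x‖ := by
  rcases K.eq_empty_or_nonempty with rfl | hne
  · exact ⟨1, one_pos, by simp⟩
  · obtain ⟨x, hx, hmin⟩ := hK.exists_isMinOn hne (H.continuousOn_grad.mono hKS).norm
    refine ⟨‖g x‖, norm_pos_iff.2 fun h => hxs (H.crit x (hKS hx) h ▸ hx), fun y hy => hmin hy⟩

lemma exists_le_value (H : Landscape f g S α C xs) {K : Set E} (hK : IsCompact K) (hKS : K ⊆ S)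
    (hxs : xs ∉ K) : ∃ γ : ℝ, 0 < γ ∧ ∀ x ∈ K, f xs + γ ≤ f x := by
  rcases K.eq_empty_or_nonempty with rfl | hne
  · exact ⟨1, one_pos, by simp⟩
  · obtain ⟨x, hx, hmin⟩ := hK.exists_isMinOn hne (H.cont.mono hKS)
    have h1 : f xs < f x := lt_of_le_of_ne (H.isMin x (hKS hx))
      fun h => hxs (H.strict x (hKS hx) h.symm ▸ hx)
    exact ⟨f x - f xs, by linarith, fun y hy => by have : f x ≤ f y := hmin hy; linarith⟩

lemma isCompact_diff_ball (H : Landscape f g S α C xs) (ε : ℝ) :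
    IsCompact (S \ Metric.ball xs ε) := H.compact.diff Metric.isOpen_ball

/-- After a restart with a small enough momentum the method never restarts again. -/
lemma exists_no_restart (H : Landscape f g S α C xs) (hα : f xs < α) {d : ℝ} (hd : 0 < d) :
    ∃ η₀ : ℝ, 0 < η₀ ∧ ∃ Tm : ℝ, 0 < Tm ∧ ∀ η : ℝ, 0 < η → η ≤ η₀ → ∀ T : ℝ, 0 < T → T ≤ Tm →
      ∀ x ∈ S, ∀ k : ℕ,
        (momentumEuler g d T ((momentumStep g S d T η)^[k] (x, -(η • g x)))).1 ∈ S := by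
  -- The gradient is bounded away from zero on the upper half of the levels, the only place where a
  -- restart can give energy at least α.
  obtain ⟨γ, hγ, hγS⟩ := H.exists_le_grad (K := S ∩ f ⁻¹' Set.Ici ((α + f xs) / 2))
    (H.compact.of_isClosed_subset (H.cont.preimage_isClosed_of_isClosed H.compact.isClosed
      isClosed_Ici) Set.inter_subset_left) Set.inter_subset_left
    (fun h => by have : (α + f xs) / 2 ≤ f xs := h.2; linarith)
  obtain ⟨B₀, hB₀⟩ := H.compact.exists_bound_of_continuousOn H.continuousOn_grad
  set B := max B₀ 1 with hBdef
  have hB1 : 1 ≤ B := le_max_right _ _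
  have hB : ∀ x ∈ S, ‖g x‖ ≤ B := fun x hx => (hB₀ x hx).trans (le_max_left _ _)
  have hC := H.pos
  -- A time span, independent of η and T, during which the gradient changes by at most γ/4 along the
  -- motion.
  obtain ⟨t, ht, ht1, htd, htC⟩ : ∃ t : ℝ, 0 < t ∧ t ≤ 1 ∧ 8 * d * t ≤ 1 ∧
      C * (12 * t * B) ≤ γ / 4 := by
    refine ⟨min 1 (min (1 / (8 * d)) (γ / 4 / (C * 12 * B))), by positivity, min_le_left _ _, ?_, ?_⟩
    · have : min 1 (min (1 / (8 * d)) (γ / 4 / (C * 12 * B))) ≤ 1 / (8 * d) :=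
        (min_le_right _ _).trans (min_le_left _ _)
      rwa [le_div_iff₀' (by positivity)] at this
    · have : min 1 (min (1 / (8 * d)) (γ / 4 / (C * 12 * B))) ≤ γ / 4 / (C * 12 * B) :=
        (min_le_right _ _).trans (min_le_right _ _)
      rw [le_div_iff₀ (by positivity)] at this
      linarith
  set c := d * γ ^ 2 / 12 with hc
  have hc0 : 0 < c := by positivity
  -- A restart adds at most η B²/2 to the energy, and the span t removes at least c (t/2)³ − c η³;
  -- the strict inequality makes the loss win. The last inequality puts x in the upper half of the
  -- levels as soon as the restarted energy reaches α.
  obtain ⟨η₀, hη₀, hη1, hη2, hη3⟩ : ∃ η₀ : ℝ, 0 < η₀ ∧ η₀ ≤ t ∧ η₀ * (B ^ 2 + c) < c * (t / 2) ^ 3 ∧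
      η₀ * B ^ 2 ≤ (α - f xs) := by
    have h1 : 0 < α - f xs := by linarith
    refine ⟨min t (min (c * (t / 2) ^ 3 / (2 * (B ^ 2 + c))) ((α - f xs) / B ^ 2)),
      by positivity, min_le_left _ _, ?_, ?_⟩
    · have : min t (min (c * (t / 2) ^ 3 / (2 * (B ^ 2 + c))) ((α - f xs) / B ^ 2)) ≤
        c * (t / 2) ^ 3 / (2 * (B ^ 2 + c)) := (min_le_right _ _).trans (min_le_left _ _)
      rw [le_div_iff₀ (by positivity)] at this
      have h2 : 0 < c * (t / 2) ^ 3 := by positivity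
      linarith
    · have : min t (min (c * (t / 2) ^ 3 / (2 * (B ^ 2 + c))) ((α - f xs) / B ^ 2)) ≤
        ((α - f xs) / B ^ 2) := (min_le_right _ _).trans (min_le_right _ _)
      rwa [le_div_iff₀ (by positivity)] at this
  refine ⟨η₀, hη₀, min t (min (1 / (4 * d)) (d / 2 / C)), by positivity, ?_⟩
  intro η hη hηle T hT hTle x hx
  have hTt : T ≤ t := hTle.trans (min_le_left _ _)
  have hr : 2 * d * T ≤ 1 / 2 := by
    have : T ≤ 1 / (4 * d) := hTle.trans ((min_le_right _ _).trans (min_le_left _ _))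
    rw [le_div_iff₀ (by positivity)] at this
    linarith
  have hCT : C * T ≤ d / 2 := by
    have : T ≤ d / 2 / C := hTle.trans ((min_le_right _ _).trans (min_le_right _ _))
    rwa [le_div_iff₀' (by positivity)] at this
  set F := momentumStep g S d T η with hF
  set z₀ : E × E := (x, -(η • g x)) with hz₀
  have hV0 : energy f z₀ ≤ f x + 1 / 2 * (η * B ^ 2) := by
    have : ‖-(η • g x)‖ ^ 2 ≤ η * B ^ 2 := by
      rw [norm_neg, norm_smul, Real.norm_of_nonneg hη.le, mul_pow]
      have h1 : η ^ 2 ≤ η := by nlinarith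
      have h2 : ‖g x‖ ^ 2 ≤ B ^ 2 := by gcongr; exact hB x hx
      gcongr
    simp only [energy, hz₀]
    linarith
  have hηB : η * B ^ 2 ≤ η₀ * B ^ 2 := by gcongr
  by_cases hlt : energy f z₀ < α
  · exact fun k => (H.iterate_of_energy_lt hd hT hr hCT (z := z₀) hx hlt k).1
  have hγx : γ ≤ ‖g x‖ := hγS x ⟨hx, show (α + f xs) / 2 ≤ f x by linarith⟩
  -- Here k T is the elapsed time and σ the effective duration of the push along the negative
  -- initial gradient; damping takes away at most half of each increment of σ.
  have inv : ∀ k : ℕ, k * T ≤ t + T → ∃ σ : ℝ, η + k * T / 2 ≤ σ ∧ σ ≤ η + k * T ∧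
      ‖(F^[k] z₀).2 + σ • g x‖ ≤ γ / 4 * σ ∧ ‖(F^[k] z₀).1 - x‖ ≤ (k * T) * (6 * t * B) ∧
      energy f (F^[k] z₀) + c * σ ^ 3 ≤ energy f z₀ + c * η ^ 3 ∧
      ∀ j < k, (momentumEuler g d T (F^[j] z₀)).1 ∈ S := by
    intro k
    induction k with
    | zero =>
      intro _
      refine ⟨η, by simp, by simp, ?_, by simp [hz₀], by simp, by simp⟩
      simp only [Function.iterate_zero, id, hz₀, neg_add_cancel, norm_zero]
      positivity
    | succ k ih =>
      intro hk
      push_cast at hk ⊢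
      have hkt : k * T ≤ t := by linarith
      obtain ⟨σ, h1, h2, h3, h4, h5, h6⟩ := ih (by linarith)
      have hkT : 0 ≤ k * T := by positivity
      obtain ⟨hm, σ', g1, g2, g3, g4, g5⟩ := H.step_near hd hT hr hCT hγ ht ht1 htd hTt htC hx hγx
        (hB x hx) (z := F^[k] z₀) (momentumStep_iterate_fst_mem hx k)
        (σ := σ) (a := k * T) (by linarith) (by linarith) hkt h3 h4
      rw [← hc] at g5
      refine ⟨σ', by linarith, by linarith, ?_⟩
      rw [Function.iterate_succ_apply', hF, momentumStep_of_mem hm]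
      refine ⟨g3, by convert g4 using 2; ring, by linarith, ?_⟩
      intro j hj
      rcases Nat.lt_succ_iff_lt_or_eq.1 hj with h | rfl
      · exact h6 j h
      · exact hm
  -- The first step at which the elapsed time reaches t. It can overshoot by one step, hence the
  -- bound t + T in `inv`.
  set N := ⌈t / T⌉₊ with hN
  have hN1 : t ≤ N * T := by
    have := Nat.le_ceil (t / T)
    rwa [div_le_iff₀ hT] at this
  have hN2 : N * T ≤ t + T := by
    have := Nat.ceil_lt_add_one (a := t / T) (by positivity)
    have h1 : (N : ℝ) * T ≤ (t / T + 1) * T := by gcongr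
    rwa [add_mul, div_mul_cancel₀ _ hT.ne', one_mul] at h1
  obtain ⟨σ, h1, h2, h3, h4, h5, h6⟩ := inv N hN2
  have hVN : energy f (F^[N] z₀) < α := by
    have e1 : (t / 2) ^ 3 ≤ σ ^ 3 := by gcongr; linarith
    have e2 : η ^ 3 ≤ η := by
      have : η ≤ 1 := by linarith
      calc η ^ 3 = η * η ^ 2 := by ring
        _ ≤ η * 1 := by gcongr; nlinarith
        _ = η := mul_one _
    have e3 : c * (t / 2) ^ 3 ≤ c * σ ^ 3 := by gcongr
    have e4 : c * η ^ 3 ≤ η * c := by rw [mul_comm η]; gcongr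
    have e5 : η * (B ^ 2 + c) ≤ η₀ * (B ^ 2 + c) := by gcongr
    have e6 := H.le x hx
    have e7 : 0 ≤ η * B ^ 2 := by positivity
    linarith
  intro k
  rcases lt_or_ge k N with hk | hk
  · exact h6 k hk
  · have := (H.iterate_of_energy_lt (η := η) hd hT hr hCT (momentumStep_iterate_fst_mem hx N)
      hVN (k - N)).1
    rwa [← Function.iterate_add_apply, Nat.sub_add_cancel hk] at this

lemma equilDist_tendsto {E : Type*} [NormedAddCommGroup E] {xs : E} {z : ℕ → E × E}
    (h1 : Tendsto (fun k => (z k).1) atTop (𝓝 xs))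
    (h2 : Tendsto (fun k => (z k).2) atTop (𝓝 0)) :
    Tendsto (fun k => equilDist xs (z k)) atTop (𝓝 0) := by
  have := (((h1.sub_const xs).norm.pow 2).add (h2.norm.pow 2)).sqrt
  simpa [equilDist] using this

/-- Without restarts the method converges to the equilibrium. -/
lemma tendsto_of_no_restart (H : Landscape f g S α C xs) {d T : ℝ} (hd : 0 < d) (hT : 0 < T)
    (hr : 2 * d * T ≤ 1 / 2) (hC : C * T ≤ d / 2) {z : ℕ → E × E} (hz : ∀ k, (z k).1 ∈ S)
    (hs : ∀ k, z (k + 1) = momentumEuler g d T (z k)) :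
    Tendsto (fun k => equilDist xs (z k)) atTop (𝓝 0) := by
  have hstep : ∀ k, energy f (z (k + 1)) + d * T * ‖(z k).2‖ ^ 2 ≤ energy f (z k) := by
    intro k
    have h1 := H.energy_euler hT hr hC (hz k) (by rw [← hs]; exact hz (k + 1))
    rw [← hs] at h1
    have h2 : 0 ≤ d * T / 2 * ‖(z (k + 1)).2‖ ^ 2 := by positivity
    linarith
  have hdT : 0 < d * T := by positivity
  have hanti : Antitone fun k => energy f (z k) := antitone_nat_of_succ_le fun k => by
    have := hstep k
    have h2 : 0 ≤ d * T * ‖(z k).2‖ ^ 2 := by positivity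
    linarith
  have hbdd : BddBelow (Set.range fun k => energy f (z k)) := by
    refine ⟨f xs, ?_⟩
    rintro _ ⟨k, rfl⟩
    have h1 := H.isMin _ (hz k)
    have h2 : 0 ≤ 1 / 2 * ‖(z k).2‖ ^ 2 := by positivity
    simp only [energy]
    linarith
  have hlim := tendsto_atTop_ciInf hanti hbdd
  have hp2 : Tendsto (fun k => ‖(z k).2‖ ^ 2) atTop (𝓝 0) := by
    have h1 := (hlim.sub (hlim.comp (tendsto_add_atTop_nat 1))).div_const (d * T)
    rw [sub_self, zero_div] at h1
    refine squeeze_zero (fun k => sq_nonneg _) (fun k => ?_) h1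
    rw [le_div_iff₀ hdT]
    have := hstep k
    simp only [Function.comp]
    linarith
  have hp : Tendsto (fun k => (z k).2) atTop (𝓝 0) := by
    rw [tendsto_zero_iff_norm_tendsto_zero]
    simpa [Real.sqrt_sq] using hp2.sqrt
  -- The update, solved for the gradient, expresses it through two successive momenta, which both
  -- tend to zero.
  have hg : Tendsto (fun k => g (z k).1) atTop (𝓝 0) := by
    have h1 := ((hp.const_smul (1 - 2 * d * T)).sub (hp.comp (tendsto_add_atTop_nat 1))).const_smul
      T⁻¹
    simp only [smul_zero, sub_zero] at h1
    refine h1.congr fun k => ?_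
    simp only [Function.comp, hs, momentumEuler, sub_sub_cancel]
    rw [inv_smul_smul₀ hT.ne']
  refine equilDist_tendsto ?_ hp
  rw [Metric.tendsto_atTop']
  intro ε hε
  obtain ⟨γ, hγ, hγS⟩ := H.exists_le_grad (H.isCompact_diff_ball ε) Set.sdiff_subset
    (by simp [hε])
  have h1 := hg.norm
  rw [norm_zero] at h1
  obtain ⟨N, hN⟩ := eventually_atTop.1 (h1.eventually (gt_mem_nhds hγ))
  refine ⟨N, fun k hk => ?_⟩
  by_contra hcon
  exact absurd (hγS _ ⟨hz k, hcon⟩) (not_le.2 (hN k hk.le))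

lemma tendsto_iterate (H : Landscape f g S α C xs) {d T η : ℝ} (hd : 0 < d) (hT : 0 < T)
    (hr : 2 * d * T ≤ 1 / 2) (hC : C * T ≤ d / 2)
    (hno : ∀ x ∈ S, ∀ k : ℕ,
      (momentumEuler g d T ((momentumStep g S d T η)^[k] (x, -(η • g x)))).1 ∈ S)
    {z : E × E} (hz : z.1 ∈ S) :
    Tendsto (fun k => equilDist xs ((momentumStep g S d T η)^[k] z)) atTop (𝓝 0) := by
  set F := momentumStep g S d T η with hF
  -- By `hno` the first restart is also the last, so some tail is a pure Euler sequence.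
  have key : ∃ N, ∀ k, (momentumEuler g d T (F^[k + N] z)).1 ∈ S := by
    by_cases h : ∀ k, (momentumEuler g d T (F^[k] z)).1 ∈ S
    · exact ⟨0, h⟩
    · push Not at h
      obtain ⟨N, hN⟩ := h
      refine ⟨N + 1, fun k => ?_⟩
      rw [Function.iterate_add_apply, Function.iterate_succ_apply', hF, momentumStep_of_notMem hN]
      exact hno _ (momentumStep_iterate_fst_mem hz N) k
  obtain ⟨N, hN⟩ := key
  rw [← tendsto_add_atTop_iff_nat N]
  refine H.tendsto_of_no_restart hd hT hr hC (fun k => momentumStep_iterate_fst_mem hz _)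
    fun k => ?_
  rw [show k + 1 + N = k + N + 1 by ring, Function.iterate_succ_apply', hF,
    momentumStep_of_mem (hN k)]

/-- Energy below α excludes restarts and cannot grow, and outside a ball around the minimizer
compactness leaves a positive gap in the value. -/
lemma stable (H : Landscape f g S α C xs) (hα : f xs < α) {d T η : ℝ} (hd : 0 < d) (hT : 0 < T)
    (hr : 2 * d * T ≤ 1 / 2) (hC : C * T ≤ d / 2) {ε : ℝ} (hε : 0 < ε) :
    ∃ δ : ℝ, 0 < δ ∧ ∀ z : E × E, z.1 ∈ S → equilDist xs z < δ → ∀ k : ℕ,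
      equilDist xs ((momentumStep g S d T η)^[k] z) < ε := by
  obtain ⟨γ, hγ, hγS⟩ := H.exists_le_value (H.isCompact_diff_ball (ε / 2)) Set.sdiff_subset
    (by simp [hε])
  set m := min γ (min (α - f xs) (ε ^ 2 / 8)) with hm
  have hm0 : 0 < m := by
    have : 0 < α - f xs := by linarith
    positivity
  have hmγ : m ≤ γ := min_le_left _ _
  have hmα : m ≤ α - f xs := (min_le_right _ _).trans (min_le_left _ _)
  have hmε : m ≤ ε ^ 2 / 8 := (min_le_right _ _).trans (min_le_right _ _)
  obtain ⟨δ, hδ, hδf⟩ := Metric.continuousOn_iff.1 H.cont xs H.mem (m / 2) (by positivity)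
  refine ⟨min δ (√m), by positivity, fun z hz hdist k => ?_⟩
  have hd1 : ‖z.1 - xs‖ < δ :=
    (Real.le_sqrt_of_sq_le (by nlinarith [sq_nonneg ‖z.2‖])).trans_lt
      (hdist.trans_le (min_le_left _ _))
  have hd2 : ‖z.2‖ ^ 2 < m := by
    have : equilDist xs z < √m := hdist.trans_le (min_le_right _ _)
    rw [equilDist, Real.sqrt_lt_sqrt_iff (by positivity)] at this
    nlinarith [sq_nonneg ‖z.1 - xs‖]
  have hf := hδf z.1 hz (by rwa [dist_eq_norm])
  rw [Real.dist_eq] at hf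
  have hV : energy f z < f xs + m := by
    have := (abs_lt.1 hf).2
    simp only [energy]
    linarith
  have hk := (H.iterate_of_energy_lt (η := η) hd hT hr hC hz (by linarith) k).2
  have hkS : ((momentumStep g S d T η)^[k] z).1 ∈ S := momentumStep_iterate_fst_mem hz k
  set w := (momentumStep g S d T η)^[k] z
  have hw := H.isMin _ hkS
  simp only [energy] at hk hV
  have h1 : ‖w.1 - xs‖ < ε / 2 := by
    by_contra hcon
    have := hγS w.1 ⟨hkS, by rwa [Metric.mem_ball, dist_eq_norm]⟩
    nlinarith [sq_nonneg ‖w.2‖]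
  have h2 : ‖w.2‖ ^ 2 < (ε / 2) ^ 2 := by nlinarith
  rw [equilDist, Real.sqrt_lt' hε]
  have h3 : ‖w.1 - xs‖ ^ 2 < (ε / 2) ^ 2 := by gcongr
  nlinarith

/-- The restarted method with a small enough step size is asymptotically stable. -/
theorem exists_maxStep (H : Landscape f g S α C xs) (hα : f xs < α) {d : ℝ} (hd : 0 < d) :
    ∃ η₀ : ℝ, 0 < η₀ ∧ ∃ Tm : ℝ, 0 < Tm ∧ ∀ η : ℝ, 0 < η → η ≤ η₀ → ∀ T : ℝ, 0 < T → T ≤ Tm →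
      (∀ ε : ℝ, 0 < ε → ∃ δ : ℝ, 0 < δ ∧ ∀ z : E × E, z.1 ∈ S → equilDist xs z < δ → ∀ k : ℕ,
        equilDist xs ((momentumStep g S d T η)^[k] z) < ε) ∧
      ∀ z : E × E, z.1 ∈ S →
        Tendsto (fun k => equilDist xs ((momentumStep g S d T η)^[k] z)) atTop (𝓝 0) := by
  obtain ⟨η₀, hη₀, Tm, hTm, hno⟩ := H.exists_no_restart hα hd
  have hC := H.pos
  refine ⟨η₀, hη₀, min Tm (min (1 / (4 * d)) (d / 2 / C)), by positivity, ?_⟩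
  intro η hη hηle T hT hTle
  have hr : 2 * d * T ≤ 1 / 2 := by
    have : T ≤ 1 / (4 * d) := hTle.trans ((min_le_right _ _).trans (min_le_left _ _))
    rw [le_div_iff₀ (by positivity)] at this
    linarith
  have hCT : C * T ≤ d / 2 := by
    have : T ≤ d / 2 / C := hTle.trans ((min_le_right _ _).trans (min_le_right _ _))
    rwa [le_div_iff₀' (by positivity)] at this
  exact ⟨fun ε hε => H.stable hα hd hT hr hCT hε,
    fun z hz => H.tendsto_iterate hd hT hr hCT
      (hno η hη hηle T hT (hTle.trans (min_le_left _ _))) hz⟩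

end Landscape

/-- If `S` is the equilibrium alone, the restarted method reaches it in one step. -/
lemma momentumStep_iterate_singleton {g : E → E} {xs : E} (hg : g xs = 0) {d T η : ℝ} (hT : 0 < T)
    {z : E × E} (hz : z.1 ∈ ({xs} : Set E)) (k : ℕ) :
    (momentumStep g {xs} d T η)^[k + 1] z = (xs, 0) := by
  have key : ∀ w : E × E, w.1 = xs → momentumStep g {xs} d T η w = (xs, 0) := by
    rintro ⟨x, p⟩ rfl
    by_cases h : (momentumEuler g d T (x, p)).1 ∈ ({x} : Set E)
    · rw [momentumStep_of_mem h]
      simp only [momentumEuler, Set.mem_singleton_iff, add_eq_left, smul_eq_zero, hT.ne',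
        false_or] at h
      simp [momentumEuler, h]
    · simp [momentumStep_of_notMem h, hg]
  induction k generalizing z with
  | zero => exact key z hz
  | succ k ih => rw [Function.iterate_succ_apply, key z hz]; exact ih rfl

end Momentum

/-! ### Contraction of a modified energy and the local exponential rate. -/

section LocalRate

variable {E : Type*} [NormedAddCommGroup E] [InnerProductSpace ℝ E]

/-- Modified energy of the linearized momentum method. -/
def modEnergy (H : E →L[ℝ] E) (d T γ : ℝ) (z : E × E) : ℝ :=
  inner ℝ (H z.1) z.1 + (1 - d * T) * ‖z.2‖ ^ 2 + 2 * γ * inner ℝ z.1 z.2 - T * inner ℝ (H z.1) z.2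

/-- For d = γ = 0 this is the conservation law of the symplectic Euler method with a quadratic
potential. Damping removes d T‖p + p'‖², which sees only the momentum; the cross term with γ
supplies the missing dissipation −2γT⟨Hx,x⟩ in position. -/
lemma modEnergy_linear_step {H : E →L[ℝ] E} (hH : ∀ x y, inner ℝ (H x) y = inner ℝ x (H y))
    (d T γ : ℝ) (x p p' : E) (hp' : p' = (1 - 2 * d * T) • p - T • H x) :
    modEnergy H d T γ (x + T • p', p') = modEnergy H d T γ (x, p) - d * T * ‖p + p'‖ ^ 2 +
      2 * γ * T * (‖p'‖ ^ 2 - inner ℝ (H x) x - 2 * d * inner ℝ x p) := by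
  have h1 : T • H x = (1 - 2 * d * T) • p - p' := by rw [hp']; abel
  have h2 : T * inner ℝ (H x) p = (1 - 2 * d * T) * ‖p‖ ^ 2 - inner ℝ p p' := by
    rw [← real_inner_smul_left, h1, inner_sub_left, real_inner_smul_left,
      real_inner_self_eq_norm_sq, real_inner_comm]
  have h3 : T * inner ℝ (H x) p' = (1 - 2 * d * T) * inner ℝ p p' - ‖p'‖ ^ 2 := by
    rw [← real_inner_smul_left, h1, inner_sub_left, real_inner_smul_left,
      real_inner_self_eq_norm_sq]
  have h4 : inner ℝ x p' = (1 - 2 * d * T) * inner ℝ x p - T * inner ℝ (H x) x := by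
    rw [hp', inner_sub_right, real_inner_smul_right, real_inner_smul_right, hH x x]
  have h5 : inner ℝ (H p') x = inner ℝ (H x) p' := by rw [hH, real_inner_comm]
  simp only [modEnergy, map_add, map_smul, inner_add_left, inner_add_right, real_inner_smul_left,
    real_inner_smul_right, h5, norm_add_sq_real, h4, real_inner_self_eq_norm_sq]
  linear_combination h3 + h2

lemma two_inner_le (θ : ℝ) (hθ : 0 < θ) (x y : E) :
    2 * inner ℝ x y ≤ θ * ‖x‖ ^ 2 + θ⁻¹ * ‖y‖ ^ 2 := by
  have h := sq_nonneg ‖θ • x - y‖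
  rw [norm_sub_sq_real, norm_smul, real_inner_smul_left, mul_pow, Real.norm_of_nonneg hθ.le] at h
  have h2 : 0 ≤ θ⁻¹ * (θ ^ 2 * ‖x‖ ^ 2 - 2 * (θ * inner ℝ x y) + ‖y‖ ^ 2) := by positivity
  have h3 : θ⁻¹ * (θ ^ 2 * ‖x‖ ^ 2 - 2 * (θ * inner ℝ x y) + ‖y‖ ^ 2) =
    θ * ‖x‖ ^ 2 - 2 * inner ℝ x y + θ⁻¹ * ‖y‖ ^ 2 := by field_simp
  linarith

lemma two_inner_le_abs (θ : ℝ) (hθ : 0 < θ) (x y : E) :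
    |2 * inner ℝ x y| ≤ θ * ‖x‖ ^ 2 + θ⁻¹ * ‖y‖ ^ 2 := by
  refine abs_le.2 ⟨?_, two_inner_le θ hθ x y⟩
  have := two_inner_le θ hθ (-x) y
  rw [inner_neg_left, norm_neg] at this
  linarith

/-- The coupling constant of the modified energy. -/
def couplingConst (D : ℝ) : ℝ := 1 / (12 * (1 + D ^ 2))

lemma couplingConst_pos (D : ℝ) : 0 < couplingConst D := by unfold couplingConst; positivity

lemma couplingConst_mul (D : ℝ) : couplingConst D * (1 + D ^ 2) = 1 / 12 := by
  unfold couplingConst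
  field_simp

/-- The cross term is a small part of the energy since `couplingConst D` times D is at most 1/24, by
2D ≤ 1 + D². In use, a is ⟨Hx,x⟩. -/
lemma two_couplingConst_mul_inner_le {d D a : ℝ} (hD : 0 < D) (hd : 0 ≤ d) {x : E}
    (hdx : d ^ 2 * ‖x‖ ^ 2 ≤ D ^ 2 * a) (p : E) :
    |2 * (couplingConst D * d) * inner ℝ x p| ≤ 1 / 24 * (a + ‖p‖ ^ 2) := by
  have h1 := two_inner_le_abs D⁻¹ (by positivity) (d • x) p
  rw [norm_smul, mul_pow, Real.norm_of_nonneg hd, real_inner_smul_left, inv_inv] at h1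
  have h2 : D⁻¹ * (d ^ 2 * ‖x‖ ^ 2) ≤ D * a := by
    rw [inv_mul_le_iff₀ hD]
    linarith
  have hc := couplingConst_pos D
  have h3 : couplingConst D * D ≤ 1 / 24 := by
    have := couplingConst_mul D
    nlinarith [sq_nonneg (D - 1)]
  have ha : 0 ≤ a := by
    have : 0 ≤ D ^ 2 * a := le_trans (by positivity) hdx
    exact nonneg_of_mul_nonneg_right this (by positivity)
  calc |2 * (couplingConst D * d) * inner ℝ x p| = couplingConst D * |2 * (d * inner ℝ x p)| := by
        rw [← abs_of_pos hc, ← abs_mul, abs_of_pos hc]; ring_nf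
    _ ≤ couplingConst D * (D * (a + ‖p‖ ^ 2)) := by
        refine mul_le_mul_of_nonneg_left ?_ hc.le
        linarith
    _ = couplingConst D * D * (a + ‖p‖ ^ 2) := by ring
    _ ≤ _ := by gcongr

lemma le_modEnergy {H : E →L[ℝ] E} {d T D : ℝ} (hD : 0 < D) (hd : 0 ≤ d)
    (hdT : d * T ≤ 1 / 100) {x : E}
    (hTH : ‖T • H x‖ ^ 2 ≤ 5 / 2 * inner ℝ (H x) x)
    (hdx : d ^ 2 * ‖x‖ ^ 2 ≤ D ^ 2 * inner ℝ (H x) x) (p : E) :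
    1 / 10 * (inner ℝ (H x) x + ‖p‖ ^ 2) ≤ modEnergy H d T (couplingConst D * d) (x, p) := by
  have h1 := (abs_le.1 (two_couplingConst_mul_inner_le hD hd hdx p)).1
  -- This weight splits T⟨Hx,p⟩ into at most 4/5 of ⟨Hx,x⟩ and 25/32 of ‖p‖², both below 1 with room
  -- for the cross term.
  have h2 := two_inner_le (16 / 25) (by norm_num) (T • H x) p
  rw [real_inner_smul_left] at h2
  have ha : 0 ≤ inner ℝ (H x) x := by nlinarith [sq_nonneg ‖T • H x‖]
  simp only [modEnergy]
  norm_num at h2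
  nlinarith [sq_nonneg ‖p‖]

set_option maxHeartbeats 800000 in
/-- Decay of the modified energy along the linearized method. -/
lemma modEnergy_decay {H : E →L[ℝ] E} (hH : ∀ x y, inner ℝ (H x) y = inner ℝ x (H y))
    {d T D : ℝ} (hD : 0 < D) (hd : 0 < d) (hT : 0 < T)
    (hdT : d * T ≤ 1 / 100) {x p p' : E} (hp' : p' = (1 - 2 * d * T) • p - T • H x)
    (hTH : ‖T • H x‖ ^ 2 ≤ 5 / 2 * inner ℝ (H x) x)
    (hdx : d ^ 2 * ‖x‖ ^ 2 ≤ D ^ 2 * inner ℝ (H x) x) :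
    modEnergy H d T (couplingConst D * d) (x + T • p', p') ≤
      (1 - couplingConst D * d * T / 15) * modEnergy H d T (couplingConst D * d) (x, p) := by
  have hc := couplingConst_pos D
  have hcD := couplingConst_mul D
  rw [modEnergy_linear_step hH d T _ x p p' hp']
  set ε := couplingConst D with hε
  set a := inner ℝ (H x) x with ha
  obtain ⟨s, hs⟩ : ∃ s, s = p + p' := ⟨_, rfl⟩
  obtain ⟨w, hw⟩ : ∃ w, w = T • H x := ⟨_, rfl⟩
  set δ := d * T with hδ
  have hδ0 : 0 < δ := by positivity
  have ha0 : 0 ≤ a := by nlinarith [sq_nonneg ‖T • H x‖]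
  -- In the variables s = p + p' and w = T H x, every term is bounded by the dissipated ‖s‖² and by
  -- a.
  have e1 : (2 * (1 - δ)) • p = s + w := by
    rw [hs, hp', hw, hδ]; module
  have e2 : (2 * (1 - δ)) • p' = (1 - 2 * δ) • s - w := by
    rw [hs, hp', hw, hδ]; module
  rw [← hw] at hTH
  have n1 : 4 * (1 - δ) ^ 2 * ‖p‖ ^ 2 = ‖s‖ ^ 2 + 2 * inner ℝ s w + ‖w‖ ^ 2 := by
    rw [← norm_add_sq_real, ← e1, norm_smul, mul_pow, Real.norm_eq_abs, sq_abs]; ring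
  have n2 : 4 * (1 - δ) ^ 2 * ‖p'‖ ^ 2 =
      (1 - 2 * δ) ^ 2 * ‖s‖ ^ 2 - (1 - 2 * δ) * (2 * inner ℝ s w) + ‖w‖ ^ 2 := by
    have : ‖(2 * (1 - δ)) • p'‖ ^ 2 = ‖(1 - 2 * δ) • s - w‖ ^ 2 := by rw [e2]
    rw [norm_sub_sq_real, norm_smul, norm_smul, mul_pow, mul_pow, Real.norm_eq_abs,
      Real.norm_eq_abs, sq_abs, sq_abs, real_inner_smul_left] at this
    linarith
  have i1 := two_inner_le 1 one_pos s w
  have i2 := (abs_le.1 (two_inner_le_abs 10 (by norm_num) s w)).1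
  have hδ1 : (39 / 10 : ℝ) ≤ 4 * (1 - δ) ^ 2 := by nlinarith
  have hss : 0 ≤ ‖s‖ ^ 2 := by positivity
  have hww : 0 ≤ ‖w‖ ^ 2 := by positivity
  have b1 : ‖p‖ ^ 2 ≤ 13 / 10 * (a + ‖s‖ ^ 2) := by
    have : 39 / 10 * ‖p‖ ^ 2 ≤ 4 * (1 - δ) ^ 2 * ‖p‖ ^ 2 := by gcongr
    norm_num at i1
    linarith
  -- The coefficient of a has to stay below 1 for the cross term to dissipate. It comes from
  -- (11/10)(5/2)/(39/10), which is why the inner product in `i2` is split with the uneven weight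
  -- 10.
  have b2 : ‖p'‖ ^ 2 ≤ 71 / 100 * a + 3 * ‖s‖ ^ 2 := by
    have h1 : 39 / 10 * ‖p'‖ ^ 2 ≤ 4 * (1 - δ) ^ 2 * ‖p'‖ ^ 2 := by gcongr
    have h2 : (1 - 2 * δ) ^ 2 * ‖s‖ ^ 2 ≤ 1 * ‖s‖ ^ 2 := by gcongr; nlinarith
    have h3 : (1 - 2 * δ) * -(2 * inner ℝ s w) ≤
        1 * (10 * ‖s‖ ^ 2 + 10⁻¹ * ‖w‖ ^ 2) := by
      refine (mul_le_mul_of_nonneg_left (b := -(2 * inner ℝ s w))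
        (c := 10 * ‖s‖ ^ 2 + 10⁻¹ * ‖w‖ ^ 2) (by linarith) (by linarith)).trans ?_
      gcongr
      linarith
    norm_num at h3
    linarith
  have b3 : -(2 * d * inner ℝ x p) ≤ 1 / 10 * a + 3 * D ^ 2 * ‖s‖ ^ 2 := by
    have h1 : 2 * (1 - δ) * inner ℝ x p = inner ℝ x s + T * a := by
      rw [← real_inner_smul_right, e1, inner_add_right, hw, real_inner_smul_right, ha, hH x x]
    have h2 := (abs_le.1 (two_inner_le_abs (19 / 100 * (D ^ 2)⁻¹) (by positivity) (d • x) s)).1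
    rw [norm_smul, mul_pow, Real.norm_of_nonneg hd.le, real_inner_smul_left, mul_inv, inv_inv] at h2
    have h3 : (D ^ 2)⁻¹ * (d ^ 2 * ‖x‖ ^ 2) ≤ a := by
      rw [inv_mul_le_iff₀ (by positivity)]; exact hdx
    have h4 : -(2 * (d * inner ℝ x s)) ≤ 19 / 100 * a + 100 / 19 * (D ^ 2 * ‖s‖ ^ 2) := by
      norm_num at h2
      linarith
    have h5 : (1 - δ) * -(2 * d * inner ℝ x p) = -(d * inner ℝ x s) - δ * a := by
      rw [hδ]; linear_combination -d * h1
    have h6 : 0 ≤ δ * a := by positivity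
    have h7 : (1 - δ) * (1 / 10 * a + 3 * D ^ 2 * ‖s‖ ^ 2) ≥
        99 / 100 * (1 / 10 * a + 3 * D ^ 2 * ‖s‖ ^ 2) := by gcongr; linarith
    have h8 : 0 ≤ D ^ 2 * ‖s‖ ^ 2 := by positivity
    refine le_of_mul_le_mul_left (a := 1 - δ) ?_ (by linarith)
    linarith
  have up : modEnergy H d T (ε * d) (x, p) ≤ 9 / 2 * (a + ‖s‖ ^ 2) := by
    have h1 := (abs_le.1 (two_couplingConst_mul_inner_le hD hd.le hdx p)).2
    have h2 := (abs_le.1 (two_inner_le_abs 1 one_pos w p)).1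
    have h3 : inner ℝ w p = T * inner ℝ (H x) p := by rw [hw, real_inner_smul_left]
    have h4 : 0 ≤ δ * ‖p‖ ^ 2 := by positivity
    simp only [modEnergy, ← ha, ← hδ]
    rw [h3] at h2
    norm_num at h2
    rw [← hε] at h1
    linarith
  have hεδ : 0 < ε * δ := by positivity
  have hcD' : ε * D ^ 2 = 1 / 12 - ε := by linarith
  have main : 2 * (ε * d) * T * (‖p'‖ ^ 2 - a - 2 * d * inner ℝ x p) ≤
      2 * (ε * δ) * (-(19 / 100) * a + 3 * (1 + D ^ 2) * ‖s‖ ^ 2) := by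
    have : 2 * (ε * d) * T = 2 * (ε * δ) := by rw [hδ]; ring
    rw [this]
    refine mul_le_mul_of_nonneg_left ?_ (by positivity)
    linarith
  -- The value of `couplingConst` makes this loss exactly half of the dissipation δ‖s‖².
  have e3 : 2 * (ε * δ) * (3 * (1 + D ^ 2) * ‖s‖ ^ 2) = δ / 2 * ‖s‖ ^ 2 := by
    linear_combination 6 * δ * ‖s‖ ^ 2 * hcD
  have hε12 : ε ≤ 1 / 12 := by nlinarith [sq_nonneg D]
  have e4 : ε * δ * ‖s‖ ^ 2 ≤ 1 / 12 * δ * ‖s‖ ^ 2 := by gcongr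
  have e5 : ε * δ / 15 * modEnergy H d T (ε * d) (x, p) ≤ ε * δ / 15 * (9 / 2 * (a + ‖s‖ ^ 2)) := by
    gcongr
  have e6 : 0 ≤ ε * δ * a := by positivity
  have e7 : ε * d * T / 15 = ε * δ / 15 := by rw [hδ]; ring
  have e8 : 0 ≤ δ * ‖s‖ ^ 2 := by positivity
  rw [← hs, e7]
  linarith

/-- Young's inequality for a nonnegative quadratic form: expand its value at θz − w. -/
lemma modEnergy_add_le {H : E →L[ℝ] E} {d T γ θ : ℝ}
    (hpos : ∀ z, 0 ≤ modEnergy H d T γ z) (hθ : 0 < θ) (z w : E × E) :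
    modEnergy H d T γ (z + w) ≤
      (1 + θ) * modEnergy H d T γ z + (1 + θ⁻¹) * modEnergy H d T γ w := by
  have h := hpos (θ • z - w)
  have e : θ * modEnergy H d T γ (z + w) + modEnergy H d T γ (θ • z - w) =
      θ * ((1 + θ) * modEnergy H d T γ z) + (1 + θ) * modEnergy H d T γ w := by
    simp only [modEnergy, Prod.fst_add, Prod.snd_add, Prod.fst_sub, Prod.snd_sub, Prod.smul_fst,
      Prod.smul_snd, map_add, map_sub, map_smul, inner_add_left, inner_add_right, inner_sub_left,
      inner_sub_right, real_inner_smul_left, real_inner_smul_right, norm_add_sq_real,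
      norm_sub_sq_real, norm_smul, mul_pow, Real.norm_of_nonneg hθ.le]
    ring
  have e2 : θ * ((1 + θ⁻¹) * modEnergy H d T γ w) = (1 + θ) * modEnergy H d T γ w := by
    field_simp
    ring
  refine le_of_mul_le_mul_left (a := θ) ?_ hθ
  rw [mul_add, e2]
  linarith

/-- An error q in the momentum update enters the new state as (T q, q). -/
lemma modEnergy_smul_le (H : E →L[ℝ] E) {d T γ : ℝ} (hdT : 0 ≤ d * T) (hT : 0 < T)
    (q : E) : modEnergy H d T γ (T • q, q) ≤ (1 + 2 * γ * T + 2 * T ^ 2 * ‖H‖) * ‖q‖ ^ 2 := by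
  have h1 : |inner ℝ (H q) q| ≤ ‖H‖ * ‖q‖ ^ 2 := by
    refine (abs_real_inner_le_norm _ _).trans ?_
    rw [pow_two, ← mul_assoc]
    gcongr
    exact H.le_opNorm q
  obtain ⟨h2, h3⟩ := abs_le.1 h1
  simp only [modEnergy, map_smul, real_inner_smul_left, real_inner_smul_right,
    real_inner_self_eq_norm_sq]
  have h4 := mul_nonneg hdT (sq_nonneg ‖q‖)
  have h5 : 0 ≤ T ^ 2 * ‖H‖ * ‖q‖ ^ 2 := by positivity
  have h6 : T * (T * inner ℝ (H q) q) ≤ T ^ 2 * ‖H‖ * ‖q‖ ^ 2 := by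
    have := mul_le_mul_of_nonneg_left h3 (sq_nonneg T)
    linarith
  linarith

/-- Exponential convergence of the momentum method near a nondegenerate minimizer. -/
theorem equilDist_isBigO_of_tendsto {g : E → E} {xs : E} {H : E →L[ℝ] E}
    (hH : ∀ x y, inner ℝ (H x) y = inner ℝ x (H y))
    {d T D μ : ℝ} (hD : 0 < D) (hd : 0 < d) (hT : 0 < T) (hμ : 0 < μ) (hdT : d * T ≤ 1 / 100)
    (hlow : ∀ x, μ * ‖x‖ ^ 2 ≤ inner ℝ (H x) x)
    (hTH : ∀ x, ‖T • H x‖ ^ 2 ≤ 5 / 2 * inner ℝ (H x) x)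
    (hdx : ∀ x, d ^ 2 * ‖x‖ ^ 2 ≤ D ^ 2 * inner ℝ (H x) x)
    (hg : HasFDerivAt g H xs) (hg0 : g xs = 0) {z : ℕ → E × E}
    (hz : ∀ᶠ k in atTop, z (k + 1) = momentumEuler g d T (z k))
    (hlim : Tendsto (fun k => equilDist xs (z k)) atTop (𝓝 0)) :
    (fun k => equilDist xs (z k)) =O[atTop]
      fun k : ℕ => Real.exp (-(couplingConst D * d * T / 60) * k) := by
  have hε := couplingConst_pos D
  set γ := couplingConst D * d with hγ
  set V := modEnergy H d T γ with hV
  set l := γ * T / 30 with hl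
  have hl0 : 0 < l := by positivity
  have hlow' : ∀ z : E × E, 1 / 10 * (inner ℝ (H z.1) z.1 + ‖z.2‖ ^ 2) ≤ V z := fun z =>
    le_modEnergy hD hd.le hdT (hTH z.1) (hdx z.1) z.2
  have ha0 : ∀ x, 0 ≤ inner ℝ (H x) x := fun x => le_trans (by positivity) (hlow x)
  have hpos : ∀ z, 0 ≤ V z := fun z =>
    le_trans (by have := ha0 z.1; positivity) (hlow' z)
  set M := (1 + 2 * γ * T + 2 * T ^ 2 * ‖H‖) * T ^ 2 with hM
  have hM0 : 0 < M := by positivity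
  -- Tuned so that the nonlinear remainder costs at most 2l² V. Then (1 + l)(1 − 2l) + 2l² = 1 − l
  -- is the resulting factor.
  set e := √(2 * l ^ 2 * μ / (10 * (1 + l⁻¹) * M)) with he
  have he0 : 0 < e := by positivity
  have he2 : e ^ 2 = 2 * l ^ 2 * μ / (10 * (1 + l⁻¹) * M) := Real.sq_sqrt (by positivity)
  have hx : Tendsto (fun k => (z k).1) atTop (𝓝 xs) := by
    rw [tendsto_iff_norm_sub_tendsto_zero]
    exact squeeze_zero (fun _ => norm_nonneg _)
      (fun k => Real.le_sqrt_of_sq_le (le_add_of_nonneg_right (sq_nonneg _))) hlim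
  have hsmall : ∀ᶠ k in atTop, ‖g (z k).1 - H ((z k).1 - xs)‖ ≤ e * ‖(z k).1 - xs‖ := by
    have := (hasFDerivAt_iff_isLittleO.1 hg).def he0
    simp only [hg0, sub_zero] at this
    exact hx.eventually this
  have hdecay : ∀ᶠ k in atTop, V ((z (k + 1)).1 - xs, (z (k + 1)).2) ≤
      Real.exp (-l) * V ((z k).1 - xs, (z k).2) := by
    filter_upwards [hz, hsmall] with k hk hs
    set x := (z k).1 - xs with hxdef
    set p := (z k).2 with hp
    set ρ := g (z k).1 - H x with hρ
    obtain ⟨p', hp'⟩ : ∃ p', p' = (1 - 2 * d * T) • p - T • H x := ⟨_, rfl⟩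
    have e1 : ((z (k + 1)).1 - xs, (z (k + 1)).2) =
        (x + T • p', p') + (T • (-(T • ρ)), -(T • ρ)) := by
      rw [hk]
      simp only [momentumEuler, Prod.mk_add_mk, hp', hρ, Prod.mk.injEq, ← hp, hxdef]
      constructor <;> module
    have h1 := modEnergy_decay hH hD hd hT hdT hp' (hTH x) (hdx x)
    rw [← hγ, ← hV] at h1
    have h2 := modEnergy_add_le hpos hl0 (x + T • p', p') (T • (-(T • ρ)), -(T • ρ))
    have h3 := modEnergy_smul_le H (d := d) (by positivity) hT (γ := γ) (-(T • ρ))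
    rw [norm_neg, norm_smul, Real.norm_of_nonneg hT.le, mul_pow, ← mul_assoc, ← hM, ← hV] at h3
    have h4 : ‖ρ‖ ^ 2 ≤ e ^ 2 * ‖x‖ ^ 2 := by
      rw [← mul_pow]; gcongr
    have h5 : μ * ‖x‖ ^ 2 ≤ 10 * V (x, p) := by
      have := hlow' (x, p)
      have := hlow x
      nlinarith [sq_nonneg ‖p‖]
    have h6 : (1 + l⁻¹) * V (T • (-(T • ρ)), -(T • ρ)) ≤ 2 * l ^ 2 * V (x, p) := by
      calc (1 + l⁻¹) * V (T • (-(T • ρ)), -(T • ρ)) ≤ (1 + l⁻¹) * (M * (e ^ 2 * ‖x‖ ^ 2)) := by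
            gcongr
            exact h3.trans (by gcongr)
        _ = 2 * l ^ 2 / 10 * (μ * ‖x‖ ^ 2) := by
            rw [he2]; field_simp
        _ ≤ 2 * l ^ 2 / 10 * (10 * V (x, p)) := by gcongr
        _ = _ := by ring
    have h7 : 1 - l ≤ Real.exp (-l) := by
      have := Real.add_one_le_exp (-l); linarith
    have h8 : (1 + l) * V (x + T • p', p') ≤ (1 + l) * ((1 - 2 * l) * V (x, p)) := by
      refine mul_le_mul_of_nonneg_left (h1.trans_eq ?_) (by positivity)
      rw [hl]; ring
    rw [e1]
    calc _ ≤ (1 - l) * V (x, p) := by rw [← hV] at h2; linarith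
      _ ≤ _ := mul_le_mul_of_nonneg_right h7 (hpos _)
  obtain ⟨N, hN⟩ := eventually_atTop.1 hdecay
  have hiter : ∀ j : ℕ, V ((z (N + j)).1 - xs, (z (N + j)).2) ≤
      Real.exp (-l * j) * V ((z N).1 - xs, (z N).2) := by
    intro j
    induction j with
    | zero => simp
    | succ j ih =>
      have h1 := hN (N + j) (by omega)
      rw [← add_assoc]
      refine h1.trans ?_
      have h2 : -l * ((j + 1 : ℕ) : ℝ) = -l + -l * j := by push_cast; ring
      rw [h2, Real.exp_add, mul_assoc]
      exact mul_le_mul_of_nonneg_left ih (Real.exp_pos _).le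
  set V₀ := V ((z N).1 - xs, (z N).2)
  have hV₀ : 0 ≤ V₀ := hpos _
  set A := √(10 * (μ⁻¹ + 1) * V₀)
  -- The exponential factor moves the origin from N back to 0. The distance is the square root of an
  -- energy, which halves the rate l = γT/30.
  refine IsBigO.of_bound (A * Real.exp (l / 2 * N)) (eventually_atTop.2 ⟨N, fun k hk => ?_⟩)
  obtain ⟨j, rfl⟩ := Nat.exists_eq_add_of_le hk
  rw [equilDist, Real.norm_of_nonneg (Real.sqrt_nonneg _), Real.norm_of_nonneg (Real.exp_pos _).le,
    mul_assoc,
    ← Real.exp_add]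
  have hexp : l / 2 * N + -(γ * T / 60) * ((N + j : ℕ) : ℝ) = -l * j / 2 := by
    rw [hl]; push_cast; ring
  rw [hexp]
  refine Real.sqrt_le_iff.2 ⟨by positivity, ?_⟩
  rw [mul_pow, Real.sq_sqrt (by positivity), ← Real.exp_nat_mul]
  have e3 : ((2 : ℕ) : ℝ) * (-l * j / 2) = -l * j := by push_cast; ring
  rw [e3]
  set x := (z (N + j)).1 - xs
  set p := (z (N + j)).2
  have h1 := hlow' (x, p)
  have h2 : ‖x‖ ^ 2 ≤ μ⁻¹ * inner ℝ (H x) x := by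
    rw [← div_eq_inv_mul, le_div_iff₀ hμ, mul_comm]
    exact hlow x
  have hax := ha0 x
  have hμi : 0 < μ⁻¹ := by positivity
  calc ‖x‖ ^ 2 + ‖p‖ ^ 2 ≤ (μ⁻¹ + 1) * (inner ℝ (H x) x + ‖p‖ ^ 2) := by
        nlinarith [sq_nonneg ‖p‖, mul_nonneg hμi.le (sq_nonneg ‖p‖)]
    _ ≤ (μ⁻¹ + 1) * (10 * V (x, p)) := by
        gcongr
        simp only at h1
        linarith
    _ ≤ (μ⁻¹ + 1) * (10 * (Real.exp (-l * j) * V₀)) := by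
        gcongr
        exact hiter j
    _ = _ := by ring

end LocalRate

/-! ### Decay of the matrix exponential of a Hurwitz matrix. -/

section Hurwitz

open scoped Matrix.Norms.Frobenius

variable {n : ℕ}

lemma tendsto_matrix_iff {ι R : Type*} [TopologicalSpace R] {a b : ℕ} {l : Filter ι}
    {F : ι → Matrix (Fin a) (Fin b) R} {M : Matrix (Fin a) (Fin b) R} :
    Tendsto F l (𝓝 M) ↔ ∀ i j, Tendsto (fun t => F t i j) l (𝓝 (M i j)) :=
  (tendsto_pi_nhds (f := F)).trans (forall_congr' fun _ => tendsto_pi_nhds)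

lemma exp_mulVec_eq_sum (N : Matrix (Fin n) (Fin n) ℂ) {v : Fin n → ℂ} {k : ℕ}
    (hv : N ^ k *ᵥ v = 0) (t : ℝ) :
    NormedSpace.exp (t • N) *ᵥ v =
      ∑ i ∈ Finset.range k, ((i.factorial : ℂ)⁻¹ * (t : ℂ) ^ i) • (N ^ i *ᵥ v) := by
  have h1 := NormedSpace.exp_series_hasSum_exp' (𝕂 := ℂ) (t • N)
  have h2 : HasSum (fun i : ℕ => ((i.factorial : ℂ)⁻¹ • (t • N) ^ i) *ᵥ v)
      (NormedSpace.exp (t • N) *ᵥ v) :=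
    h1.map (AddMonoidHom.mk' (fun M : Matrix (Fin n) (Fin n) ℂ => M *ᵥ v)
      fun A B => Matrix.add_mulVec A B v) (by
        change Continuous fun M : Matrix (Fin n) (Fin n) ℂ => M *ᵥ v
        fun_prop)
  have h3 : ∀ i : ℕ, ((i.factorial : ℂ)⁻¹ • (t • N) ^ i) *ᵥ v =
      ((i.factorial : ℂ)⁻¹ * (t : ℂ) ^ i) • (N ^ i *ᵥ v) := by
    intro i
    rw [smul_pow, Matrix.smul_mulVec, Matrix.smul_mulVec, mul_smul]
    congr 1
    rw [← Complex.ofReal_pow]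
    ext j
    simp
  simp only [h3] at h2
  refine h2.unique (hasSum_sum_of_ne_finset_zero fun i hi => ?_)
  have hki : k ≤ i := by simpa using hi
  rw [← Nat.sub_add_cancel hki, pow_add N, ← Matrix.mulVec_mulVec, hv, Matrix.mulVec_zero,
    smul_zero]

/-- On a generalized eigenvector the matrix acts as s plus a nilpotent part, so the exponential is
e^{ts} times a polynomial in t. -/
lemma tendsto_exp_mulVec_of_genEigen (M : Matrix (Fin n) (Fin n) ℂ) {s : ℂ} (hs : s.re < 0)
    {v : Fin n → ℂ} {k : ℕ} (hv : (M - algebraMap ℂ _ s) ^ k *ᵥ v = 0) :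
    Tendsto (fun t : ℝ => NormedSpace.exp (t • M) *ᵥ v) atTop (𝓝 0) := by
  have hexp : ∀ t : ℝ, NormedSpace.exp (t • M) *ᵥ v = ∑ i ∈ Finset.range k,
      (Complex.exp (t * s) * ((i.factorial : ℂ)⁻¹ * (t : ℂ) ^ i)) •
        ((M - algebraMap ℂ _ s) ^ i *ᵥ v) := by
    intro t
    have h1 : t • M = algebraMap ℂ (Matrix (Fin n) (Fin n) ℂ) (t * s) +
        t • (M - algebraMap ℂ _ s) := by
      have : algebraMap ℂ (Matrix (Fin n) (Fin n) ℂ) (t * s) = t • algebraMap ℂ _ s := by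
        rw [Algebra.algebraMap_eq_smul_one, Algebra.algebraMap_eq_smul_one, mul_smul]
        ext i j
        simp
      rw [this]; module
    have h2 : NormedSpace.exp (algebraMap ℂ (Matrix (Fin n) (Fin n) ℂ) (t * s)) =
        algebraMap ℂ _ (NormedSpace.exp (t * s)) := (NormedSpace.algebraMap_exp_comm _).symm
    rw [h1, Matrix.exp_add_of_commute _ _ (Algebra.commute_algebraMap_left _ _), h2,
      ← Complex.exp_eq_exp_ℂ, Algebra.algebraMap_eq_smul_one,
      smul_mul_assoc, one_mul, Matrix.smul_mulVec, exp_mulVec_eq_sum _ hv, Finset.smul_sum]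
    simp only [mul_smul]
  simp only [hexp]
  rw [← Finset.sum_const_zero (s := Finset.range k)]
  refine tendsto_finsetSum _ fun i _ => ?_
  rw [← zero_smul ℂ ((M - algebraMap ℂ _ s) ^ i *ᵥ v)]
  refine Tendsto.smul_const ?_ _
  rw [tendsto_zero_iff_norm_tendsto_zero]
  have h2 : Tendsto (fun t : ℝ => (i.factorial : ℝ)⁻¹ * (t ^ i * Real.exp (-(-s.re) * t))) atTop
      (𝓝 0) := by
    have := (Real.tendsto_pow_mul_exp_neg_atTop_nhds_zero i).comp
      (tendsto_id.const_mul_atTop (neg_pos.2 hs))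
    have h3 := this.const_mul ((i.factorial : ℝ)⁻¹ * ((-s.re) ^ i)⁻¹)
    rw [mul_zero] at h3
    refine h3.congr fun t => ?_
    have hne : (-s.re) ^ i ≠ 0 := pow_ne_zero _ (by linarith)
    simp only [Function.comp, id]
    rw [mul_pow, ← neg_mul]
    field_simp
  refine h2.congr' ?_
  filter_upwards [eventually_ge_atTop 0] with t ht
  rw [norm_mul, norm_mul, norm_pow, Complex.norm_exp, norm_inv, Complex.norm_natCast,
    Complex.norm_real, Real.norm_of_nonneg ht]
  have : ((t : ℂ) * s).re = -(-s.re) * t := by simp [mul_comm]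
  rw [this]; ring

/-- Over ℂ the generalized eigenspaces span, so it suffices to test generalized eigenvectors. -/
lemma tendsto_exp_complex (M : Matrix (Fin n) (Fin n) ℂ) (hM : ∀ s ∈ spectrum ℂ M, s.re < 0) :
    Tendsto (fun t : ℝ => NormedSpace.exp (t • M)) atTop (𝓝 0) := by
  have hall : ∀ v : Fin n → ℂ, Tendsto (fun t : ℝ => NormedSpace.exp (t • M) *ᵥ v) atTop (𝓝 0) := by
    intro v
    have hv : v ∈ ⨆ s : ℂ, Module.End.maxGenEigenspace (Matrix.toLin' M) s := by
      rw [Module.End.iSup_maxGenEigenspace_eq_top]; trivial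
    induction hv using Submodule.iSup_induction' with
    | mem s w hw =>
      by_cases h0 : w = 0
      · simp [h0]
      obtain ⟨k, hk⟩ := (Module.End.mem_maxGenEigenspace _ _ _).1 hw
      refine tendsto_exp_mulVec_of_genEigen M (s := s) (k := k) ?_ ?_
      · apply hM
        rw [← Matrix.spectrum_toLin', ← Module.End.hasEigenvalue_iff_mem_spectrum]
        refine Module.End.hasEigenvalue_of_hasGenEigenvalue (k := k) ?_
        change _ ≠ ⊥
        intro hbot
        refine h0 ?_
        rw [← Submodule.mem_bot ℂ, ← hbot]
        exact (Module.End.mem_genEigenspace_nat).2 (LinearMap.mem_ker.2 hk)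
      · have : Matrix.toLin' ((M - algebraMap ℂ _ s) ^ k) =
            (Matrix.toLin' M - s • (1 : Module.End ℂ (Fin n → ℂ))) ^ k := by
          rw [Matrix.toLin'_pow, map_sub]
          congr 2
          rw [Algebra.algebraMap_eq_smul_one, map_smul, Matrix.toLin'_one]
          rfl
        rw [← Matrix.toLin'_apply, this, hk]
    | zero => simp
    | add x y _ _ hx hy =>
      have := hx.add hy
      rw [add_zero] at this
      refine this.congr fun t => ?_
      rw [Matrix.mulVec_add]
  rw [tendsto_matrix_iff]
  intro i j
  have h1 := (tendsto_pi_nhds.1 (hall (Pi.single j 1))) i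
  simpa [Matrix.mulVec_single_one] using h1

/-- All eigenvalues of the real matrix `A` have negative real part. -/
def Hurwitz (A : Matrix (Fin n) (Fin n) ℝ) : Prop :=
  ∀ s ∈ spectrum ℂ (A.map (fun x : ℝ => (x : ℂ))), s.re < 0

lemma Hurwitz.tendsto_exp {A : Matrix (Fin n) (Fin n) ℝ} (hA : Hurwitz A) :
    Tendsto (fun t : ℝ => NormedSpace.exp (t • A)) atTop (𝓝 0) := by
  have h1 := tendsto_exp_complex _ hA
  have h2 : ∀ t : ℝ, NormedSpace.exp (t • A.map (fun x : ℝ => (x : ℂ))) =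
      (NormedSpace.exp (t • A)).map (fun x : ℝ => (x : ℂ)) := by
    intro t
    have := NormedSpace.map_exp (Complex.ofRealHom.mapMatrix (m := Fin n))
      (show Continuous fun M : Matrix (Fin n) (Fin n) ℝ => M.map (fun x : ℝ => (x : ℂ)) from
        continuous_id.matrix_map Complex.continuous_ofReal) (t • A)
    refine Eq.trans ?_ this.symm
    congr 1
    ext i j
    simp
  simp only [h2] at h1
  rw [tendsto_matrix_iff] at h1 ⊢
  intro i j
  have h4 := (Complex.continuous_re.tendsto _).comp (h1 i j)
  simpa [Function.comp_def] using h4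

end Hurwitz

/-! ### Lyapunov equations: solvability, smooth dependence, integral formula, stability criterion.
-/

section Lyapunov

open scoped Matrix.Norms.Frobenius

variable {n : ℕ}

lemma posSemidef_iff_real {M : Matrix (Fin n) (Fin n) ℝ} :
    M.PosSemidef ↔ Mᵀ = M ∧ ∀ v, 0 ≤ v ⬝ᵥ M *ᵥ v := by
  rw [Matrix.posSemidef_iff_dotProduct_mulVec]
  simp [Matrix.IsHermitian]

lemma posDef_iff_real {M : Matrix (Fin n) (Fin n) ℝ} :
    M.PosDef ↔ Mᵀ = M ∧ ∀ v, v ≠ 0 → 0 < v ⬝ᵥ M *ᵥ v := by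
  rw [Matrix.posDef_iff_dotProduct_mulVec]
  simp [Matrix.IsHermitian]

lemma Matrix.PosDef.transpose_eq {M : Matrix (Fin n) (Fin n) ℝ} (h : M.PosDef) : Mᵀ = M :=
  (posDef_iff_real.1 h).1

lemma Matrix.PosSemidef.transpose_eq {M : Matrix (Fin n) (Fin n) ℝ} (h : M.PosSemidef) : Mᵀ = M :=
  (posSemidef_iff_real.1 h).1

lemma Hurwitz.transpose {A : Matrix (Fin n) (Fin n) ℝ} (hA : Hurwitz A) : Hurwitz Aᵀ := by
  intro s hs
  apply hA s
  rw [Matrix.mem_spectrum_iff_isRoot_charpoly] at hs ⊢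
  rwa [← Matrix.charpoly_transpose]

lemma hasDerivAt_exp_smul_matrix (A : Matrix (Fin n) (Fin n) ℝ) (t : ℝ) :
    HasDerivAt (fun u : ℝ => NormedSpace.exp (u • A)) (A * NormedSpace.exp (t • A)) t :=
  hasDerivAt_exp_smul_const' A t

lemma hasDerivAt_lyapunov (A X : Matrix (Fin n) (Fin n) ℝ) (t : ℝ) :
    HasDerivAt (fun u : ℝ => (NormedSpace.exp (u • A))ᵀ * X * NormedSpace.exp (u • A))
      ((NormedSpace.exp (t • A))ᵀ * (Aᵀ * X + X * A) * NormedSpace.exp (t • A)) t := by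
  have h1 : HasDerivAt (fun u : ℝ => (NormedSpace.exp (u • A))ᵀ)
      ((NormedSpace.exp (t • A))ᵀ * Aᵀ) t := by
    have e : ∀ u : ℝ, NormedSpace.exp (u • Aᵀ) = (NormedSpace.exp (u • A))ᵀ := fun u => by
      rw [← Matrix.transpose_smul, Matrix.exp_transpose]
    refine ((hasDerivAt_exp_smul_const (𝕂 := ℝ) Aᵀ t).congr_of_eventuallyEq
      (Eventually.of_forall fun u => (e u).symm)).congr_deriv ?_
    exact congrArg (· * Aᵀ) (e t)
  have h2 := (h1.mul_const X).mul (hasDerivAt_exp_smul_matrix A t)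
  refine h2.congr_deriv ?_
  noncomm_ring

lemma Hurwitz.tendsto_lyapunov {A : Matrix (Fin n) (Fin n) ℝ} (hA : Hurwitz A)
    (X : Matrix (Fin n) (Fin n) ℝ) :
    Tendsto (fun u : ℝ => (NormedSpace.exp (u • A))ᵀ * X * NormedSpace.exp (u • A)) atTop
      (𝓝 0) := by
  have h1 : Continuous fun M : Matrix (Fin n) (Fin n) ℝ => Mᵀ * X * M := by fun_prop
  have h2 := (h1.tendsto 0).comp hA.tendsto_exp
  simpa [Function.comp_def] using h2

/-- The matrix e^{tAᵀ} X e^{tA} has zero derivative, equals X at t = 0 and tends to 0. This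
injectivity makes the Lyapunov operator invertible in finite dimension. -/
lemma Hurwitz.eq_zero {A X : Matrix (Fin n) (Fin n) ℝ} (hA : Hurwitz A)
    (hX : Aᵀ * X + X * A = 0) : X = 0 := by
  have h1 : ∀ t : ℝ, HasDerivAt
      (fun u : ℝ => (NormedSpace.exp (u • A))ᵀ * X * NormedSpace.exp (u • A)) 0 t := fun t => by
    simpa [hX] using hasDerivAt_lyapunov A X t
  have h2 := is_const_of_deriv_eq_zero (fun t => (h1 t).differentiableAt) (fun t => (h1 t).deriv)
  have h3 := hA.tendsto_lyapunov X
  have h4 : (fun u : ℝ => (NormedSpace.exp (u • A))ᵀ * X * NormedSpace.exp (u • A)) =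
      fun _ => X := by
    funext u
    rw [h2 u 0]
    simp
  rw [h4] at h3
  exact tendsto_nhds_unique tendsto_const_nhds h3

section Operator

/-- The topology of the Frobenius norm, as an instance that is found from the norm. -/
@[reducible] def frobTopology {a b : ℕ} : TopologicalSpace (Matrix (Fin a) (Fin b) ℝ) :=
  (Matrix.frobeniusNormedAddCommGroup (m := Fin a) (n := Fin b)
    (α := ℝ)).toPseudoMetricSpace.toUniformSpace.toTopologicalSpace

attribute [local instance] frobTopology

/-- The Lyapunov operator `X ↦ Aᵀ X + X A`. -/
def lyapOp (A : Matrix (Fin n) (Fin n) ℝ) :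
    Matrix (Fin n) (Fin n) ℝ →L[ℝ] Matrix (Fin n) (Fin n) ℝ :=
  LinearMap.toContinuousLinearMap
    { toFun := fun X => Aᵀ * X + X * A
      map_add' := fun X Y => by noncomm_ring
      map_smul' := fun c X => by simp }

@[simp] lemma lyapOp_apply (A X : Matrix (Fin n) (Fin n) ℝ) : lyapOp A X = Aᵀ * X + X * A := rfl

lemma contDiff_lyapOp {k : WithTop ℕ∞} :
    ContDiff ℝ k (lyapOp : Matrix (Fin n) (Fin n) ℝ → _) := by
  let L : Matrix (Fin n) (Fin n) ℝ →ₗ[ℝ]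
      (Matrix (Fin n) (Fin n) ℝ →L[ℝ] Matrix (Fin n) (Fin n) ℝ) :=
    { toFun := lyapOp
      map_add' := fun A B => by ext1 X; simp; noncomm_ring
      map_smul' := fun c A => by ext1 X; simp }
  exact L.toContinuousLinearMap.contDiff

lemma Hurwitz.isInvertible_lyapOp {A : Matrix (Fin n) (Fin n) ℝ} (hA : Hurwitz A) :
    (lyapOp A).IsInvertible := by
  have hinj : Function.Injective (lyapOp A).toLinearMap := by
    rw [injective_iff_map_eq_zero]
    exact fun X hX => hA.eq_zero hX
  exact ⟨(LinearEquiv.ofInjectiveEndo _ hinj).toContinuousLinearEquiv, by ext1 X; rfl⟩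

/-- The solution `X` of `Aᵀ X + X A = -M` for a Hurwitz matrix `A`. -/
def lyapSol (A M : Matrix (Fin n) (Fin n) ℝ) : Matrix (Fin n) (Fin n) ℝ := (lyapOp A).inverse (-M)

lemma Hurwitz.lyapSol_spec {A : Matrix (Fin n) (Fin n) ℝ} (hA : Hurwitz A)
    (M : Matrix (Fin n) (Fin n) ℝ) : Aᵀ * lyapSol A M + lyapSol A M * A = -M :=
  hA.isInvertible_lyapOp.self_apply_inverse (-M)

lemma Hurwitz.eq_lyapSol {A X M : Matrix (Fin n) (Fin n) ℝ} (hA : Hurwitz A)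
    (hX : Aᵀ * X + X * A = -M) : X = lyapSol A M := by
  refine sub_eq_zero.1 (hA.eq_zero ?_)
  have := hA.lyapSol_spec M
  calc Aᵀ * (X - lyapSol A M) + (X - lyapSol A M) * A
      = (Aᵀ * X + X * A) - (Aᵀ * lyapSol A M + lyapSol A M * A) := by noncomm_ring
    _ = 0 := by rw [hX, this, sub_self]

/-- Inversion of operators is smooth at invertible ones. All smoothness of the cost in the gain
comes from here. -/
lemma Hurwitz.contDiffAt_lyapSol {F : Type*} [NormedAddCommGroup F] [NormedSpace ℝ F]
    {k : WithTop ℕ∞} {a M : F → Matrix (Fin n) (Fin n) ℝ} {x : F} (hA : Hurwitz (a x))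
    (ha : ContDiffAt ℝ k a x) (hM : ContDiffAt ℝ k M x) :
    ContDiffAt ℝ k (fun y => lyapSol (a y) (M y)) x := by
  have h1 : ContDiffAt ℝ k (fun y => lyapOp (a y)) x := contDiff_lyapOp.contDiffAt.comp x ha
  have h2 : ContDiffAt ℝ k (fun y => (lyapOp (a y)).inverse) x :=
    ContDiffAt.comp (g := ContinuousLinearMap.inverse) x
      hA.isInvertible_lyapOp.contDiffAt_map_inverse h1
  exact h2.clm_apply hM.neg

lemma ContDiffAt.matrix_mul {F : Type*} [NormedAddCommGroup F] [NormedSpace ℝ F]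
    {k : WithTop ℕ∞} {a b c : ℕ} {f : F → Matrix (Fin a) (Fin b) ℝ}
    {g : F → Matrix (Fin b) (Fin c) ℝ} {x : F} (hf : ContDiffAt ℝ k f x)
    (hg : ContDiffAt ℝ k g x) : ContDiffAt ℝ k (fun y => f y * g y) x := by
  let R : Matrix (Fin a) (Fin b) ℝ → Matrix (Fin b) (Fin c) ℝ →L[ℝ] Matrix (Fin a) (Fin c) ℝ :=
    fun M => LinearMap.toContinuousLinearMap
      { toFun := fun N => M * N
        map_add' := fun X Y => Matrix.mul_add _ _ _
        map_smul' := fun c X => by simp }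
  let L : Matrix (Fin a) (Fin b) ℝ →ₗ[ℝ]
      (Matrix (Fin b) (Fin c) ℝ →L[ℝ] Matrix (Fin a) (Fin c) ℝ) :=
    { toFun := R
      map_add' := fun A B => by ext1 X; exact Matrix.add_mul A B X
      map_smul' := fun c A => by ext1 X; exact Matrix.smul_mul c A X }
  exact (L.toContinuousLinearMap.contDiff.contDiffAt.comp x hf).clm_apply hg

lemma ContDiffAt.matrix_transpose {F : Type*} [NormedAddCommGroup F] [NormedSpace ℝ F]
    {k : WithTop ℕ∞} {a b : ℕ} {f : F → Matrix (Fin a) (Fin b) ℝ} {x : F}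
    (hf : ContDiffAt ℝ k f x) : ContDiffAt ℝ k (fun y => (f y)ᵀ) x :=
  (LinearMap.toContinuousLinearMap
    (Matrix.transposeLinearEquiv (Fin a) (Fin b) ℝ ℝ).toLinearMap).contDiff.contDiffAt.comp x hf

end Operator

lemma Hurwitz.lyapSol_transpose {A : Matrix (Fin n) (Fin n) ℝ} (hA : Hurwitz A)
    {M : Matrix (Fin n) (Fin n) ℝ} (hM : Mᵀ = M) : (lyapSol A M)ᵀ = lyapSol A M := by
  refine hA.eq_lyapSol ?_
  have := congrArg Matrix.transpose (hA.lyapSol_spec M)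
  simp only [Matrix.transpose_add, Matrix.transpose_mul, Matrix.transpose_transpose,
    Matrix.transpose_neg, hM] at this
  rw [← this, add_comm]

lemma lyapSol_smul (A : Matrix (Fin n) (Fin n) ℝ) (c : ℝ)
    (M : Matrix (Fin n) (Fin n) ℝ) : lyapSol A (c • M) = c • lyapSol A M := by
  simp [lyapSol, ← smul_neg]

/-- The integral representation of the solution of the Lyapunov equation. -/
lemma Hurwitz.integral_quadratic {A : Matrix (Fin n) (Fin n) ℝ} (hA : Hurwitz A)
    {M : Matrix (Fin n) (Fin n) ℝ} (hM : M.PosSemidef) (v : Fin n → ℝ) :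
    ∫ t in Set.Ioi (0 : ℝ), (NormedSpace.exp (t • A) *ᵥ v) ⬝ᵥ M *ᵥ (NormedSpace.exp (t • A) *ᵥ v) =
      v ⬝ᵥ lyapSol A M *ᵥ v := by
  set X := lyapSol A M
  let ev : Matrix (Fin n) (Fin n) ℝ →L[ℝ] ℝ := LinearMap.toContinuousLinearMap
    { toFun := fun N => v ⬝ᵥ N *ᵥ v
      map_add' := fun N N' => by rw [Matrix.add_mulVec, dotProduct_add]
      map_smul' := fun c N => by rw [Matrix.smul_mulVec, dotProduct_smul]; rfl }
  have hev : ∀ N, ev N = v ⬝ᵥ N *ᵥ v := fun _ => rfl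
  have hquad : ∀ (t : ℝ) (N : Matrix (Fin n) (Fin n) ℝ),
      ev ((NormedSpace.exp (t • A))ᵀ * N * NormedSpace.exp (t • A)) =
        (NormedSpace.exp (t • A) *ᵥ v) ⬝ᵥ N *ᵥ (NormedSpace.exp (t • A) *ᵥ v) := by
    intro t N
    rw [hev, Matrix.mul_assoc, ← Matrix.mulVec_mulVec, ← Matrix.mulVec_mulVec,
      Matrix.dotProduct_mulVec, Matrix.vecMul_transpose]
  have hderiv : ∀ t ∈ Set.Ici (0 : ℝ), HasDerivAt
      (fun u : ℝ => ev ((NormedSpace.exp (u • A))ᵀ * X * NormedSpace.exp (u • A)))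
      (-((NormedSpace.exp (t • A) *ᵥ v) ⬝ᵥ M *ᵥ (NormedSpace.exp (t • A) *ᵥ v))) t := by
    intro t _
    have h1 := ev.hasFDerivAt.comp_hasDerivAt t (hasDerivAt_lyapunov A X t)
    refine h1.congr_deriv ?_
    refine (congrArg (fun N => ev ((NormedSpace.exp (t • A))ᵀ * N * NormedSpace.exp (t • A)))
      (hA.lyapSol_spec M)).trans ((hquad t (-M)).trans ?_)
    rw [Matrix.neg_mulVec, dotProduct_neg]
  have hlim : Tendsto (fun u : ℝ => ev ((NormedSpace.exp (u • A))ᵀ * X * NormedSpace.exp (u • A)))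
      atTop (𝓝 0) := by
    have := (ev.continuous.tendsto 0).comp (hA.tendsto_lyapunov X)
    rwa [map_zero] at this
  -- The sign of the integrand takes the place of a separate proof of integrability.
  have hint := integral_Ioi_of_hasDerivAt_of_nonpos' hderiv
    (fun t _ => neg_nonpos.2 ((posSemidef_iff_real.1 hM).2 _)) hlim
  rw [integral_neg] at hint
  have h0 : ev ((NormedSpace.exp ((0 : ℝ) • A))ᵀ * X * NormedSpace.exp ((0 : ℝ) • A)) =
      v ⬝ᵥ X *ᵥ v := by
    rw [hev]; simp
  rw [h0] at hint
  linarith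

lemma Hurwitz.lyapSol_posSemidef {A : Matrix (Fin n) (Fin n) ℝ} (hA : Hurwitz A)
    {M : Matrix (Fin n) (Fin n) ℝ} (hM : M.PosSemidef) : (lyapSol A M).PosSemidef := by
  rw [posSemidef_iff_real]
  refine ⟨hA.lyapSol_transpose hM.transpose_eq, fun v => ?_⟩
  rw [← hA.integral_quadratic hM]
  exact integral_nonneg fun t => (posSemidef_iff_real.1 hM).2 _

/-- Duality between the two Lyapunov equations. -/
lemma trace_lyapSol_mul {A M N X Y : Matrix (Fin n) (Fin n) ℝ}
    (hX : Aᵀ * X + X * A = -M) (hY : A * Y + Y * Aᵀ = -N) :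
    (X * N).trace = (Y * M).trace := by
  have h1 : N = -(A * Y + Y * Aᵀ) := by rw [hY, neg_neg]
  have h2 : M = -(Aᵀ * X + X * A) := by rw [hX, neg_neg]
  rw [h1, h2]
  simp only [mul_neg, mul_add, Matrix.trace_neg, Matrix.trace_add]
  congr 1
  have e1 : (X * (A * Y)).trace = (Y * (X * A)).trace := by
    rw [← Matrix.mul_assoc, Matrix.trace_mul_comm]
  have e2 : (X * (Y * Aᵀ)).trace = (Y * (Aᵀ * X)).trace := by
    rw [Matrix.trace_mul_comm, Matrix.mul_assoc]
  rw [e1, e2, add_comm]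

lemma quadratic_lyapunov {A Y N : Matrix (Fin n) (Fin n) ℝ} (hY : A * Y + Y * Aᵀ = -N)
    (hYt : Yᵀ = Y) (v : Fin n → ℝ) : 2 * ((Y *ᵥ v) ⬝ᵥ Aᵀ *ᵥ v) = -(v ⬝ᵥ N *ᵥ v) := by
  have h1 : v ⬝ᵥ (A * Y + Y * Aᵀ) *ᵥ v = -(v ⬝ᵥ N *ᵥ v) := by
    rw [hY, Matrix.neg_mulVec, dotProduct_neg]
  rw [← h1, Matrix.add_mulVec, dotProduct_add, ← Matrix.mulVec_mulVec, ← Matrix.mulVec_mulVec,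
    Matrix.dotProduct_mulVec v A, Matrix.dotProduct_mulVec v Y, ← Matrix.mulVec_transpose,
    ← Matrix.mulVec_transpose, hYt, dotProduct_comm (Aᵀ *ᵥ v)]
  ring

/-- Lyapunov's criterion: a positive semidefinite solution certifies stability. -/
lemma hurwitz_of_lyapunov {A Y N : Matrix (Fin n) (Fin n) ℝ} (hY : A * Y + Y * Aᵀ = -N)
    (hYp : Y.PosSemidef) (hN : N.PosDef) : Hurwitz A := by
  intro s hs
  have hs' : s ∈ spectrum ℂ ((Aᵀ).map (fun x : ℝ => (x : ℂ))) := by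
    rw [Matrix.mem_spectrum_iff_isRoot_charpoly] at hs ⊢
    rwa [← Matrix.charpoly_transpose]
  rw [← Matrix.spectrum_toLin', ← Module.End.hasEigenvalue_iff_mem_spectrum] at hs'
  obtain ⟨w, hw⟩ := hs'.exists_hasEigenvector
  have hw0 := hw.2
  have hws : (Aᵀ).map (fun x : ℝ => (x : ℂ)) *ᵥ w = s • w := by
    have := hw.apply_eq_smul
    rwa [Matrix.toLin'_apply] at this
  set u : Fin n → ℝ := fun i => (w i).re with hu
  set v : Fin n → ℝ := fun i => (w i).im with hv
  have e1 : Aᵀ *ᵥ u = s.re • u - s.im • v := by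
    funext i
    have := congrArg Complex.re (congrFun hws i)
    simpa [Matrix.mulVec, dotProduct, Complex.mul_re] using this
  have e2 : Aᵀ *ᵥ v = s.im • u + s.re • v := by
    funext i
    have := congrArg Complex.im (congrFun hws i)
    simp [Matrix.mulVec, dotProduct, Complex.mul_im] at this
    simp [Matrix.mulVec, dotProduct, hu, hv]
    linarith
  -- When the identities for u and v are added, the terms with Im s cancel by symmetry of Y. What
  -- remains is 2 Re s (uᵀYu + vᵀYv) = −(uᵀNu + vᵀNv) < 0.
  have h1 := quadratic_lyapunov hY hYp.transpose_eq u
  have h2 := quadratic_lyapunov hY hYp.transpose_eq v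
  rw [e1, dotProduct_sub, dotProduct_smul, dotProduct_smul] at h1
  rw [e2, dotProduct_add, dotProduct_smul, dotProduct_smul] at h2
  have h3 : (Y *ᵥ u) ⬝ᵥ v = (Y *ᵥ v) ⬝ᵥ u := by
    rw [dotProduct_comm, Matrix.dotProduct_mulVec, ← Matrix.mulVec_transpose, hYp.transpose_eq]
  have hNp := (posDef_iff_real.1 hN).2
  have hNs := (posSemidef_iff_real.1 hN.posSemidef).2
  have hYs := (posSemidef_iff_real.1 hYp).2
  have h4 : 0 < u ⬝ᵥ N *ᵥ u + v ⬝ᵥ N *ᵥ v := by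
    by_cases hu0 : u = 0
    · have hv0 : v ≠ 0 := by
        intro hv0
        apply hw0
        funext i
        exact Complex.ext (congrFun hu0 i) (congrFun hv0 i)
      have := hNp v hv0
      have := hNs u
      linarith
    · have := hNp u hu0
      have := hNs v
      linarith
  have h5 := hYs u
  have h6 := hYs v
  rw [dotProduct_comm] at h5 h6
  simp only [smul_eq_mul] at h1 h2
  rw [h3] at h1
  by_contra hcon
  push Not at hcon
  have h7 := mul_nonneg hcon h5
  have h8 := mul_nonneg hcon h6
  linarith

lemma lyapunov_posDef {A Y N : Matrix (Fin n) (Fin n) ℝ} (hY : A * Y + Y * Aᵀ = -N)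
    (hYp : Y.PosSemidef) (hN : N.PosDef) : Y.PosDef := by
  rw [posDef_iff_real]
  refine ⟨hYp.transpose_eq, fun v hv => lt_of_le_of_ne ((posSemidef_iff_real.1 hYp).2 v) ?_⟩
  intro h0
  have h1 : Y *ᵥ v = 0 := (hYp.dotProduct_mulVec_zero_iff v).1 (by simpa using h0.symm)
  have h2 := quadratic_lyapunov hY hYp.transpose_eq v
  rw [h1, zero_dotProduct] at h2
  have := (posDef_iff_real.1 hN).2 v hv
  linarith

end Lyapunov

/-! ### Frobenius inner product, vector norms and trace inequalities. -/

section FrobeniusInner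

open scoped Matrix.Norms.Frobenius

variable {a b : ℕ}

lemma frobenius_norm_sq (M : Matrix (Fin a) (Fin b) ℝ) : ‖M‖ ^ 2 = frobSq M := by
  have h : 0 ≤ ∑ i, ∑ j, M i j ^ 2 := by positivity
  rw [Matrix.frobenius_norm_def, frobSq]
  simp only [Real.norm_eq_abs, Real.rpow_two, sq_abs]
  rw [← Real.sqrt_eq_rpow, Real.sq_sqrt h]

/-- The Frobenius inner product. -/
@[reducible] def frobInner : InnerProductSpace ℝ (Matrix (Fin a) (Fin b) ℝ) where
  toNormedSpace := Matrix.frobeniusNormedSpace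
  inner M N := ∑ i, ∑ j, M i j * N i j
  norm_sq_eq_re_inner M := by
    rw [frobenius_norm_sq, frobSq]
    simp [sq]
  conj_inner_symm M N := by simp [mul_comm]
  add_left M N K := by simp [add_mul, Finset.sum_add_distrib]
  smul_left M N r := by simp [mul_assoc, Finset.mul_sum]

attribute [local instance] frobInner

lemma frobInner_def (M N : Matrix (Fin a) (Fin b) ℝ) : inner ℝ M N = ∑ i, ∑ j, M i j * N i j := rfl

lemma frobInner_eq_trace (M N : Matrix (Fin a) (Fin b) ℝ) : inner ℝ M N = (Mᵀ * N).trace := by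
  rw [frobInner_def, Finset.sum_comm]
  simp [Matrix.trace, Matrix.mul_apply]

lemma frobSq_eq_trace (M : Matrix (Fin a) (Fin b) ℝ) : frobSq M = (Mᵀ * M).trace := by
  rw [← frobInner_eq_trace, real_inner_self_eq_norm_sq, frobenius_norm_sq]

lemma stateDist_eq (z : GainState a b) (K : Matrix (Fin a) (Fin b) ℝ) :
    stateDist z (K, 0) = equilDist K z := by
  simp [stateDist, equilDist, frobenius_norm_sq]

end FrobeniusInner

section VecNorm

/-- Euclidean norm of a vector. -/
def vecNorm {a : ℕ} (v : Fin a → ℝ) : ℝ := ‖WithLp.toLp 2 v‖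

variable {a b : ℕ}

lemma vecNorm_nonneg (v : Fin a → ℝ) : 0 ≤ vecNorm v := norm_nonneg _

lemma vecNorm_sq (v : Fin a → ℝ) : vecNorm v ^ 2 = v ⬝ᵥ v := by
  rw [vecNorm, EuclideanSpace.norm_sq_eq]
  simp [dotProduct, sq]

lemma vecNorm_pos {v : Fin a → ℝ} (hv : v ≠ 0) : 0 < vecNorm v := by
  rw [vecNorm, norm_pos_iff]
  simpa using hv

lemma abs_dotProduct_le (v w : Fin a → ℝ) : |v ⬝ᵥ w| ≤ vecNorm v * vecNorm w := by
  have h := abs_real_inner_le_norm (WithLp.toLp 2 v) (WithLp.toLp 2 w)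
  have e : inner ℝ (WithLp.toLp 2 v) (WithLp.toLp 2 w) = v ⬝ᵥ w := by
    simp [PiLp.inner_apply, dotProduct, mul_comm]
  rwa [e] at h

lemma vecNorm_sub_le (v w : Fin a → ℝ) : vecNorm (v - w) ≤ vecNorm v + vecNorm w := by
  simp only [vecNorm, WithLp.toLp_sub]
  exact norm_sub_le _ _

lemma specNorm_nonneg (M : Matrix (Fin a) (Fin b) ℝ) : 0 ≤ specNorm M := by
  unfold specNorm
  open scoped Matrix.Norms.L2Operator in exact norm_nonneg M

lemma vecNorm_mulVec_le (M : Matrix (Fin a) (Fin b) ℝ) (v : Fin b → ℝ) :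
    vecNorm (M *ᵥ v) ≤ specNorm M * vecNorm v := by
  open scoped Matrix.Norms.L2Operator in
  exact Matrix.l2_opNorm_mulVec M (WithLp.toLp 2 v)

lemma specNorm_transpose (M : Matrix (Fin a) (Fin b) ℝ) : specNorm Mᵀ = specNorm M := by
  have h : Mᴴ = Mᵀ := by simp [Matrix.conjTranspose_eq_transpose_of_trivial]
  unfold specNorm
  rw [← h]
  open scoped Matrix.Norms.L2Operator in exact Matrix.l2_opNorm_conjTranspose M

lemma vecNorm_mulVec_le_frob (M : Matrix (Fin a) (Fin b) ℝ) (v : Fin b → ℝ) :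
    vecNorm (M *ᵥ v) ^ 2 ≤ frobSq M * vecNorm v ^ 2 := by
  rw [vecNorm_sq, vecNorm_sq, frobSq, Finset.sum_mul, dotProduct]
  refine Finset.sum_le_sum fun i _ => ?_
  have := Finset.sum_mul_sq_le_sq_mul_sq Finset.univ (M i) v
  simpa [Matrix.mulVec, dotProduct, ← sq] using this

end VecNorm

section Spectrum

variable {n m : ℕ}

lemma posSemidef_sub_smul_one {M : Matrix (Fin n) (Fin n) ℝ} (hM : Mᵀ = M) {c : ℝ}
    (hc : ∀ s ∈ spectrum ℝ M, c ≤ s) : (M - c • (1 : Matrix (Fin n) (Fin n) ℝ)).PosSemidef := by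
  rw [Matrix.posSemidef_iff_isHermitian_and_spectrum_nonneg]
  refine ⟨by simp [Matrix.IsHermitian, hM], fun s hs => ?_⟩
  have : s + c ∈ spectrum ℝ M := by
    rw [spectrum.mem_iff] at hs ⊢
    convert hs using 2
    simp only [Algebra.algebraMap_eq_smul_one]
    module
  have := hc _ this
  simp only [Set.mem_ofPred_eq]
  linarith

lemma posSemidef_smul_one_sub {M : Matrix (Fin n) (Fin n) ℝ} (hM : Mᵀ = M) {c : ℝ}
    (hc : ∀ s ∈ spectrum ℝ M, s ≤ c) : (c • (1 : Matrix (Fin n) (Fin n) ℝ) - M).PosSemidef := by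
  rw [Matrix.posSemidef_iff_isHermitian_and_spectrum_nonneg]
  refine ⟨by simp [Matrix.IsHermitian, hM], fun s hs => ?_⟩
  have : c - s ∈ spectrum ℝ M := by
    rw [spectrum.mem_iff] at hs ⊢
    rw [← IsUnit.neg_iff]
    convert hs using 2
    simp only [Algebra.algebraMap_eq_smul_one]
    module
  have := hc _ this
  simp only [Set.mem_ofPred_eq]
  linarith

lemma spectrum_real_finite {M : Matrix (Fin n) (Fin n) ℝ} (hM : M.IsHermitian) :
    (spectrum ℝ M).Finite := by
  rw [hM.spectrum_real_eq_range_eigenvalues]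
  exact Set.finite_range _

lemma spectrum_real_nonempty (hn : 0 < n) {M : Matrix (Fin n) (Fin n) ℝ} (hM : M.IsHermitian) :
    (spectrum ℝ M).Nonempty := by
  rw [hM.spectrum_real_eq_range_eigenvalues]
  exact ⟨_, ⟨0, hn⟩, rfl⟩

lemma posSemidef_sub_lamMin {M : Matrix (Fin n) (Fin n) ℝ} (hM : M.PosDef) :
    (M - lamMin M • (1 : Matrix (Fin n) (Fin n) ℝ)).PosSemidef :=
  posSemidef_sub_smul_one hM.transpose_eq fun _ hs =>
    csInf_le (spectrum_real_finite hM.isHermitian).bddBelow hs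

lemma posSemidef_lamMax_sub {M : Matrix (Fin n) (Fin n) ℝ} (hM : M.PosDef) :
    (lamMax M • (1 : Matrix (Fin n) (Fin n) ℝ) - M).PosSemidef :=
  posSemidef_smul_one_sub hM.transpose_eq fun _ hs =>
    le_csSup (spectrum_real_finite hM.isHermitian).bddAbove hs

lemma spectrum_pos {M : Matrix (Fin n) (Fin n) ℝ} (hM : M.PosDef) {s : ℝ} (hs : s ∈ spectrum ℝ M) :
    0 < s := by
  rw [hM.isHermitian.spectrum_real_eq_range_eigenvalues] at hs
  obtain ⟨i, rfl⟩ := hs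
  exact hM.eigenvalues_pos i

lemma lamMin_pos (hn : 0 < n) {M : Matrix (Fin n) (Fin n) ℝ} (hM : M.PosDef) : 0 < lamMin M :=
  spectrum_pos hM ((spectrum_real_nonempty hn hM.isHermitian).csInf_mem
    (spectrum_real_finite hM.isHermitian))

lemma lamMax_pos (hn : 0 < n) {M : Matrix (Fin n) (Fin n) ℝ} (hM : M.PosDef) : 0 < lamMax M :=
  spectrum_pos hM ((spectrum_real_nonempty hn hM.isHermitian).csSup_mem
    (spectrum_real_finite hM.isHermitian))

lemma lamMin_mul_le {M : Matrix (Fin n) (Fin n) ℝ} (hM : M.PosDef) (v : Fin n → ℝ) :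
    lamMin M * vecNorm v ^ 2 ≤ v ⬝ᵥ M *ᵥ v := by
  have h := (posSemidef_iff_real.1 (posSemidef_sub_lamMin hM)).2 v
  rw [Matrix.sub_mulVec, dotProduct_sub, Matrix.smul_mulVec, Matrix.one_mulVec, dotProduct_smul,
    smul_eq_mul, ← vecNorm_sq] at h
  linarith

lemma trace_mul_nonneg {M N : Matrix (Fin n) (Fin n) ℝ} (hM : M.PosSemidef) (hN : N.PosSemidef) :
    0 ≤ (M * N).trace := by
  obtain ⟨Z, rfl⟩ : ∃ Z : Matrix (Fin n) (Fin n) ℝ, N = Zᵀ * Z := by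
    open scoped MatrixOrder in
    obtain ⟨y, hy⟩ := CStarAlgebra.nonneg_iff_eq_star_mul_self.mp hN.nonneg
    exact ⟨y, by rw [hy, Matrix.star_eq_conjTranspose, conjTranspose_eq_transpose_of_trivial]⟩
  rw [← Matrix.mul_assoc, Matrix.trace_mul_comm, ← Matrix.mul_assoc]
  have := (hM.mul_mul_conjTranspose_same Z).trace_nonneg
  rwa [conjTranspose_eq_transpose_of_trivial] at this

lemma mul_trace_le {M N : Matrix (Fin n) (Fin n) ℝ} {c : ℝ}
    (hM : (M - c • (1 : Matrix (Fin n) (Fin n) ℝ)).PosSemidef) (hN : N.PosSemidef) :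
    c * N.trace ≤ (M * N).trace := by
  have := trace_mul_nonneg hM hN
  rw [Matrix.sub_mul, Matrix.trace_sub, Matrix.smul_mul, Matrix.one_mul, Matrix.trace_smul,
    smul_eq_mul] at this
  linarith

lemma trace_mul_le {M N : Matrix (Fin n) (Fin n) ℝ} {c : ℝ}
    (hM : (c • (1 : Matrix (Fin n) (Fin n) ℝ) - M).PosSemidef) (hN : N.PosSemidef) :
    (M * N).trace ≤ c * N.trace := by
  have := trace_mul_nonneg hM hN
  rw [Matrix.sub_mul, Matrix.trace_sub, Matrix.smul_mul, Matrix.one_mul, Matrix.trace_smul,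
    smul_eq_mul] at this
  linarith

/-- With Y = ZᵀZ the trace is the squared Frobenius norm of Z, which bounds its action on vectors.
-/
lemma posSemidef_trace_sub {Y : Matrix (Fin n) (Fin n) ℝ} (hY : Y.PosSemidef) :
    (Y.trace • (1 : Matrix (Fin n) (Fin n) ℝ) - Y).PosSemidef := by
  rw [posSemidef_iff_real]
  refine ⟨by simp [hY.transpose_eq], fun v => ?_⟩
  obtain ⟨Z, rfl⟩ : ∃ Z : Matrix (Fin n) (Fin n) ℝ, Y = Zᵀ * Z := by
    open scoped MatrixOrder in
    obtain ⟨y, hy⟩ := CStarAlgebra.nonneg_iff_eq_star_mul_self.mp hY.nonneg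
    exact ⟨y, by rw [hy, Matrix.star_eq_conjTranspose, conjTranspose_eq_transpose_of_trivial]⟩
  have h := vecNorm_mulVec_le_frob Z v
  rw [vecNorm_sq, vecNorm_sq, frobSq_eq_trace] at h
  rw [Matrix.sub_mulVec, dotProduct_sub, Matrix.smul_mulVec, Matrix.one_mulVec, dotProduct_smul,
    smul_eq_mul, ← Matrix.mulVec_mulVec, Matrix.dotProduct_mulVec v, Matrix.vecMul_transpose]
  linarith

lemma frobSq_le_trace_sq {Y : Matrix (Fin n) (Fin n) ℝ} (hY : Y.PosSemidef) :
    frobSq Y ≤ Y.trace ^ 2 := by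
  rw [frobSq_eq_trace, hY.transpose_eq, sq]
  exact trace_mul_le (posSemidef_trace_sub hY) hY

lemma vecNorm_mulVec_le_trace {Y : Matrix (Fin n) (Fin n) ℝ} (hY : Y.PosSemidef) (v : Fin n → ℝ) :
    vecNorm (Y *ᵥ v) ≤ Y.trace * vecNorm v := by
  have h1 := vecNorm_mulVec_le_frob Y v
  have h2 := frobSq_le_trace_sq hY
  have h3 := hY.trace_nonneg
  refine le_of_sq_le_sq ?_ (mul_nonneg h3 (vecNorm_nonneg v))
  rw [mul_pow]
  exact h1.trans (by gcongr)

lemma posSemidef_transpose_mul_mul {R : Matrix (Fin m) (Fin m) ℝ} (hR : R.PosSemidef)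
    (D : Matrix (Fin m) (Fin n) ℝ) : (Dᵀ * R * D).PosSemidef := by
  have := hR.conjTranspose_mul_mul_same D
  rwa [conjTranspose_eq_transpose_of_trivial] at this

lemma trace_transpose_mul_mul {R : Matrix (Fin m) (Fin m) ℝ} (D : Matrix (Fin m) (Fin n) ℝ) :
    (Dᵀ * R * D).trace = (R * (Dᵀᵀ * Dᵀ)).trace := by
  rw [Matrix.transpose_transpose, Matrix.mul_assoc, Matrix.trace_mul_comm, Matrix.mul_assoc]

lemma posSemidef_transpose_mul_self (D : Matrix (Fin m) (Fin n) ℝ) : (Dᵀ * D).PosSemidef := by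
  have := Matrix.posSemidef_conjTranspose_mul_self D
  rwa [conjTranspose_eq_transpose_of_trivial] at this

lemma trace_transpose_transpose (D : Matrix (Fin m) (Fin n) ℝ) :
    (Dᵀᵀ * Dᵀ).trace = frobSq D := by
  rw [Matrix.transpose_transpose, Matrix.trace_mul_comm, frobSq_eq_trace]

lemma lamMin_mul_frobSq_le {R : Matrix (Fin m) (Fin m) ℝ} (hR : R.PosDef)
    {Y : Matrix (Fin n) (Fin n) ℝ} {y : ℝ} (hy : 0 ≤ y)
    (hY : (Y - y • (1 : Matrix (Fin n) (Fin n) ℝ)).PosSemidef) (D : Matrix (Fin m) (Fin n) ℝ) :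
    y * lamMin R * frobSq D ≤ (Y * (Dᵀ * R * D)).trace := by
  refine le_trans ?_ (mul_trace_le hY (posSemidef_transpose_mul_mul hR.posSemidef D))
  rw [mul_assoc, trace_transpose_mul_mul, ← trace_transpose_transpose]
  exact mul_le_mul_of_nonneg_left
    (mul_trace_le (posSemidef_sub_lamMin hR) (posSemidef_transpose_mul_self _)) hy

lemma trace_le_lamMax_mul_frobSq {R : Matrix (Fin m) (Fin m) ℝ} (hR : R.PosDef)
    {Y : Matrix (Fin n) (Fin n) ℝ} (hY : Y.PosSemidef) (D : Matrix (Fin m) (Fin n) ℝ) :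
    (Y * (Dᵀ * R * D)).trace ≤ Y.trace * lamMax R * frobSq D := by
  refine (trace_mul_le (posSemidef_trace_sub hY)
    (posSemidef_transpose_mul_mul hR.posSemidef D)).trans ?_
  rw [mul_assoc, trace_transpose_mul_mul, ← trace_transpose_transpose]
  exact mul_le_mul_of_nonneg_left
    (trace_mul_le (posSemidef_lamMax_sub hR) (posSemidef_transpose_mul_self _)) hY.trace_nonneg

lemma exists_eigenvector {M : Matrix (Fin n) (Fin n) ℝ} {s : ℝ} (hs : s ∈ spectrum ℝ M) :
    ∃ v, v ≠ 0 ∧ M *ᵥ v = s • v := by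
  rw [← Matrix.spectrum_toLin', ← Module.End.hasEigenvalue_iff_mem_spectrum] at hs
  obtain ⟨v, hv⟩ := hs.exists_hasEigenvector
  have := hv.apply_eq_smul
  rw [Matrix.toLin'_apply] at this
  exact ⟨v, hv.2, this⟩

/-- Lower bound for the eigenvalues of the solution of a Lyapunov equation. -/
lemma lyapunov_lower_bound {A Y N : Matrix (Fin n) (Fin n) ℝ} (hY : A * Y + Y * Aᵀ = -N)
    (hYp : Y.PosSemidef) (hN : N.PosDef) {c : ℝ} (hc : 0 < c)
    (hA : ∀ v, vecNorm (Aᵀ *ᵥ v) ≤ c * vecNorm v) :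
    (Y - (lamMin N / (2 * c)) • (1 : Matrix (Fin n) (Fin n) ℝ)).PosSemidef := by
  refine posSemidef_sub_smul_one hYp.transpose_eq fun s hs => ?_
  have hs0 : 0 ≤ s := (Matrix.posSemidef_iff_isHermitian_and_spectrum_nonneg.1 hYp).2 hs
  obtain ⟨v, hv, hvs⟩ := exists_eigenvector hs
  -- On an eigenvector of Y with eigenvalue s: λmin(N)‖v‖² ≤ vᵀNv = −2s vᵀAᵀv ≤ 2sc‖v‖².
  have h1 := quadratic_lyapunov hY hYp.transpose_eq v
  rw [hvs, smul_dotProduct, smul_eq_mul] at h1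
  have h2 := lamMin_mul_le hN v
  have h3 := (abs_le.1 (abs_dotProduct_le v (Aᵀ *ᵥ v))).1
  have h4 : vecNorm v * vecNorm (Aᵀ *ᵥ v) ≤ vecNorm v * (c * vecNorm v) :=
    mul_le_mul_of_nonneg_left (hA v) (vecNorm_nonneg v)
  have h5 := vecNorm_pos hv
  rw [div_le_iff₀ (by positivity)]
  have h6 : s * -(v ⬝ᵥ Aᵀ *ᵥ v) ≤ s * (vecNorm v * (c * vecNorm v)) :=
    mul_le_mul_of_nonneg_left (by linarith) hs0
  refine le_of_mul_le_mul_right (a := vecNorm v ^ 2) ?_ (by positivity)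
  linarith

end Spectrum

/-! ### The LQR cost as a trace, and its exact expansion. -/

namespace SLQR

open scoped Matrix.Norms.Frobenius

attribute [local instance] frobInner

variable {m n : ℕ} {P : SLQR m n}

/-- Closed-loop matrix. -/
def closed (P : SLQR m n) (K : Matrix (Fin m) (Fin n) ℝ) : Matrix (Fin n) (Fin n) ℝ := P.A - P.B * K

/-- Weight of the closed loop. -/
def weight (P : SLQR m n) (K : Matrix (Fin m) (Fin n) ℝ) : Matrix (Fin n) (Fin n) ℝ :=
  P.Q + Kᵀ * P.R * K

/-- Value matrix of the gain `K`. -/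
def value (P : SLQR m n) (K : Matrix (Fin m) (Fin n) ℝ) : Matrix (Fin n) (Fin n) ℝ :=
  lyapSol (P.closed K) (P.weight K)

/-- Integrated second moment of the closed-loop state. -/
def gram (P : SLQR m n) (K : Matrix (Fin m) (Fin n) ℝ) : Matrix (Fin n) (Fin n) ℝ :=
  lyapSol (P.closed K)ᵀ P.Sig

/-- Residual of the optimality condition. -/
def resid (P : SLQR m n) (K : Matrix (Fin m) (Fin n) ℝ) : Matrix (Fin m) (Fin n) ℝ :=
  P.R * K - P.Bᵀ * P.value K

lemma hurwitz_of_mem_stab {K : Matrix (Fin m) (Fin n) ℝ} (hK : K ∈ P.stab) : Hurwitz (P.closed K) :=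
  hK

lemma Standing.weight_posSemidef (hP : P.Standing) (K : Matrix (Fin m) (Fin n) ℝ) :
    (P.weight K).PosSemidef :=
  hP.posQ.posSemidef.add (posSemidef_transpose_mul_mul hP.posR.posSemidef K)

lemma value_spec {K : Matrix (Fin m) (Fin n) ℝ} (hK : K ∈ P.stab) :
    (P.closed K)ᵀ * P.value K + P.value K * P.closed K = -P.weight K :=
  (hurwitz_of_mem_stab hK).lyapSol_spec _

lemma gram_spec {K : Matrix (Fin m) (Fin n) ℝ} (hK : K ∈ P.stab) :
    P.closed K * P.gram K + P.gram K * (P.closed K)ᵀ = -P.Sig := by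
  have := (hurwitz_of_mem_stab hK).transpose.lyapSol_spec P.Sig
  rwa [Matrix.transpose_transpose] at this

lemma Standing.value_posSemidef (hP : P.Standing) {K : Matrix (Fin m) (Fin n) ℝ}
    (hK : K ∈ P.stab) : (P.value K).PosSemidef :=
  (hurwitz_of_mem_stab hK).lyapSol_posSemidef (hP.weight_posSemidef K)

lemma Standing.gram_posSemidef (hP : P.Standing) {K : Matrix (Fin m) (Fin n) ℝ}
    (hK : K ∈ P.stab) : (P.gram K).PosSemidef :=
  (hurwitz_of_mem_stab hK).transpose.lyapSol_posSemidef hP.posSig.posSemidef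

lemma Standing.gram_posDef (hP : P.Standing) {K : Matrix (Fin m) (Fin n) ℝ}
    (hK : K ∈ P.stab) : (P.gram K).PosDef :=
  lyapunov_posDef (gram_spec hK) (hP.gram_posSemidef hK) hP.posSig

lemma running_cost_eq (K : Matrix (Fin m) (Fin n) ℝ) (x₀ : Fin n → ℝ) (t : ℝ) :
    P.traj K x₀ t ⬝ᵥ (P.Q *ᵥ P.traj K x₀ t) + P.control K x₀ t ⬝ᵥ (P.R *ᵥ P.control K x₀ t) =
      (NormedSpace.exp (t • P.closed K) *ᵥ x₀) ⬝ᵥ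
        P.weight K *ᵥ (NormedSpace.exp (t • P.closed K) *ᵥ x₀) := by
  have : P.traj K x₀ t = NormedSpace.exp (t • P.closed K) *ᵥ x₀ := rfl
  rw [control, this]
  set x := NormedSpace.exp (t • P.closed K) *ᵥ x₀
  rw [weight, Matrix.add_mulVec, dotProduct_add, Matrix.mulVec_neg, neg_dotProduct_neg,
    ← Matrix.mulVec_mulVec, ← Matrix.mulVec_mulVec, Matrix.dotProduct_mulVec x Kᵀ,
    Matrix.vecMul_transpose]

lemma Standing.integral_quadratic (hP : P.Standing) (X : Matrix (Fin n) (Fin n) ℝ) :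
    ∫ x, x ⬝ᵥ X *ᵥ x ∂P.law = (X * P.Sig).trace := by
  have h1 : ∀ x : Fin n → ℝ, x ⬝ᵥ X *ᵥ x = ∑ i, ∑ j, X i j * (x j * x i) := by
    intro x
    simp only [dotProduct, Matrix.mulVec, Finset.mul_sum]
    refine Finset.sum_congr rfl fun i _ => Finset.sum_congr rfl fun j _ => ?_
    ring
  calc ∫ x, x ⬝ᵥ X *ᵥ x ∂P.law = ∫ x, ∑ i, ∑ j, X i j * (x j * x i) ∂P.law :=
        integral_congr_ae (Eventually.of_forall h1)
    _ = ∑ i, ∑ j, X i j * P.Sig j i := by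
        refine (integral_finsetSum _ fun i _ => integrable_finsetSum _ fun j _ =>
          (hP.integrable j i).const_mul _).trans (Finset.sum_congr rfl fun i _ => ?_)
        refine (integral_finsetSum _ fun j _ => (hP.integrable j i).const_mul _).trans
          (Finset.sum_congr rfl fun j _ => ?_)
        rw [integral_const_mul, hP.secondMoment]
    _ = _ := by simp only [Matrix.trace, Matrix.diag, Matrix.mul_apply]

lemma Standing.cost_eq (hP : P.Standing) {K : Matrix (Fin m) (Fin n) ℝ} (hK : K ∈ P.stab) :
    P.cost K = (P.value K * P.Sig).trace := by
  rw [cost, ← hP.integral_quadratic]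
  congr 1
  funext x₀
  simp only [running_cost_eq]
  exact (hurwitz_of_mem_stab hK).integral_quadratic (hP.weight_posSemidef K) x₀

lemma Standing.cost_eq_gram (hP : P.Standing) {K : Matrix (Fin m) (Fin n) ℝ} (hK : K ∈ P.stab) :
    P.cost K = (P.gram K * P.weight K).trace := by
  rw [hP.cost_eq hK]
  exact trace_lyapSol_mul (value_spec hK) (gram_spec hK)

/-- Subtract the two Lyapunov equations after rewriting the one for K with the closed loop of K'.
The source is then exactly quadratic in K' − K, with linear part governed by `resid`. -/
lemma Standing.resid_spec (hP : P.Standing) {K K' : Matrix (Fin m) (Fin n) ℝ} (hK : K ∈ P.stab)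
    (hK' : K' ∈ P.stab) :
    (P.closed K')ᵀ * (P.value K' - P.value K) + (P.value K' - P.value K) * P.closed K' =
      -((K' - K)ᵀ * P.R * (K' - K) + (K' - K)ᵀ * P.resid K + (P.resid K)ᵀ * (K' - K)) := by
  have h1 := value_spec hK
  have h2 := value_spec hK'
  have e : P.closed K' = P.closed K - P.B * (K' - K) := by
    simp only [closed, Matrix.mul_sub]; abel
  have hX := (hP.value_posSemidef hK).transpose_eq
  have h3 : (P.closed K')ᵀ * P.value K + P.value K * P.closed K' =
      -P.weight K - (K' - K)ᵀ * P.Bᵀ * P.value K - P.value K * P.B * (K' - K) := by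
    rw [← h1, e, Matrix.transpose_sub, Matrix.transpose_mul]
    simp only [Matrix.sub_mul, Matrix.mul_sub, Matrix.mul_assoc]
    abel
  have h4 : (P.closed K')ᵀ * (P.value K' - P.value K) + (P.value K' - P.value K) * P.closed K' =
      -P.weight K' - (-P.weight K - (K' - K)ᵀ * P.Bᵀ * P.value K - P.value K * P.B * (K' - K)) := by
    rw [← h2, ← h3]
    simp only [Matrix.sub_mul, Matrix.mul_sub]
    abel
  rw [h4]
  simp only [weight, resid, Matrix.transpose_sub, Matrix.transpose_mul, hX,
    hP.posR.transpose_eq, Matrix.transpose_transpose, Matrix.sub_mul, Matrix.mul_sub,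
    Matrix.mul_assoc]
  abel

/-- Exact expansion of the cost around a stabilizing gain. -/
lemma Standing.cost_sub (hP : P.Standing) {K K' : Matrix (Fin m) (Fin n) ℝ} (hK : K ∈ P.stab)
    (hK' : K' ∈ P.stab) :
    P.cost K' - P.cost K = (P.gram K' * ((K' - K)ᵀ * P.R * (K' - K))).trace +
      2 * inner ℝ (P.resid K * P.gram K') (K' - K) := by
  -- Duality uses the second-moment matrix of the new gain K'; this is why there is no remainder
  -- term.
  have h1 := trace_lyapSol_mul (hP.resid_spec hK hK') (gram_spec hK')
  rw [hP.cost_eq hK, hP.cost_eq hK', ← Matrix.trace_sub, ← Matrix.sub_mul, h1, Matrix.mul_add,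
    Matrix.mul_add, Matrix.trace_add, Matrix.trace_add, frobInner_eq_trace, Matrix.transpose_mul,
    (hP.gram_posSemidef hK').transpose_eq]
  have : (P.gram K' * ((K' - K)ᵀ * P.resid K)).trace =
      (P.gram K' * ((P.resid K)ᵀ * (K' - K))).trace := by
    rw [← Matrix.trace_transpose, Matrix.transpose_mul, Matrix.transpose_mul,
      (hP.gram_posSemidef hK').transpose_eq, Matrix.transpose_transpose, Matrix.trace_mul_comm]
  rw [this]
  simp only [Matrix.mul_assoc]
  ring

section Smooth

variable {k : WithTop ℕ∞}

lemma contDiffAt_closed {K : Matrix (Fin m) (Fin n) ℝ} : ContDiffAt ℝ k P.closed K :=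
  contDiffAt_const.sub (contDiffAt_const.matrix_mul contDiffAt_id)

lemma contDiffAt_weight {K : Matrix (Fin m) (Fin n) ℝ} : ContDiffAt ℝ k P.weight K :=
  contDiffAt_const.add ((contDiffAt_id.matrix_transpose.matrix_mul contDiffAt_const).matrix_mul
    contDiffAt_id)

lemma contDiffAt_value {K : Matrix (Fin m) (Fin n) ℝ} (hK : K ∈ P.stab) :
    ContDiffAt ℝ k P.value K :=
  (hurwitz_of_mem_stab hK).contDiffAt_lyapSol contDiffAt_closed contDiffAt_weight

lemma contDiffAt_gram {K : Matrix (Fin m) (Fin n) ℝ} (hK : K ∈ P.stab) :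
    ContDiffAt ℝ k P.gram K :=
  Hurwitz.contDiffAt_lyapSol (a := fun K => (P.closed K)ᵀ) (M := fun _ => P.Sig)
    (hurwitz_of_mem_stab hK).transpose contDiffAt_closed.matrix_transpose
    contDiffAt_const

lemma contDiffAt_resid {K : Matrix (Fin m) (Fin n) ℝ} (hK : K ∈ P.stab) :
    ContDiffAt ℝ k P.resid K :=
  (contDiffAt_const.matrix_mul contDiffAt_id).sub
    (contDiffAt_const.matrix_mul (contDiffAt_value hK))

end Smooth

end SLQR

/-- Continuity of h at 0 is enough; both the cost and the gradient along a line are brought to this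
form. -/
lemma hasDerivAt_smul_self {F : Type*} [NormedAddCommGroup F] [NormedSpace ℝ F] {h : ℝ → F}
    (hh : ContinuousAt h 0) : HasDerivAt (fun t : ℝ => t • h t) (h 0) 0 := by
  rw [hasDerivAt_iff_tendsto_slope_zero]
  refine (hh.tendsto.mono_left nhdsWithin_le_nhds).congr' ?_
  filter_upwards [self_mem_nhdsWithin] with t ht
  simp [inv_smul_smul₀ ht]

/-! ### Openness of the stabilizing set, gradient of the cost, compact sublevel sets. -/

namespace SLQR

open scoped Matrix.Norms.Frobenius

attribute [local instance] frobInner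

variable {m n : ℕ} {P : SLQR m n}

/-- The matrix `gram K` remains a Lyapunov certificate for nearby gains, since its source term stays
close to `Sig` and hence positive definite. -/
lemma Standing.isOpen_stab (hP : P.Standing) (hn : 0 < n) : IsOpen P.stab := by
  rw [isOpen_iff_mem_nhds]
  intro K hK
  set N : Matrix (Fin m) (Fin n) ℝ → Matrix (Fin n) (Fin n) ℝ :=
    fun K' => -(P.closed K' * P.gram K + P.gram K * (P.closed K')ᵀ) with hN
  have hYt := (hP.gram_posSemidef hK).transpose_eq
  have hNK : N K = P.Sig := by rw [hN]; simp only [gram_spec hK, neg_neg]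
  have hNt : ∀ K', (N K')ᵀ = N K' := by
    intro K'
    simp only [hN, Matrix.transpose_neg, Matrix.transpose_add, Matrix.transpose_mul, hYt,
      Matrix.transpose_transpose]
    rw [add_comm]
  have hcont : ContinuousAt N K :=
    (((contDiffAt_closed (k := 0)).matrix_mul contDiffAt_const).add
      (contDiffAt_const.matrix_mul contDiffAt_closed.matrix_transpose)).neg.continuousAt
  have hlam := lamMin_pos hn hP.posSig
  have hev : ∀ᶠ K' in 𝓝 K, ‖N K' - P.Sig‖ < lamMin P.Sig := by
    have h1 : ContinuousAt (fun K' => ‖N K' - P.Sig‖) K := (hcont.sub continuousAt_const).norm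
    refine h1.eventually_lt continuousAt_const ?_
    rw [hNK, sub_self, norm_zero]
    exact hlam
  filter_upwards [hev] with K' hK'
  refine hurwitz_of_lyapunov (A := P.closed K') (Y := P.gram K) (N := N K')
    (by simp only [hN, neg_neg]) (hP.gram_posSemidef hK) ?_
  rw [posDef_iff_real]
  refine ⟨hNt K', fun v hv => ?_⟩
  have h1 := lamMin_mul_le hP.posSig v
  have h2 : v ⬝ᵥ N K' *ᵥ v = v ⬝ᵥ P.Sig *ᵥ v + v ⬝ᵥ (N K' - P.Sig) *ᵥ v := by
    rw [← dotProduct_add, ← Matrix.add_mulVec, add_sub_cancel]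
  have h3 := (abs_le.1 (abs_dotProduct_le v ((N K' - P.Sig) *ᵥ v))).1
  have h4 : vecNorm ((N K' - P.Sig) *ᵥ v) ≤ ‖N K' - P.Sig‖ * vecNorm v := by
    refine le_of_sq_le_sq ?_ (mul_nonneg (norm_nonneg _) (vecNorm_nonneg v))
    rw [mul_pow, frobenius_norm_sq]
    exact vecNorm_mulVec_le_frob _ v
  have h5 := vecNorm_pos hv
  have h6 : vecNorm v * vecNorm ((N K' - P.Sig) *ᵥ v) ≤
      vecNorm v * (‖N K' - P.Sig‖ * vecNorm v) := by gcongr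
  have h7 : ‖N K' - P.Sig‖ * vecNorm v ^ 2 < lamMin P.Sig * vecNorm v ^ 2 := by gcongr
  rw [h2]
  nlinarith

/-- The gradient of the cost at a stabilizing gain. -/
def grad (P : SLQR m n) (K : Matrix (Fin m) (Fin n) ℝ) : Matrix (Fin m) (Fin n) ℝ :=
  (2 : ℝ) • (P.resid K * P.gram K)

lemma contDiffAt_grad {k : WithTop ℕ∞} {K : Matrix (Fin m) (Fin n) ℝ} (hK : K ∈ P.stab) :
    ContDiffAt ℝ k P.grad K :=
  ((contDiffAt_resid hK).matrix_mul (contDiffAt_gram hK)).const_smul (2 : ℝ)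

lemma continuousAt_line (K V : Matrix (Fin m) (Fin n) ℝ) :
    ContinuousAt (fun t : ℝ => K + t • V) 0 := by fun_prop

lemma Standing.eventually_mem_stab (hP : P.Standing) (hn : 0 < n)
    {K : Matrix (Fin m) (Fin n) ℝ} (hK : K ∈ P.stab) (V : Matrix (Fin m) (Fin n) ℝ) :
    ∀ᶠ t : ℝ in 𝓝 0, K + t • V ∈ P.stab :=
  (continuousAt_line K V).eventually (by simpa using (hP.isOpen_stab hn).mem_nhds hK)

lemma Standing.hasLineDerivAt_cost (hP : P.Standing) (hn : 0 < n)
    {K : Matrix (Fin m) (Fin n) ℝ} (hK : K ∈ P.stab) (V : Matrix (Fin m) (Fin n) ℝ) :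
    HasLineDerivAt ℝ P.cost (inner ℝ (P.grad K) V) K V := by
  set h : ℝ → ℝ := fun t => t * (P.gram (K + t • V) * (Vᵀ * P.R * V)).trace +
    2 * inner ℝ (P.resid K * P.gram (K + t • V)) V with hh
  have hg : ContinuousAt (fun t : ℝ => P.gram (K + t • V)) 0 := by
    have e : K + (0 : ℝ) • V = K := by simp
    refine ContinuousAt.comp (g := P.gram) (f := fun t : ℝ => K + t • V) (x := (0 : ℝ)) ?_
      (continuousAt_line K V)
    rw [e]
    exact (contDiffAt_gram (k := 0) hK).continuousAt
  have hcont : ContinuousAt h 0 := by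
    have h1 : Continuous fun Y : Matrix (Fin n) (Fin n) ℝ => (Y * (Vᵀ * P.R * V)).trace := by
      fun_prop
    have h2 : Continuous fun Y : Matrix (Fin n) (Fin n) ℝ => inner ℝ (P.resid K * Y) V := by
      simp only [frobInner_eq_trace]
      fun_prop
    exact (continuousAt_id.mul (ContinuousAt.comp
        (g := fun Y : Matrix (Fin n) (Fin n) ℝ => (Y * (Vᵀ * P.R * V)).trace)
        h1.continuousAt hg)).add
      (continuousAt_const.mul (ContinuousAt.comp
        (g := fun Y : Matrix (Fin n) (Fin n) ℝ => inner ℝ (P.resid K * Y) V) h2.continuousAt hg))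
  have h0 : h 0 = inner ℝ (P.grad K) V := by
    simp only [hh, zero_smul, add_zero, zero_mul, zero_add, grad, real_inner_smul_left]
  have hd := (hasDerivAt_smul_self hcont).const_add (P.cost K)
  rw [h0] at hd
  refine hd.congr_of_eventuallyEq ?_
  filter_upwards [hP.eventually_mem_stab hn hK V] with t ht
  have := hP.cost_sub hK ht
  rw [add_sub_cancel_left, real_inner_smul_right, Matrix.transpose_smul] at this
  simp only [Matrix.smul_mul, Matrix.mul_smul, Matrix.trace_smul, smul_eq_mul] at this
  simp only [hh, smul_eq_mul]
  linarith

lemma inner_single (M : Matrix (Fin m) (Fin n) ℝ) (i : Fin m) (j : Fin n) :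
    inner ℝ M (Matrix.single i j (1 : ℝ)) = M i j := by
  rw [frobInner_def, Finset.sum_eq_single i, Finset.sum_eq_single j]
  · simp
  · intro b _ hb; simp [hb.symm]
  · simp
  · intro b _ hb; simp [hb.symm]
  · simp

lemma Standing.matGrad_cost (hP : P.Standing) (hn : 0 < n)
    {K : Matrix (Fin m) (Fin n) ℝ} (hK : K ∈ P.stab) : matGrad P.cost K = P.grad K := by
  ext i j
  rw [matGrad, Matrix.of_apply, (hP.hasLineDerivAt_cost hn hK _).lineDeriv, inner_single]

/-- Derivatives along lines do not give Fréchet differentiability; the smooth trace formula does. It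
agrees with the cost on the stabilizing set, so openness of that set is needed. -/
lemma Standing.differentiableAt_cost (hP : P.Standing) (hn : 0 < n)
    {K : Matrix (Fin m) (Fin n) ℝ} (hK : K ∈ P.stab) : DifferentiableAt ℝ P.cost K := by
  have h1 : DifferentiableAt ℝ (fun K => inner ℝ (P.value K)ᵀ P.Sig) K :=
    (((contDiffAt_value (k := 1) hK).matrix_transpose).differentiableAt (by simp)).inner ℝ
      (differentiableAt_const _)
  refine h1.congr_of_eventuallyEq ?_
  filter_upwards [(hP.isOpen_stab hn).mem_nhds hK] with K' hK'
  rw [hP.cost_eq hK', frobInner_eq_trace, Matrix.transpose_transpose]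

lemma Standing.hasFDerivAt_cost (hP : P.Standing) (hn : 0 < n)
    {K : Matrix (Fin m) (Fin n) ℝ} (hK : K ∈ P.stab) :
    HasFDerivAt P.cost (innerSL ℝ (P.grad K)) K := by
  have h1 := (hP.differentiableAt_cost hn hK).hasFDerivAt
  have e : innerSL ℝ (P.grad K) = fderiv ℝ P.cost K := by
    refine ContinuousLinearMap.ext fun V => ?_
    exact (hP.hasLineDerivAt_cost hn hK V).lineDeriv.symm.trans
      (hP.differentiableAt_cost hn hK).lineDeriv_eq_fderiv
  rw [e]
  exact h1

lemma vecNorm_closed_transpose_le (K : Matrix (Fin m) (Fin n) ℝ) {c : ℝ}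
    (hc : ∀ w, vecNorm (Kᵀ *ᵥ w) ≤ c * vecNorm w) (hc0 : 0 ≤ c) (v : Fin n → ℝ) :
    vecNorm ((P.closed K)ᵀ *ᵥ v) ≤ (specNorm P.A + specNorm P.B * c) * vecNorm v := by
  rw [closed, Matrix.transpose_sub, Matrix.transpose_mul, Matrix.sub_mulVec,
    ← Matrix.mulVec_mulVec]
  have h1 := vecNorm_mulVec_le P.Aᵀ v
  have h2 := vecNorm_mulVec_le P.Bᵀ v
  rw [specNorm_transpose] at h1 h2
  have h3 := mul_le_mul_of_nonneg_left h2 hc0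
  have h4 := hc (P.Bᵀ *ᵥ v)
  have h5 := vecNorm_sub_le (P.Aᵀ *ᵥ v) (Kᵀ *ᵥ P.Bᵀ *ᵥ v)
  linarith

lemma vecNorm_transpose_mulVec_le_frob (K : Matrix (Fin m) (Fin n) ℝ) (w : Fin m → ℝ) :
    vecNorm (Kᵀ *ᵥ w) ≤ ‖K‖ * vecNorm w := by
  refine le_of_sq_le_sq ?_ (mul_nonneg (norm_nonneg _) (vecNorm_nonneg w))
  rw [mul_pow, ← Matrix.frobenius_norm_transpose, frobenius_norm_sq]
  exact vecNorm_mulVec_le_frob _ w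

/-- Pairs of a gain and a certificate of its cost. -/
def certified (P : SLQR m n) (α : ℝ) :
    Set (Matrix (Fin m) (Fin n) ℝ × Matrix (Fin n) (Fin n) ℝ) :=
  {z | z.2.PosSemidef ∧ P.closed z.1 * z.2 + z.2 * (P.closed z.1)ᵀ = -P.Sig ∧
    (z.2 * P.weight z.1).trace ≤ α}

/-- The certified pairs do not mention stability, which Lyapunov's criterion recovers. They are cut
out by closed conditions, so compactness of the sublevel set follows by projection. -/
lemma Standing.sublevel_eq_image (hP : P.Standing) (α : ℝ) :
    P.sublevel α = Prod.fst '' P.certified α := by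
  ext K
  constructor
  · rintro ⟨hK, hα⟩
    exact ⟨(K, P.gram K), ⟨hP.gram_posSemidef hK, gram_spec hK,
      by rwa [hP.cost_eq_gram hK] at hα⟩, rfl⟩
  · rintro ⟨⟨K, Y⟩, ⟨h1, h2, h3⟩, rfl⟩
    have hK : K ∈ P.stab := hurwitz_of_lyapunov h2 h1 hP.posSig
    refine ⟨hK, ?_⟩
    have hY : Y = P.gram K := (hurwitz_of_mem_stab hK).transpose.eq_lyapSol
      (by rw [Matrix.transpose_transpose]; exact h2)
    rw [hP.cost_eq_gram hK, ← hY]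
    exact h3

lemma isClosed_posSemidef : IsClosed {Y : Matrix (Fin n) (Fin n) ℝ | Y.PosSemidef} := by
  simp only [posSemidef_iff_real, Set.ofPred_and, Set.ofPred_forall]
  refine (isClosed_eq (by fun_prop) continuous_id).inter (isClosed_iInter fun v => ?_)
  exact isClosed_le continuous_const (by fun_prop)

lemma isClosed_certified (P : SLQR m n) (α : ℝ) : IsClosed (P.certified α) := by
  have h1 : Continuous fun z : Matrix (Fin m) (Fin n) ℝ × Matrix (Fin n) (Fin n) ℝ =>
      P.closed z.1 := by unfold closed; fun_prop
  have h2 : Continuous fun z : Matrix (Fin m) (Fin n) ℝ × Matrix (Fin n) (Fin n) ℝ =>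
      P.weight z.1 := by unfold weight; fun_prop
  refine (isClosed_posSemidef.preimage continuous_snd).inter (IsClosed.inter ?_ ?_)
  · exact isClosed_eq ((h1.matrix_mul continuous_snd).add
      (continuous_snd.matrix_mul h1.matrix_transpose)) continuous_const
  · exact isClosed_le (continuous_snd.matrix_mul h2).matrix_trace continuous_const

lemma Standing.trace_gram_le (hP : P.Standing) {K : Matrix (Fin m) (Fin n) ℝ}
    {Y : Matrix (Fin n) (Fin n) ℝ} (hY : Y.PosSemidef) :
    lamMin P.Q * Y.trace ≤ (Y * P.weight K).trace := by
  have h1 := mul_trace_le (posSemidef_sub_lamMin hP.posQ) hY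
  have h2 := trace_mul_nonneg hY (posSemidef_transpose_mul_mul hP.posR.posSemidef K)
  rw [weight, Matrix.mul_add, Matrix.trace_add, Matrix.trace_mul_comm Y P.Q]
  linarith

lemma Standing.isBounded_certified (hP : P.Standing) (hm : 0 < m) (hn : 0 < n) (α : ℝ) :
    Bornology.IsBounded (P.certified α) := by
  have hQ := lamMin_pos hn hP.posQ
  have hR := lamMin_pos hm hP.posR
  have hS := lamMin_pos hn hP.posSig
  have ha := specNorm_nonneg P.A
  have hb := specNorm_nonneg P.B
  rw [isBounded_iff_forall_norm_le]
  refine ⟨max (max 1 (2 * α * (specNorm P.A + 1 + specNorm P.B) / (lamMin P.Sig * lamMin P.R)))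
    (α / lamMin P.Q), ?_⟩
  rintro ⟨K, Y⟩ ⟨hY, hlyap, hα⟩
  simp only at hY hlyap hα
  have htr : Y.trace ≤ α / lamMin P.Q := by
    rw [le_div_iff₀' hQ]
    exact (hP.trace_gram_le hY).trans hα
  rw [Prod.norm_def]
  refine max_le_max ?_ ?_
  -- A large gain forces cost: the lower bound on Y decays like 1/‖K‖ while the control weight grows
  -- like ‖K‖², so their product is at least linear in ‖K‖. The summand 1 keeps the denominator
  -- positive.
  · rcases le_total ‖K‖ 1 with h | h
    · exact h.trans (le_max_left _ _)
    refine le_trans ?_ (le_max_right _ _)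
    have hc0 : 0 < specNorm P.A + 1 + specNorm P.B * ‖K‖ := by positivity
    have h1 := lyapunov_lower_bound hlyap hY hP.posSig
      (c := specNorm P.A + 1 + specNorm P.B * ‖K‖) hc0 fun v => by
        refine (vecNorm_closed_transpose_le K (vecNorm_transpose_mulVec_le_frob K)
          (norm_nonneg _) v).trans ?_
        gcongr
        · exact vecNorm_nonneg v
        · linarith
    have h2 := lamMin_mul_frobSq_le hP.posR (by positivity) h1 K
    have h3 : (Y * (Kᵀ * P.R * K)).trace ≤ α := by
      have := trace_mul_nonneg hY hP.posQ.posSemidef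
      rw [weight, Matrix.mul_add, Matrix.trace_add] at hα
      linarith
    have hα0 : 0 ≤ α := le_trans (trace_mul_nonneg hY
      (posSemidef_transpose_mul_mul hP.posR.posSemidef K)) h3
    rw [← frobenius_norm_sq] at h2
    have h4 := h2.trans h3
    rw [div_mul_eq_mul_div, div_mul_eq_mul_div, div_le_iff₀ (by positivity)] at h4
    rw [le_div_iff₀ (by positivity)]
    have hK : 0 < ‖K‖ := by linarith
    refine le_of_mul_le_mul_right (a := ‖K‖) ?_ hK
    have h5 : specNorm P.A + 1 ≤ (specNorm P.A + 1) * ‖K‖ := by nlinarith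
    have h6 : α * (2 * (specNorm P.A + 1 + specNorm P.B * ‖K‖)) ≤
        α * (2 * ((specNorm P.A + 1) * ‖K‖ + specNorm P.B * ‖K‖)) := by gcongr
    linarith
  · refine le_trans ?_ htr
    refine le_of_sq_le_sq ?_ hY.trace_nonneg
    rw [frobenius_norm_sq]
    exact frobSq_le_trace_sq hY

lemma Standing.isCompact_sublevel (hP : P.Standing) (hm : 0 < m) (hn : 0 < n) (α : ℝ) :
    IsCompact (P.sublevel α) := by
  have : ProperSpace (Matrix (Fin m) (Fin n) ℝ) := FiniteDimensional.proper ℝ _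
  have : ProperSpace (Matrix (Fin n) (Fin n) ℝ) := FiniteDimensional.proper ℝ _
  rw [hP.sublevel_eq_image]
  exact (Metric.isCompact_of_isClosed_isBounded (isClosed_certified P α)
    (hP.isBounded_certified hm hn α)).image continuous_fst

end SLQR

/-! ### From a smooth function with a compact sublevel set to the abstract landscape. -/

section Abstract

variable {E : Type*} [NormedAddCommGroup E] [InnerProductSpace ℝ E]

lemma hasDerivAt_along {f : E → ℝ} {G x v : E} {t : ℝ}
    (hf : HasFDerivAt f (innerSL ℝ G) (x + t • v)) :
    HasDerivAt (fun s : ℝ => f (x + s • v)) (inner ℝ G v) t := by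
  have h1 : HasDerivAt (fun s : ℝ => x + s • v) ((1 : ℝ) • v) t :=
    ((hasDerivAt_id t).smul_const v).const_add x
  rw [one_smul] at h1
  exact hf.comp_hasDerivAt t h1

lemma exists_exit {f : E → ℝ} {g : E → E} {U : Set E} {α : ℝ} (hU : IsOpen U)
    (hf : ∀ x ∈ U, HasFDerivAt f (innerSL ℝ (g x)) x) (hS : IsClosed {x | x ∈ U ∧ f x ≤ α})
    {x : E} (hx : x ∈ U ∧ f x ≤ α) {v : E} (hv : ¬(x + v ∈ U ∧ f (x + v) ≤ α)) :
    ∃ s : ℝ, 0 ≤ s ∧ s ≤ 1 ∧ (x + s • v ∈ U ∧ f (x + s • v) ≤ α) ∧ f (x + s • v) = α ∧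
      0 ≤ inner ℝ (g (x + s • v)) v := by
  have hline : Continuous fun s : ℝ => x + s • v := by fun_prop
  have hI : IsCompact (Set.Icc (0 : ℝ) 1 ∩ (fun s : ℝ => x + s • v) ⁻¹' {x | x ∈ U ∧ f x ≤ α}) :=
    isCompact_Icc.inter_right (hS.preimage hline)
  -- The last parameter in [0, 1] whose point lies in the sublevel set: just beyond it, f exceeds α
  -- on U, which gives both the value α and a nonnegative slope.
  obtain ⟨s, ⟨⟨hs0, hs1⟩, hsU, hsα⟩, hmax⟩ := hI.exists_isGreatest
    ⟨0, ⟨le_rfl, zero_le_one⟩, by simpa using hx⟩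
  have hs1' : s < 1 := by
    refine lt_of_le_of_ne hs1 ?_
    rintro rfl
    exact hv ⟨by simpa using hsU, by simpa using hsα⟩
  have hfar : ∀ t, s < t → t < 1 → x + t • v ∈ U → α < f (x + t • v) := by
    intro t h1 h2 h3
    by_contra! h4
    exact absurd (hmax ⟨⟨hs0.trans h1.le, h2.le⟩, h3, h4⟩) (not_le.2 h1)
  have hev : ∀ᶠ t in 𝓝 s, x + t • v ∈ U := hline.continuousAt.eventually (hU.mem_nhds hsU)
  have hev1 : ∀ᶠ t in 𝓝 s, t < 1 := eventually_lt_nhds hs1'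
  have hder := hasDerivAt_along (hf _ hsU)
  have hne : (𝓝[>] s).NeBot := nhdsGT_neBot s
  refine ⟨s, hs0, hs1, ⟨hsU, hsα⟩, le_antisymm hsα ?_, ?_⟩
  · by_contra! h
    have h1 := hder.continuousAt.eventually_lt continuousAt_const h
    have h2 : ∀ᶠ t in 𝓝[>] s, False := by
      filter_upwards [mem_nhdsWithin_of_mem_nhds h1, mem_nhdsWithin_of_mem_nhds hev,
        mem_nhdsWithin_of_mem_nhds hev1, self_mem_nhdsWithin] with t a b c d
      exact absurd a (not_lt.2 (hfar t d c b).le)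
    exact h2.exists.elim fun _ h => h
  · by_contra! h
    have h1 := (hasDerivAt_iff_tendsto_slope.1 hder).eventually (eventually_lt_nhds h)
    have h1' : ∀ᶠ t in 𝓝[>] s, slope (fun s : ℝ => f (x + s • v)) s t < 0 :=
      h1.filter_mono (nhdsWithin_mono _ fun t ht => ne_of_gt ht)
    have h2 : ∀ᶠ t in 𝓝[>] s, False := by
      filter_upwards [h1', mem_nhdsWithin_of_mem_nhds hev,
        mem_nhdsWithin_of_mem_nhds hev1, self_mem_nhdsWithin] with t a b c d
      rw [slope_def_field, div_lt_iff₀ (sub_pos.2 d), zero_mul] at a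
      linarith [hfar t d c b]
    exact h2.exists.elim fun _ h => h

/-- The sublevel set need not be convex, so the mean value inequality is applied on `Cv`, where the
derivative of g is bounded by compactness of M. The resulting C is not explicit; it serves only the
existence of admissible step sizes. -/
lemma exists_landscape {f : E → ℝ} {g : E → E} {U M Cv : Set E} {α : ℝ} {xs : E}
    (hU : IsOpen U) (hf : ∀ x ∈ U, HasFDerivAt f (innerSL ℝ (g x)) x)
    (hg : ∀ x ∈ U, ContDiffAt ℝ 2 g x) (hS : IsCompact {x | x ∈ U ∧ f x ≤ α})
    (hM : IsCompact M) (hMU : M ⊆ U) (hCv : Convex ℝ Cv) (hCM : Cv ⊆ M)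
    (hSC : {x | x ∈ U ∧ f x ≤ α} ⊆ Cv) (hxs : xs ∈ U) (hxα : f xs ≤ α)
    (hmin : ∀ x ∈ U, f xs ≤ f x) (hstrict : ∀ x ∈ U, f x = f xs → x = xs)
    (hcrit : ∀ x ∈ U, g x = 0 → x = xs) :
    ∃ C, Landscape f g {x | x ∈ U ∧ f x ≤ α} α C xs := by
  have hgd : ∀ x ∈ U, HasFDerivAt g (fderiv ℝ g x) x := fun x hx =>
    ((hg x hx).differentiableAt (by simp)).hasFDerivAt
  have hcont : ContinuousOn (fderiv ℝ g) M := fun x hx =>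
    (((hg x (hMU hx)).fderiv_right (m := 1) (by norm_num)).continuousAt).continuousWithinAt
  obtain ⟨C₀, hC₀⟩ := hM.exists_bound_of_continuousOn hcont
  have hC : ∀ x ∈ Cv, ‖fderiv ℝ g x‖ ≤ max C₀ 1 := fun x hx =>
    (hC₀ x (hCM hx)).trans (le_max_left _ _)
  have hpos : 0 < max C₀ 1 := lt_max_of_lt_right one_pos
  have hlip : ∀ x ∈ Cv, ∀ y ∈ Cv, ‖g y - g x‖ ≤ max C₀ 1 * ‖y - x‖ := fun x hx y hy =>
    hCv.norm_image_sub_le_of_norm_hasFDerivWithin_le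
      (fun z hz => (hgd z (hMU (hCM hz))).hasFDerivWithinAt) hC hx hy
  refine ⟨max C₀ 1, hS, ⟨hxs, hxα⟩, fun x hx => hx.2, fun x hx => hmin x hx.1,
    fun x hx => hstrict x hx.1, fun x hx => (hf x hx.1).continuousAt.continuousWithinAt,
    fun x hx => hcrit x hx.1, hpos, ?_, fun x hx y hy => hlip x (hSC hx) y (hSC hy),
    fun x hx v hv => exists_exit hU hf hS.isClosed hx hv⟩
  intro x hx y hy
  have hseg : ∀ t ∈ Set.Icc (0 : ℝ) 1, x + t • (y - x) ∈ Cv := fun t ht =>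
    hCv.add_smul_sub_mem (hSC hx) (hSC hy) ht
  have hd : ∀ t ∈ Set.Icc (0 : ℝ) 1, HasDerivAt (fun s : ℝ => f (x + s • (y - x)))
      (inner ℝ (g (x + t • (y - x))) (y - x)) t := fun t ht =>
    hasDerivAt_along (hf _ (hMU (hCM (hseg t ht))))
  obtain ⟨t, ht, he⟩ := exists_hasDerivAt_eq_slope (fun s : ℝ => f (x + s • (y - x)))
    (fun t => inner ℝ (g (x + t • (y - x))) (y - x)) zero_lt_one
    (fun t ht => (hd t ht).continuousAt.continuousWithinAt)
    (fun t ht => hd t (Set.Ioo_subset_Icc_self ht))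
  have ht' := Set.Ioo_subset_Icc_self ht
  simp only [one_smul, zero_smul, add_zero, sub_zero, div_one, add_sub_cancel] at he
  have h1 := hlip x (hSC hx) _ (hseg t ht')
  have h2 := real_inner_le_norm (g (x + t • (y - x)) - g x) (y - x)
  rw [inner_sub_left, he] at h2
  rw [add_sub_cancel_left, norm_smul, Real.norm_eq_abs, abs_of_nonneg ht'.1] at h1
  have h3 : t * ‖y - x‖ ≤ ‖y - x‖ := mul_le_of_le_one_left (norm_nonneg _) ht'.2
  have h4 : ‖g (x + t • (y - x)) - g x‖ ≤ max C₀ 1 * ‖y - x‖ :=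
    h1.trans (mul_le_mul_of_nonneg_left h3 hpos.le)
  have h5 := mul_le_mul_of_nonneg_right h4 (norm_nonneg (y - x))
  nlinarith

end Abstract

/-! ### Uniqueness of the critical gain. -/

namespace SLQR

open scoped Matrix.Norms.Frobenius

attribute [local instance] frobInner

variable {m n : ℕ} {P : SLQR m n}

lemma Standing.grad_eq_zero_iff (hP : P.Standing) {K : Matrix (Fin m) (Fin n) ℝ}
    (hK : K ∈ P.stab) : P.grad K = 0 ↔ P.resid K = 0 := by
  have hdet : IsUnit (P.gram K).det := isUnit_iff_ne_zero.2 (hP.gram_posDef hK).det_pos.ne'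
  constructor
  · intro h
    have h1 : P.resid K * P.gram K = 0 := (smul_eq_zero.1 h).resolve_left two_ne_zero
    rw [← Matrix.mul_nonsing_inv_cancel_right _ (P.resid K) hdet, h1, Matrix.zero_mul]
  · intro h
    rw [grad, h, Matrix.zero_mul, smul_zero]

lemma Standing.grad_eq_zero (hP : P.Standing) (hn : 0 < n) {K : Matrix (Fin m) (Fin n) ℝ}
    (hK : P.IsOptimal K) : P.grad K = 0 := by
  have h1 : IsLocalMin P.cost K := by
    filter_upwards [(hP.isOpen_stab hn).mem_nhds hK.1] with K' hK' using hK.2 K' hK'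
  have h2 := h1.hasFDerivAt_eq_zero (hP.hasFDerivAt_cost hn hK.1)
  have h3 : innerSL ℝ (P.grad K) (P.grad K) = 0 := by rw [h2]; rfl
  rw [innerSL_apply_apply] at h3
  exact inner_self_eq_zero.1 h3

lemma Standing.cost_sub_of_resid (hP : P.Standing) {K K' : Matrix (Fin m) (Fin n) ℝ}
    (hK : K ∈ P.stab) (hr : P.resid K = 0) (hK' : K' ∈ P.stab) :
    P.cost K' - P.cost K = (P.gram K' * ((K' - K)ᵀ * P.R * (K' - K))).trace := by
  rw [hP.cost_sub hK hK', hr, Matrix.zero_mul, inner_zero_left, mul_zero, add_zero]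

/-- At a critical gain only the quadratic term of the expansion is left, and it is positive for K' ≠
K. So a critical gain is the strict global minimizer, which also makes it unique. -/
lemma Standing.eq_of_cost_le (hP : P.Standing) (hm : 0 < m) (hn : 0 < n)
    {K K' : Matrix (Fin m) (Fin n) ℝ}
    (hK : K ∈ P.stab) (hr : P.resid K = 0) (hK' : K' ∈ P.stab) (h : P.cost K' ≤ P.cost K) :
    K' = K := by
  have h1 := hP.cost_sub_of_resid hK hr hK'
  have hY := hP.gram_posDef hK'
  have hlam := lamMin_pos hn hY
  have hR := lamMin_pos hm hP.posR
  have h2 := lamMin_mul_frobSq_le hP.posR hlam.le (posSemidef_sub_lamMin hY) (K' - K)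
  rw [← h1, ← frobenius_norm_sq] at h2
  have h3 : ‖K' - K‖ ^ 2 ≤ 0 := by
    by_contra! h3
    have := mul_pos (mul_pos hlam hR) h3
    linarith
  have h4 : ‖K' - K‖ = 0 := by nlinarith [norm_nonneg (K' - K)]
  exact sub_eq_zero.1 (norm_eq_zero.1 h4)

lemma Standing.eq_of_grad_eq_zero (hP : P.Standing) (hm : 0 < m) (hn : 0 < n)
    {K K' : Matrix (Fin m) (Fin n) ℝ} (hK : P.IsOptimal K) (hK' : K' ∈ P.stab)
    (h : P.grad K' = 0) : K' = K :=
  (hP.eq_of_cost_le hm hn hK' ((hP.grad_eq_zero_iff hK').1 h) hK.1 (hK.2 K' hK')).symm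

lemma Standing.contDiffAt_matGrad (hP : P.Standing) (hn : 0 < n) {k : WithTop ℕ∞}
    {K : Matrix (Fin m) (Fin n) ℝ} (hK : K ∈ P.stab) : ContDiffAt ℝ k (matGrad P.cost) K := by
  refine (contDiffAt_grad hK).congr_of_eventuallyEq ?_
  filter_upwards [(hP.isOpen_stab hn).mem_nhds hK] with K' hK' using hP.matGrad_cost hn hK'

lemma Standing.exists_landscape (hP : P.Standing) (hm : 0 < m) (hn : 0 < n)
    {Kstar Kinit K₀ : Matrix (Fin m) (Fin n) ℝ} {Cv : Set (Matrix (Fin m) (Fin n) ℝ)}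
    (hopt : P.IsOptimal Kstar) (hCv : Convex ℝ Cv) (hCM : Cv ⊆ P.sublevel (P.cost Kinit))
    (hK₀ : K₀ ∈ P.stab) (hSC : P.sublevel (P.cost K₀) ⊆ Cv) :
    ∃ C, Landscape P.cost (matGrad P.cost) (P.sublevel (P.cost K₀)) (P.cost K₀) C Kstar := by
  have hg0 := hP.grad_eq_zero hn hopt
  refine _root_.exists_landscape (U := P.stab) (hP.isOpen_stab hn) (fun K hK => ?_)
    (fun K hK => hP.contDiffAt_matGrad hn hK) (hP.isCompact_sublevel hm hn (P.cost K₀))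
    (hP.isCompact_sublevel hm hn (P.cost Kinit)) (fun K hK => hK.1) hCv hCM hSC hopt.1
    (hopt.2 K₀ hK₀) hopt.2 (fun K hK h => ?_) (fun K hK h => ?_)
  · rw [hP.matGrad_cost hn hK]
    exact hP.hasFDerivAt_cost hn hK
  · exact hP.eq_of_cost_le hm hn hopt.1 ((hP.grad_eq_zero_iff hopt.1).1 hg0) hK h.le
  · rw [hP.matGrad_cost hn hK] at h
    exact hP.eq_of_grad_eq_zero hm hn hopt hK h

end SLQR

/-- Use nonnegativity of the form at Lx − Hx and the upper bound at Hx. -/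
lemma norm_sq_le_of_symmetric {E : Type*} [NormedAddCommGroup E] [InnerProductSpace ℝ E]
    {H : E →L[ℝ] E} (hH : ∀ x y, inner ℝ (H x) y = inner ℝ x (H y)) {L : ℝ} (hL : 0 < L)
    (h0 : ∀ x, 0 ≤ inner ℝ (H x) x) (h1 : ∀ x, inner ℝ (H x) x ≤ L * ‖x‖ ^ 2) (x : E) :
    ‖H x‖ ^ 2 ≤ L * inner ℝ (H x) x := by
  have h2 := h0 (L • x - H x)
  have h3 := h1 (H x)
  rw [map_sub, map_smul, inner_sub_left, inner_sub_right, inner_sub_right, inner_smul_left,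
    inner_smul_left, inner_smul_right, inner_smul_right, hH (H x) x, real_inner_self_eq_norm_sq]
    at h2
  simp only [conj_trivial] at h2
  refine le_of_mul_le_mul_left ?_ hL
  nlinarith

/-! ### Hessian at the optimal gain and its bounds. -/

namespace SLQR

open scoped Matrix.Norms.Frobenius

attribute [local instance] frobInner

variable {m n : ℕ} {P : SLQR m n}

section Hessian

variable {K : Matrix (Fin m) (Fin n) ℝ}

/-- At a critical gain the value matrix changes only to second order in t, so to first order the
residual changes by t R V. -/
lemma Standing.resid_line (hP : P.Standing) (hK : K ∈ P.stab) (hr : P.resid K = 0)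
    {V : Matrix (Fin m) (Fin n) ℝ} {t : ℝ} (ht : K + t • V ∈ P.stab) :
    P.resid (K + t • V) =
      t • (P.R * V - t • (P.Bᵀ * lyapSol (P.closed (K + t • V)) (Vᵀ * P.R * V))) := by
  have h1 := hP.resid_spec hK ht
  rw [hr, Matrix.transpose_zero, Matrix.zero_mul, Matrix.mul_zero, add_zero, add_zero,
    add_sub_cancel_left] at h1
  have h2 := (hurwitz_of_mem_stab ht).eq_lyapSol h1
  have h3 : (t • V)ᵀ * P.R * (t • V) = (t * t) • (Vᵀ * P.R * V) := by
    rw [Matrix.transpose_smul, Matrix.smul_mul, Matrix.smul_mul, Matrix.mul_smul, smul_smul]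
  rw [h3, lyapSol_smul, sub_eq_iff_eq_add] at h2
  rw [resid] at hr ⊢
  rw [h2, Matrix.mul_add, Matrix.mul_add, ← sub_eq_zero.1 hr, Matrix.mul_smul, Matrix.mul_smul,
    smul_sub, smul_smul]
  abel

/-- The gradient along a line through a critical gain. -/
lemma Standing.exists_grad_line (hP : P.Standing) (hK : K ∈ P.stab)
    (hr : P.resid K = 0) (V : Matrix (Fin m) (Fin n) ℝ) :
    ∃ h : ℝ → Matrix (Fin m) (Fin n) ℝ, ContinuousAt h 0 ∧
      h 0 = (2 : ℝ) • (P.R * V * P.gram K) ∧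
      ∀ t : ℝ, K + t • V ∈ P.stab → P.grad (K + t • V) = t • h t := by
  have e : K + (0 : ℝ) • V = K := by simp
  have hline : ContDiffAt ℝ 0 (fun s : ℝ => K + s • V) 0 :=
    contDiffAt_const.add (contDiffAt_id.smul contDiffAt_const)
  have hclosed : ContDiffAt ℝ 0 (fun s : ℝ => P.closed (K + s • V)) 0 :=
    contDiffAt_const.sub (contDiffAt_const.matrix_mul hline)
  have hlyap : ContDiffAt ℝ 0
      (fun s : ℝ => lyapSol (P.closed (K + s • V)) (Vᵀ * P.R * V)) 0 := by
    refine Hurwitz.contDiffAt_lyapSol (a := fun s : ℝ => P.closed (K + s • V))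
      (M := fun _ => Vᵀ * P.R * V) ?_ hclosed contDiffAt_const
    simp only [e]
    exact hurwitz_of_mem_stab hK
  have hgram : ContDiffAt ℝ 0 (fun s : ℝ => P.gram (K + s • V)) 0 := by
    refine Hurwitz.contDiffAt_lyapSol (a := fun s : ℝ => (P.closed (K + s • V))ᵀ)
      (M := fun _ => P.Sig) ?_ hclosed.matrix_transpose contDiffAt_const
    simp only [e]
    exact (hurwitz_of_mem_stab hK).transpose
  refine ⟨fun s : ℝ => (2 : ℝ) • ((P.R * V - s •
      (P.Bᵀ * lyapSol (P.closed (K + s • V)) (Vᵀ * P.R * V))) * P.gram (K + s • V)),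
    (((contDiffAt_const.sub (contDiffAt_id.smul (contDiffAt_const.matrix_mul hlyap))).matrix_mul
      hgram).const_smul (2 : ℝ)).continuousAt, ?_, fun t ht => ?_⟩
  · simp only [zero_smul, sub_zero, add_zero]
  · rw [grad, hP.resid_line hK hr ht, Matrix.smul_mul, smul_comm]

/-- The Hessian of the cost at a critical gain. -/
lemma Standing.fderiv_grad (hP : P.Standing) (hn : 0 < n) (hK : K ∈ P.stab) (hr : P.resid K = 0)
    (V : Matrix (Fin m) (Fin n) ℝ) :
    fderiv ℝ P.grad K V = (2 : ℝ) • (P.R * V * P.gram K) := by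
  obtain ⟨h, hcont, h0, hh⟩ := hP.exists_grad_line hK hr V
  have e : K + (0 : ℝ) • V = K := by simp
  have hd : HasFDerivAt P.grad (fderiv ℝ P.grad K) (K + (0 : ℝ) • V) := by
    rw [e]
    exact ((contDiffAt_grad (k := 1) hK).differentiableAt (by simp)).hasFDerivAt
  have h1 : HasDerivAt (fun s : ℝ => K + s • V) V 0 := by
    have := ((hasDerivAt_id (0 : ℝ)).smul_const V).const_add K
    rwa [one_smul] at this
  have h2 : HasDerivAt (P.grad ∘ fun s : ℝ => K + s • V) (fderiv ℝ P.grad K V) 0 :=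
    hd.comp_hasDerivAt (0 : ℝ) h1
  have h3 := hasDerivAt_smul_self hcont
  rw [h0] at h3
  refine h2.unique (h3.congr_of_eventuallyEq ?_)
  filter_upwards [hP.eventually_mem_stab hn hK V] with t ht using hh t ht

lemma inner_hessian (hP : P.Standing) (hK : K ∈ P.stab) (U V : Matrix (Fin m) (Fin n) ℝ) :
    inner ℝ ((2 : ℝ) • (P.R * U * P.gram K)) V = 2 * (P.gram K * (Uᵀ * P.R * V)).trace := by
  rw [real_inner_smul_left, frobInner_eq_trace, Matrix.transpose_mul, Matrix.transpose_mul,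
    (hP.gram_posSemidef hK).transpose_eq, hP.posR.transpose_eq]
  simp only [Matrix.mul_assoc]

lemma inner_hessian_symm (hP : P.Standing) (hK : K ∈ P.stab) (U V : Matrix (Fin m) (Fin n) ℝ) :
    inner ℝ ((2 : ℝ) • (P.R * U * P.gram K)) V = inner ℝ U ((2 : ℝ) • (P.R * V * P.gram K)) := by
  rw [real_inner_comm ((2 : ℝ) • (P.R * V * P.gram K)) U, inner_hessian hP hK,
    inner_hessian hP hK, ← Matrix.trace_transpose,
    Matrix.transpose_mul, Matrix.transpose_mul, Matrix.transpose_mul,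
    (hP.gram_posSemidef hK).transpose_eq, hP.posR.transpose_eq, Matrix.transpose_transpose,
    Matrix.trace_mul_comm]
  simp only [Matrix.mul_assoc]

lemma Standing.hasFDerivAt_matGrad (hP : P.Standing) (hn : 0 < n) (hK : K ∈ P.stab) :
    HasFDerivAt (matGrad P.cost) (fderiv ℝ P.grad K) K := by
  refine HasFDerivAt.congr_of_eventuallyEq
    ((contDiffAt_grad (k := 1) hK).differentiableAt (by simp)).hasFDerivAt ?_
  filter_upwards [(hP.isOpen_stab hn).mem_nhds hK] with K' hK' using hP.matGrad_cost hn hK'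

end Hessian

section Constants

variable {K : Matrix (Fin m) (Fin n) ℝ}

lemma Standing.lamMin_mul_trace_gram_le (hP : P.Standing) (hK : K ∈ P.stab) :
    lamMin P.Q * (P.gram K).trace ≤ P.cost K := by
  rw [hP.cost_eq_gram hK]
  exact hP.trace_gram_le (hP.gram_posSemidef hK)

lemma Standing.lamMin_mul_trace_value_le (hP : P.Standing) (hK : K ∈ P.stab) :
    lamMin P.Sig * (P.value K).trace ≤ P.cost K := by
  rw [hP.cost_eq hK, Matrix.trace_mul_comm]
  exact mul_trace_le (posSemidef_sub_lamMin hP.posSig) (hP.value_posSemidef hK)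

lemma Standing.cost_pos (hP : P.Standing) (hn : 0 < n) (hK : K ∈ P.stab) : 0 < P.cost K := by
  have : Nonempty (Fin n) := ⟨⟨0, hn⟩⟩
  exact (mul_pos (lamMin_pos hn hP.posQ) (hP.gram_posDef hK).trace_pos).trans_le
    (hP.lamMin_mul_trace_gram_le hK)

lemma vecNorm_transpose_mulVec_le {c : ℝ} (hc : 0 ≤ c)
    (h : ∀ v, vecNorm (K *ᵥ v) ≤ c * vecNorm v) (w : Fin m → ℝ) :
    vecNorm (Kᵀ *ᵥ w) ≤ c * vecNorm w := by
  have h1 : vecNorm (Kᵀ *ᵥ w) ^ 2 = w ⬝ᵥ K *ᵥ Kᵀ *ᵥ w := by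
    rw [vecNorm_sq, Matrix.dotProduct_mulVec w, ← Matrix.mulVec_transpose]
  have h2 := (le_abs_self _).trans (abs_dotProduct_le w (K *ᵥ Kᵀ *ᵥ w))
  have h3 := mul_le_mul_of_nonneg_left (h (Kᵀ *ᵥ w)) (vecNorm_nonneg w)
  rcases (vecNorm_nonneg (Kᵀ *ᵥ w)).eq_or_lt with h4 | h4
  · rw [← h4]
    exact mul_nonneg hc (vecNorm_nonneg w)
  · refine le_of_mul_le_mul_right ?_ h4
    nlinarith

/-- Bound of a critical gain. -/
lemma Standing.vecNorm_mulVec_le_of_resid (hP : P.Standing) (hm : 0 < m) (hn : 0 < n)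
    (hK : K ∈ P.stab) (hr : P.resid K = 0) (v : Fin n → ℝ) :
    vecNorm (K *ᵥ v) ≤
      specNorm P.B * P.cost K / (lamMin P.Sig * lamMin P.R) * vecNorm v := by
  have hR := lamMin_pos hm hP.posR
  have hS := lamMin_pos hn hP.posSig
  have h1 : P.R *ᵥ K *ᵥ v = P.Bᵀ *ᵥ P.value K *ᵥ v := by
    rw [Matrix.mulVec_mulVec, Matrix.mulVec_mulVec]
    rw [resid] at hr
    rw [sub_eq_zero.1 hr]
  have h2 := lamMin_mul_le hP.posR (K *ᵥ v)
  rw [h1] at h2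
  have h3 := (le_abs_self _).trans (abs_dotProduct_le (K *ᵥ v) (P.Bᵀ *ᵥ P.value K *ᵥ v))
  have h4 := vecNorm_mulVec_le P.Bᵀ (P.value K *ᵥ v)
  rw [specNorm_transpose] at h4
  have h5 := vecNorm_mulVec_le_trace (hP.value_posSemidef hK) v
  have hb := specNorm_nonneg P.B
  have hv := vecNorm_nonneg v
  have hKv := vecNorm_nonneg (K *ᵥ v)
  have h6 : vecNorm (P.Bᵀ *ᵥ P.value K *ᵥ v) ≤
      specNorm P.B * ((P.value K).trace * vecNorm v) :=
    h4.trans (mul_le_mul_of_nonneg_left h5 hb)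
  have h7 := hP.lamMin_mul_trace_value_le hK
  have hf := (hP.cost_pos hn hK).le
  rcases hKv.eq_or_lt with h8 | h8
  · rw [← h8]
    positivity
  have h9 : lamMin P.R * vecNorm (K *ᵥ v) ≤ specNorm P.B * ((P.value K).trace * vecNorm v) := by
    refine le_of_mul_le_mul_right ?_ h8
    have := mul_le_mul_of_nonneg_left h6 hKv
    nlinarith
  rw [div_mul_eq_mul_div, le_div_iff₀ (by positivity)]
  have h10 := mul_le_mul_of_nonneg_left h9 hS.le
  have h11 := mul_le_mul_of_nonneg_left h7 (mul_nonneg hb hv)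
  nlinarith

/-- The bound of the closed loop matrix that enters the gradient-domination constant. -/
def loopBound (P : SLQR m n) (α : ℝ) : ℝ :=
  specNorm P.A + specNorm P.B ^ 2 * α / (lamMin P.Sig * lamMin P.R)

lemma Standing.vecNorm_closed_transpose_le_loopBound (hP : P.Standing) (hm : 0 < m) (hn : 0 < n)
    (hK : K ∈ P.stab) (hr : P.resid K = 0) (v : Fin n → ℝ) :
    vecNorm ((P.closed K)ᵀ *ᵥ v) ≤ P.loopBound (P.cost K) * vecNorm v := by
  have hR := lamMin_pos hm hP.posR
  have hS := lamMin_pos hn hP.posSig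
  have hf := hP.cost_pos hn hK
  have hb := specNorm_nonneg P.B
  have hc : 0 ≤ specNorm P.B * P.cost K / (lamMin P.Sig * lamMin P.R) := by positivity
  refine (vecNorm_closed_transpose_le K (vecNorm_transpose_mulVec_le hc
    (hP.vecNorm_mulVec_le_of_resid hm hn hK hr)) hc v).trans_eq ?_
  rw [loopBound]
  ring

/-- If the bound vanished, so would the closed-loop matrix, and the Lyapunov equation would give
vᵀΣv = 0. -/
lemma Standing.loopBound_pos (hP : P.Standing) (hm : 0 < m) (hn : 0 < n)
    (hK : K ∈ P.stab) (hr : P.resid K = 0) : 0 < P.loopBound (P.cost K) := by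
  have hR := lamMin_pos hm hP.posR
  have hS := lamMin_pos hn hP.posSig
  have hf := hP.cost_pos hn hK
  have ha := specNorm_nonneg P.A
  have h0 : 0 ≤ P.loopBound (P.cost K) := by
    unfold loopBound
    positivity
  refine h0.lt_of_ne fun h => ?_
  have h1 := hP.vecNorm_closed_transpose_le_loopBound hm hn hK hr
  rw [← h] at h1
  set v : Fin n → ℝ := fun _ => 1
  have hv : v ≠ 0 := fun e => one_ne_zero (congrFun e ⟨0, hn⟩)
  have h2 : (P.closed K)ᵀ *ᵥ v = 0 := by
    by_contra h3
    have := vecNorm_pos h3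
    have := h1 v
    linarith
  have h3 : v ⬝ᵥ (P.closed K * P.gram K + P.gram K * (P.closed K)ᵀ) *ᵥ v = 0 := by
    rw [Matrix.add_mulVec, ← Matrix.mulVec_mulVec, ← Matrix.mulVec_mulVec, h2,
      Matrix.mulVec_zero, add_zero, Matrix.dotProduct_mulVec, ← Matrix.mulVec_transpose, h2,
      zero_dotProduct]
  rw [gram_spec hK, Matrix.neg_mulVec, dotProduct_neg, neg_eq_zero] at h3
  have h4 := (posDef_iff_real.1 hP.posSig).2 v hv
  linarith

lemma Standing.gram_lower_bound (hP : P.Standing) (hm : 0 < m) (hn : 0 < n)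
    (hK : K ∈ P.stab) (hr : P.resid K = 0) :
    (P.gram K - (lamMin P.Sig / (2 * P.loopBound (P.cost K))) •
      (1 : Matrix (Fin n) (Fin n) ℝ)).PosSemidef :=
  lyapunov_lower_bound (gram_spec hK) (hP.gram_posSemidef hK) hP.posSig
    (hP.loopBound_pos hm hn hK hr) (hP.vecNorm_closed_transpose_le_loopBound hm hn hK hr)

/-- Compares a lower and an upper bound for the trace of `gram K`. -/
lemma Standing.lamMin_mul_le_loopBound (hP : P.Standing) (hm : 0 < m) (hn : 0 < n)
    (hK : K ∈ P.stab) (hr : P.resid K = 0) :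
    lamMin P.Sig * lamMin P.Q ≤ 2 * P.cost K * P.loopBound (P.cost K) := by
  have hQ := lamMin_pos hn hP.posQ
  have hS := lamMin_pos hn hP.posSig
  have hN := hP.loopBound_pos hm hn hK hr
  have h1 := (hP.gram_lower_bound hm hn hK hr).trace_nonneg
  have h2 := hP.lamMin_mul_trace_gram_le hK
  rw [Matrix.trace_sub, Matrix.trace_smul, Matrix.trace_one, Fintype.card_fin, smul_eq_mul,
    sub_nonneg] at h1
  have h3 : (1 : ℝ) ≤ n := by exact_mod_cast hn
  have h4 : lamMin P.Sig / (2 * P.loopBound (P.cost K)) ≤ (P.gram K).trace :=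
    (le_mul_of_one_le_right (by positivity) h3).trans h1
  rw [div_le_iff₀ (by positivity)] at h4
  have h5 := mul_le_mul_of_nonneg_left h4 hQ.le
  nlinarith

lemma Standing.plConst_pos (hP : P.Standing) (hm : 0 < m) (hn : 0 < n)
    (hK : K ∈ P.stab) (hr : P.resid K = 0) : 0 < P.plConst (P.cost K) (P.cost K) := by
  have hQ := lamMin_pos hn hP.posQ
  have hS := lamMin_pos hn hP.posSig
  have hR := lamMin_pos hm hP.posR
  have hf := hP.cost_pos hn hK
  have hN : 0 < specNorm P.A + specNorm P.B ^ 2 * P.cost K / (lamMin P.Sig * lamMin P.R) :=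
    hP.loopBound_pos hm hn hK hr
  unfold plConst
  positivity

/-- The Hessian at a critical gain is bounded below by the gradient-domination constant. -/
lemma Standing.plConst_mul_le (hP : P.Standing) (hm : 0 < m) (hn : 0 < n)
    (hK : K ∈ P.stab) (hr : P.resid K = 0) (V : Matrix (Fin m) (Fin n) ℝ) :
    4 * P.plConst (P.cost K) (P.cost K) * ‖V‖ ^ 2 ≤
      inner ℝ ((2 : ℝ) • (P.R * V * P.gram K)) V := by
  have hQ := lamMin_pos hn hP.posQ
  have hS := lamMin_pos hn hP.posSig
  have hR := lamMin_pos hm hP.posR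
  have hf := hP.cost_pos hn hK
  have hN := hP.loopBound_pos hm hn hK hr
  have h1 := lamMin_mul_frobSq_le hP.posR (by positivity) (hP.gram_lower_bound hm hn hK hr) V
  rw [inner_hessian hP hK, frobenius_norm_sq]
  refine le_trans ?_ (mul_le_mul_of_nonneg_left h1 zero_le_two)
  rw [← mul_assoc]
  refine mul_le_mul_of_nonneg_right ?_ (by rw [← frobenius_norm_sq]; positivity)
  -- With N the loop bound, the Hessian is at least λmin(R) λmin(Σ)/N. Multiplying by λmin(Σ)
  -- λmin(Q)/(2fN) ≤ 1 gives exactly 4μ.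
  have h2 := hP.lamMin_mul_le_loopBound hm hn hK hr
  have e : P.plConst (P.cost K) (P.cost K) = lamMin P.R * lamMin P.Sig ^ 2 * lamMin P.Q /
    (8 * P.cost K * P.loopBound (P.cost K) ^ 2) := rfl
  rw [e, mul_div_assoc', div_mul_eq_mul_div, mul_div_assoc', div_le_div_iff₀ (by positivity)
    (by positivity)]
  have h3 := mul_le_mul_of_nonneg_left h2
    (show 0 ≤ 8 * lamMin P.R * lamMin P.Sig * P.loopBound (P.cost K) by positivity)
  nlinarith

lemma Standing.xi_nonneg (hP : P.Standing) (hn : 0 < n) {α : ℝ} (hα : 0 ≤ α) : 0 ≤ P.xi α := by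
  have hQ := lamMin_pos hn hP.posQ
  have hS := lamMin_pos hn hP.posSig
  have hb := specNorm_nonneg P.B
  unfold xi
  positivity

lemma Standing.xi_mono (hP : P.Standing) (hn : 0 < n) {α β : ℝ} (hα : 0 ≤ α) (h : α ≤ β) :
    P.xi α ≤ P.xi β := by
  have hQ := lamMin_pos hn hP.posQ
  have hS := lamMin_pos hn hP.posSig
  have hb := specNorm_nonneg P.B
  have hβ := hα.trans h
  unfold xi
  gcongr

lemma Standing.smoothConst_pos (hP : P.Standing) (hm : 0 < m) (hn : 0 < n) {α : ℝ}
    (hα : 0 < α) : 0 < P.smoothConst α := by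
  have hQ := lamMin_pos hn hP.posQ
  have hR := lamMax_pos hm hP.posR
  have hb := specNorm_nonneg P.B
  have := hP.xi_nonneg hn hα.le
  unfold smoothConst
  positivity

lemma Standing.smoothConst_mono (hP : P.Standing) (hm : 0 < m) (hn : 0 < n) {α β : ℝ}
    (hα : 0 ≤ α) (h : α ≤ β) : P.smoothConst α ≤ P.smoothConst β := by
  have hQ := lamMin_pos hn hP.posQ
  have hR := lamMax_pos hm hP.posR
  have hb := specNorm_nonneg P.B
  have h1 := hP.xi_nonneg hn hα
  have h2 := hP.xi_mono hn hα h
  have hβ := hα.trans h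
  unfold smoothConst
  gcongr

/-- The Hessian at a stabilizing gain is bounded above by the smoothness constant. -/
lemma Standing.le_smoothConst_mul (hP : P.Standing) (hm : 0 < m) (hn : 0 < n)
    (hK : K ∈ P.stab) (V : Matrix (Fin m) (Fin n) ℝ) :
    inner ℝ ((2 : ℝ) • (P.R * V * P.gram K)) V ≤ P.smoothConst (P.cost K) * ‖V‖ ^ 2 := by
  have hQ := lamMin_pos hn hP.posQ
  have hR := lamMax_pos hm hP.posR
  have hf := hP.cost_pos hn hK
  have hb := specNorm_nonneg P.B
  have hxi := hP.xi_nonneg hn hf.le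
  have h1 := trace_le_lamMax_mul_frobSq hP.posR (hP.gram_posSemidef hK) V
  rw [inner_hessian hP hK]
  rw [← frobenius_norm_sq] at h1
  have h2 : (P.gram K).trace ≤ P.cost K / lamMin P.Q := by
    rw [le_div_iff₀' hQ]
    exact hP.lamMin_mul_trace_gram_le hK
  calc 2 * (P.gram K * (Vᵀ * P.R * V)).trace
      ≤ 2 * ((P.gram K).trace * lamMax P.R * ‖V‖ ^ 2) := by linarith
    _ ≤ 2 * (P.cost K / lamMin P.Q * (lamMax P.R + √n * specNorm P.B * P.xi (P.cost K)) *
        ‖V‖ ^ 2) := by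
      gcongr
      -- For this form λmax(R) suffices; the ξ-term is nonnegative slack.
      exact le_add_of_nonneg_right (by positivity)
    _ = P.smoothConst (P.cost K) * ‖V‖ ^ 2 := by
      rw [smoothConst]
      ring

/-- The constants 4μ and L bound the same quadratic form, so any nonzero V compares them. -/
lemma Standing.four_le_condNumber (hP : P.Standing) (hm : 0 < m) (hn : 0 < n)
    (hK : K ∈ P.stab) (hr : P.resid K = 0) : 4 ≤ P.condNumber (P.cost K) := by
  rw [condNumber, le_div_iff₀ (hP.plConst_pos hm hn hK hr)]
  set V : Matrix (Fin m) (Fin n) ℝ := Matrix.of fun _ _ => 1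
  have hV : V ≠ 0 := fun e => one_ne_zero (congrFun (congrFun e ⟨0, hm⟩) ⟨0, hn⟩)
  have h1 : 0 < ‖V‖ ^ 2 := by positivity
  exact le_of_mul_le_mul_right
    ((hP.plConst_mul_le hm hn hK hr V).trans (hP.le_smoothConst_mul hm hn hK V)) h1

end Constants

end SLQR

lemma tendsto_of_equilDist {E : Type*} [NormedAddCommGroup E] {xs : E} {z : ℕ → E × E}
    (h : Tendsto (fun k => equilDist xs (z k)) atTop (𝓝 0)) :
    Tendsto (fun k => (z k).1) atTop (𝓝 xs) ∧ Tendsto (fun k => (z k).2) atTop (𝓝 0) := by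
  constructor
  · rw [tendsto_iff_norm_sub_tendsto_zero]
    refine squeeze_zero (fun _ => norm_nonneg _) (fun k => ?_) h
    exact Real.le_sqrt_of_sq_le (by nlinarith [sq_nonneg ‖(z k).2‖])
  · rw [tendsto_zero_iff_norm_tendsto_zero]
    refine squeeze_zero (fun _ => norm_nonneg _) (fun k => ?_) h
    exact Real.le_sqrt_of_sq_le (by nlinarith [sq_nonneg ‖(z k).1 - xs‖])

/-! ### Transfer to the LQR iterates and conclusion. -/

namespace SLQR

open scoped Matrix.Norms.Frobenius

attribute [local instance] frobInner

variable {m n : ℕ} {P : SLQR m n}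

lemma restartStep_eq (d T η α : ℝ) :
    P.restartStep d 0 T η α = momentumStep (matGrad P.cost) (P.sublevel α) d T η := by
  funext z
  have e : P.euler d 0 T z = momentumEuler (matGrad P.cost) d T z := by
    rw [euler, momentumEuler, zero_smul, add_zero]
  rw [restartStep, momentumStep, e]

lemma stateDist_iterates (d T η α : ℝ) (K : Matrix (Fin m) (Fin n) ℝ) (z : GainState m n) (k : ℕ) :
    stateDist (P.iterates d 0 T η α z k) (K, 0) =
      equilDist K ((momentumStep (matGrad P.cost) (P.sublevel α) d T η)^[k] z) := by
  rw [stateDist_eq, iterates, restartStep_eq]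

lemma Standing.sublevel_eq_singleton (hP : P.Standing) (hm : 0 < m) (hn : 0 < n)
    {Kstar K₀ : Matrix (Fin m) (Fin n) ℝ} (hopt : P.IsOptimal Kstar)
    (h : P.cost K₀ ≤ P.cost Kstar) (hK₀ : K₀ ∈ P.stab) : P.sublevel (P.cost K₀) = {Kstar} := by
  have hr := (hP.grad_eq_zero_iff hopt.1).1 (hP.grad_eq_zero hn hopt)
  ext K
  constructor
  · rintro ⟨h1, h2⟩
    exact hP.eq_of_cost_le hm hn hopt.1 hr h1 (h2.trans h)
  · rintro rfl
    exact ⟨hopt.1, hopt.2 K₀ hK₀⟩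

lemma equilDist_singleton (hP : P.Standing) (hn : 0 < n)
    {Kstar : Matrix (Fin m) (Fin n) ℝ} (hopt : P.IsOptimal Kstar) {d T η : ℝ} (hT : 0 < T)
    {z : GainState m n} (hz : z.1 ∈ ({Kstar} : Set (Matrix (Fin m) (Fin n) ℝ))) (k : ℕ) :
    equilDist Kstar ((momentumStep (matGrad P.cost) {Kstar} d T η)^[k + 1] z) = 0 := by
  rw [momentumStep_iterate_singleton ?_ hT hz]
  · simp [equilDist]
  · rw [hP.matGrad_cost hn hopt.1, hP.grad_eq_zero hn hopt]

/-- A step below the explicit bound keeps the oscillating modes of the Hessian stable. -/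
lemma smoothConst_mul_sq_le {L C d η T : ℝ} (hL : 0 < L) (hLC : L ≤ C) (hη : 0 ≤ η) (hT : 0 < T)
    (hdη : d * η ≤ 1 / 10)
    (h : T ≤ (-η + √(η ^ 2 + 8 * (1 - 2 * d * η) / C)) / (2 * (1 - 2 * d * η))) :
    T ^ 2 * L ≤ 5 / 2 := by
  have hC := hL.trans_le hLC
  set w := 1 - 2 * d * η with hw
  -- Squaring the bound on T yields T² C ≤ 2/w, and w ≥ 4/5 makes this 5/2.
  have hw0 : 4 / 5 ≤ w := by linarith
  rw [le_div_iff₀ (by linarith)] at h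
  have h1 : 2 * w * T + η ≤ √(η ^ 2 + 8 * w / C) := by linarith
  have h2 := (Real.le_sqrt' (by nlinarith)).1 h1
  have h3 : 4 * w ^ 2 * T ^ 2 ≤ 8 * w / C := by
    have : 0 ≤ w * T * η := by
      have : 0 ≤ w := by linarith
      positivity
    nlinarith
  rw [le_div_iff₀ hC] at h3
  have h4 : w * (4 * w * T ^ 2 * C) ≤ w * 8 := by linarith
  have h5 := le_of_mul_le_mul_left h4 (by linarith)
  have h6 : T ^ 2 * L ≤ T ^ 2 * C := by gcongr
  have h7 : 4 / 5 * (T ^ 2 * C) ≤ w * (T ^ 2 * C) := by gcongr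
  linarith

/-- T need not be small enough for the energy estimates, so the end of the restarts is deduced from
convergence: the optimal gain is interior to the sublevel set and the proposed Euler points tend to
it. -/
lemma Standing.eventually_euler (hP : P.Standing) (hn : 0 < n)
    {Kstar : Matrix (Fin m) (Fin n) ℝ} (hopt : P.IsOptimal Kstar) {α : ℝ}
    (hα : P.cost Kstar < α) {d T η : ℝ} {z : ℕ → GainState m n}
    (hz : ∀ k, z (k + 1) = momentumStep (matGrad P.cost) (P.sublevel α) d T η (z k))
    (hlim : Tendsto (fun k => equilDist Kstar (z k)) atTop (𝓝 0)) :
    ∀ᶠ k in atTop, z (k + 1) = momentumEuler (matGrad P.cost) d T (z k) := by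
  have hg0 : matGrad P.cost Kstar = 0 := by
    rw [hP.matGrad_cost hn hopt.1, hP.grad_eq_zero hn hopt]
  obtain ⟨h1, h2⟩ := tendsto_of_equilDist hlim
  have h3 : Tendsto (fun k => matGrad P.cost (z k).1) atTop (𝓝 0) := by
    have := (hP.contDiffAt_matGrad (k := 0) hn hopt.1).continuousAt.tendsto.comp h1
    rwa [hg0] at this
  have h4 : Tendsto (fun k => (momentumEuler (matGrad P.cost) d T (z k)).1) atTop (𝓝 Kstar) := by
    have := h1.add (((h2.const_smul (1 - 2 * d * T)).sub (h3.const_smul T)).const_smul T)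
    rwa [smul_zero, smul_zero, sub_zero, smul_zero, add_zero] at this
  have h5 : P.sublevel α ∈ 𝓝 Kstar := by
    filter_upwards [(hP.isOpen_stab hn).mem_nhds hopt.1,
      (hP.hasFDerivAt_cost hn hopt.1).continuousAt.eventually_lt continuousAt_const hα]
      with K a b using ⟨a, b.le⟩
  filter_upwards [h4.eventually h5] with k hk
  rw [hz, momentumStep_of_mem hk]

/-- Local linear convergence of the Euler iterates near the optimal gain. -/
lemma Standing.equilDist_isBigO (hP : P.Standing) (hm : 0 < m) (hn : 0 < n)
    {Kstar : Matrix (Fin m) (Fin n) ℝ} (hopt : P.IsOptimal Kstar) {d T D : ℝ} (hD : 0 < D)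
    (hd : 0 < d) (hT : 0 < T) (hdT : d * T ≤ 1 / 100)
    (hTL : T ^ 2 * P.smoothConst (P.cost Kstar) ≤ 5 / 2)
    (hdD : d ^ 2 ≤ D ^ 2 * (4 * P.plConst (P.cost Kstar) (P.cost Kstar)))
    {z : ℕ → GainState m n}
    (hz : ∀ᶠ k in atTop, z (k + 1) = momentumEuler (matGrad P.cost) d T (z k))
    (hlim : Tendsto (fun k => equilDist Kstar (z k)) atTop (𝓝 0)) :
    (fun k => equilDist Kstar (z k)) =O[atTop]
      fun k : ℕ => Real.exp (-(couplingConst D * d * T / 60) * k) := by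
  have hg0 := hP.grad_eq_zero hn hopt
  have hr := (hP.grad_eq_zero_iff hopt.1).1 hg0
  have hμ := hP.plConst_pos hm hn hopt.1 hr
  have hL := hP.smoothConst_pos hm hn (hP.cost_pos hn hopt.1)
  have hH := hP.fderiv_grad hn hopt.1 hr
  have hsymm : ∀ U V, inner ℝ (fderiv ℝ P.grad Kstar U) V =
      inner ℝ U (fderiv ℝ P.grad Kstar V) := by
    intro U V
    rw [hH, hH]
    exact inner_hessian_symm hP hopt.1 U V
  have hlow : ∀ V, 4 * P.plConst (P.cost Kstar) (P.cost Kstar) * ‖V‖ ^ 2 ≤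
      inner ℝ (fderiv ℝ P.grad Kstar V) V := by
    intro V
    rw [hH]
    exact hP.plConst_mul_le hm hn hopt.1 hr V
  have hup : ∀ V, inner ℝ (fderiv ℝ P.grad Kstar V) V ≤
      P.smoothConst (P.cost Kstar) * ‖V‖ ^ 2 := by
    intro V
    rw [hH]
    exact hP.le_smoothConst_mul hm hn hopt.1 V
  have hnn : ∀ V, 0 ≤ inner ℝ (fderiv ℝ P.grad Kstar V) V := fun V =>
    le_trans (by positivity) (hlow V)
  refine equilDist_isBigO_of_tendsto (μ := 4 * P.plConst (P.cost Kstar) (P.cost Kstar)) hsymm hD hd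
    hT (by positivity) hdT hlow (fun V => ?_) (fun V => ?_) (hP.hasFDerivAt_matGrad hn hopt.1)
    (by rw [hP.matGrad_cost hn hopt.1, hg0]) hz hlim
  · rw [norm_smul, mul_pow, Real.norm_eq_abs, sq_abs]
    have h1 := mul_le_mul_of_nonneg_left (norm_sq_le_of_symmetric hsymm hL hnn hup V) (sq_nonneg T)
    exact h1.trans ((mul_assoc _ _ _).symm.le.trans (mul_le_mul_of_nonneg_right hTL (hnn V)))
  · have h1 := mul_le_mul_of_nonneg_right hdD (sq_nonneg ‖V‖)
    exact h1.trans ((mul_assoc _ _ _).le.trans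
      (mul_le_mul_of_nonneg_left (hlow V) (sq_nonneg D)))

/-- Restarted method from a level above the optimal value. -/
lemma Standing.exists_restart_of_lt (hP : P.Standing) (hm : 0 < m) (hn : 0 < n)
    {Kstar Kinit K₀ : Matrix (Fin m) (Fin n) ℝ} {Cv : Set (Matrix (Fin m) (Fin n) ℝ)}
    (hopt : P.IsOptimal Kstar) (hKinit : Kinit ∈ P.stab) (hCv : Convex ℝ Cv)
    (hCM : Cv ⊆ P.sublevel (P.cost Kinit)) (hK₀ : K₀ ∈ P.stab)
    (hSC : P.sublevel (P.cost K₀) ⊆ Cv) (hlt : P.cost Kstar < P.cost K₀) {d D : ℝ} (hD : 0 < D)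
    (hd : 0 < d) (hdD : d ^ 2 ≤ D ^ 2 * (4 * P.plConst (P.cost Kstar) (P.cost Kstar))) :
    ∃ η₀ : ℝ, 0 < η₀ ∧ ∀ η : ℝ, 0 < η → η ≤ η₀ →
      (∃ Tmax : ℝ, P.IsMaxStep d η (P.cost K₀) (Kstar, 0) Tmax) ∧
      ∀ Tmax : ℝ, P.IsMaxStep d η (P.cost K₀) (Kstar, 0) Tmax →
        ∀ T : ℝ, 0 < T → d * T ≤ 1 / 100 → T ≤ min Tmax (P.stepBound d η (P.cost Kinit)) →
          ∀ z : GainState m n, z.1 ∈ P.sublevel (P.cost K₀) →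
            (fun k : ℕ => stateDist (P.iterates d 0 T η (P.cost K₀) z k) (Kstar, 0))
              =O[atTop] fun k : ℕ => Real.exp (-(couplingConst D * d * T / 60) * k) := by
  have hL := hP.smoothConst_pos hm hn (hP.cost_pos hn hopt.1)
  obtain ⟨C, hland⟩ := hP.exists_landscape hm hn hopt hCv hCM hK₀ hSC
  obtain ⟨η₁, hη₁, Tm, hTm, hstab⟩ := hland.exists_maxStep hlt hd
  -- The second entry gives d η ≤ 1/10, as `smoothConst_mul_sq_le` requires.
  refine ⟨min η₁ (1 / (10 * d)), by positivity, fun η hη hηle => ⟨⟨Tm, hTm, ?_⟩, ?_⟩⟩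
  · intro T hT hTle
    simp only [stateDist_iterates]
    simp only [stateDist_eq]
    exact hstab η hη (hηle.trans (min_le_left _ _)) T hT hTle
  · rintro Tmax ⟨_, hmax⟩ T hT hdT hTmin z hz
    have hlim := (hmax T hT (hTmin.trans (min_le_left _ _))).2 z hz
    simp only [stateDist_iterates] at hlim ⊢
    have hdη : d * η ≤ 1 / 10 := by
      have := hηle.trans (min_le_right _ _)
      rw [le_div_iff₀ (by positivity)] at this
      linarith
    have hTL := smoothConst_mul_sq_le hL
      (hP.smoothConst_mono hm hn (hP.cost_pos hn hopt.1).le (hopt.2 Kinit hKinit)) hη.le hT hdη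
      (hTmin.trans (min_le_right _ _))
    have hev := hP.eventually_euler hn hopt hlt
      (z := fun k => (momentumStep (matGrad P.cost) (P.sublevel (P.cost K₀)) d T η)^[k] z)
      (fun k => Function.iterate_succ_apply' _ _ _) hlim
    exact hP.equilDist_isBigO hm hn hopt hD hd hT hdT hTL hdD hev hlim

/-- Restarted method from the optimal level. -/
lemma Standing.restart_of_le (hP : P.Standing) (hm : 0 < m) (hn : 0 < n)
    {Kstar K₀ : Matrix (Fin m) (Fin n) ℝ} (hopt : P.IsOptimal Kstar) (hK₀ : K₀ ∈ P.stab)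
    (hge : P.cost K₀ ≤ P.cost Kstar) (d η : ℝ) :
    (∃ Tmax : ℝ, P.IsMaxStep d η (P.cost K₀) (Kstar, 0) Tmax) ∧
      ∀ T : ℝ, 0 < T → ∀ z : GainState m n, z.1 ∈ P.sublevel (P.cost K₀) →
        ∀ g : ℕ → ℝ, (fun k : ℕ => stateDist (P.iterates d 0 T η (P.cost K₀) z k) (Kstar, 0))
          =O[atTop] g := by
  have hS := hP.sublevel_eq_singleton hm hn hopt hge hK₀
  refine ⟨⟨1, one_pos, fun T hT _ => ?_⟩, ?_⟩
  · simp only [stateDist_iterates]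
    simp only [stateDist_eq, hS]
    refine ⟨fun ε hε => ⟨ε, hε, fun z hz hzε k => ?_⟩, fun z hz => ?_⟩
    · rcases k with _ | k
      · exact hzε
      · rwa [equilDist_singleton hP hn hopt hT hz]
    · refine (tendsto_add_atTop_iff_nat 1).1 ?_
      simp only [equilDist_singleton hP hn hopt hT hz]
      exact tendsto_const_nhds
  · intro T hT z hz g
    simp only [stateDist_iterates, hS] at hz ⊢
    refine EventuallyEq.trans_isBigO (f₂ := fun _ => (0 : ℝ)) ?_ (isBigO_zero _ _)
    -- Only the initial state can differ from the equilibrium, so every comparison function works.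
    filter_upwards [eventually_ge_atTop 1] with k hk
    obtain ⟨j, rfl⟩ := Nat.exists_eq_add_of_le' hk
    exact equilDist_singleton hP hn hopt hT hz j

end SLQR

end

theorem theorem6 (a₁ a₂ ℓ : ℝ) (ha₁ : 0 < a₁) (ha₂ : a₁ ≤ a₂) (hℓ : 0 < ℓ) :
    ∃ c : ℝ, 0 < c ∧ ∃ τ : ℝ, 0 < τ ∧
      ∀ (m n : ℕ), 0 < m → 0 < n →
      ∀ (P : SLQR m n), P.Standing →
      ∀ (Kstar Kinit K₀ : Matrix (Fin m) (Fin n) ℝ) (Cv : Set (Matrix (Fin m) (Fin n) ℝ)),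
        P.IsOptimal Kstar →
        Kinit ∈ P.stab →
        Convex ℝ Cv → Kstar ∈ Cv → Cv ⊆ P.sublevel (P.cost Kinit) →
        K₀ ∈ P.stab → P.sublevel (P.cost K₀) ⊆ Cv →
        ℓ ≤ P.smoothConst (P.cost Kstar) →
      ∀ d : ℝ,
        a₁ / √(P.condNumber (P.cost Kstar)) ≤ d →
        d ≤ a₂ / √(P.condNumber (P.cost Kstar)) →
      ∃ η₀ : ℝ, 0 < η₀ ∧ ∀ η : ℝ, 0 < η → η ≤ η₀ →
        (∃ Tmax : ℝ, P.IsMaxStep d η (P.cost K₀) (Kstar, 0) Tmax) ∧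
        ∀ Tmax : ℝ, P.IsMaxStep d η (P.cost K₀) (Kstar, 0) Tmax →
          ∀ T : ℝ, 0 < T → T ≤ τ → T ≤ min Tmax (P.stepBound d η (P.cost Kinit)) →
            ∀ z : GainState m n, z.1 ∈ P.sublevel (P.cost K₀) →
              (fun k : ℕ => stateDist (P.iterates d 0 T η (P.cost K₀) z k) (Kstar, 0))
                =O[atTop]
              (fun k : ℕ =>
                Real.exp (-(c * T / √(P.condNumber (P.cost Kstar))) * (k : ℝ))) := by
  have ha₂' : 0 < a₂ := ha₁.trans_le ha₂
  -- From d² ≤ a₂²μ/L and L ≥ ℓ: the bound a₂²μ/ℓ is D²·4μ.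
  set D : ℝ := a₂ / (2 * √ℓ) with hDdef
  have hsℓ : 0 < √ℓ := Real.sqrt_pos.2 hℓ
  have hD : 0 < D := by positivity
  have hc := couplingConst_pos D
  -- The rate `couplingConst D` · d T/60 is bounded below through d ≥ a₁/√κ. The choice of τ gives d
  -- T ≤ 1/100, because √κ ≥ 2 implies d ≤ a₂/2.
  refine ⟨couplingConst D * a₁ / 60, by positivity, 1 / (50 * a₂), by positivity, ?_⟩
  intro m n hm hn P hP Kstar Kinit K₀ Cv hopt hKinit hCv _ hCM hK₀ hSC hℓL d hd1 hd2
  have hr := (hP.grad_eq_zero_iff hopt.1).1 (hP.grad_eq_zero hn hopt)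
  have hκ := hP.four_le_condNumber hm hn hopt.1 hr
  have hμ := hP.plConst_pos hm hn hopt.1 hr
  have hL := hℓ.trans_le hℓL
  have hsκ : 2 ≤ √(P.condNumber (P.cost Kstar)) := Real.le_sqrt_of_sq_le (by linarith)
  have hsκ0 : 0 < √(P.condNumber (P.cost Kstar)) := by linarith
  have hd : 0 < d := lt_of_lt_of_le (by positivity) hd1
  have hdκ : d * √(P.condNumber (P.cost Kstar)) ≤ a₂ := (le_div_iff₀ hsκ0).1 hd2
  have hdD : d ^ 2 ≤ D ^ 2 * (4 * P.plConst (P.cost Kstar) (P.cost Kstar)) := by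
    have h1 : (d * √(P.condNumber (P.cost Kstar))) ^ 2 ≤ a₂ ^ 2 := by gcongr
    rw [mul_pow, Real.sq_sqrt (by linarith), SLQR.condNumber, mul_div_assoc', div_le_iff₀ hμ] at h1
    have h2 : d ^ 2 * ℓ ≤ d ^ 2 * P.smoothConst (P.cost Kstar) := by gcongr
    rw [hDdef, div_pow, mul_pow, Real.sq_sqrt hℓ.le, div_mul_eq_mul_div,
      le_div_iff₀ (by positivity)]
    linarith
  -- At the optimal level the sublevel set has no interior point, so that case is treated apart.
  rcases lt_or_ge (P.cost Kstar) (P.cost K₀) with hlt | hge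
  · obtain ⟨η₀, hη₀, h⟩ :=
      hP.exists_restart_of_lt hm hn hopt hKinit hCv hCM hK₀ hSC hlt hD hd hdD
    refine ⟨η₀, hη₀, fun η hη hηle => ⟨(h η hη hηle).1, ?_⟩⟩
    intro Tmax hmax T hT hTτ hTmin z hz
    have hdT : d * T ≤ 1 / 100 := by
      rw [le_div_iff₀ (by positivity)] at hTτ
      have h1 : d * 2 ≤ a₂ := le_trans (by gcongr) hdκ
      have h2 : d * 2 * T ≤ a₂ * T := by gcongr
      linarith
    refine ((h η hη hηle).2 Tmax hmax T hT hdT hTmin z hz).trans ?_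
    refine IsBigO.of_bound 1 (Eventually.of_forall fun k => ?_)
    rw [one_mul, Real.norm_eq_abs, Real.norm_eq_abs, Real.abs_exp, Real.abs_exp,
      Real.exp_le_exp]
    refine mul_le_mul_of_nonneg_right (neg_le_neg ?_) (Nat.cast_nonneg k)
    calc couplingConst D * a₁ / 60 * T / √(P.condNumber (P.cost Kstar))
        = couplingConst D * (a₁ / √(P.condNumber (P.cost Kstar))) * T / 60 := by ring
      _ ≤ couplingConst D * d * T / 60 := by gcongr
  · refine ⟨1, one_pos, fun η _ _ => ?_⟩
    have h := hP.restart_of_le hm hn hopt hK₀ hge d η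
    exact ⟨h.1, fun _ _ T hT _ _ z hz => h.2 T hT z hz _⟩
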